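/- Let $N$ be a lattice (a free abelian group of finite rank) and $N_{\mathbb R}=N\otimes\mathbb R$. Fans are finite, nonempty, strongly convex, rational and polyhedral. For a cone $\sigma$, let $N_\sigma$ be the group of lattice points in its linear span; if $\tau$ is a facet of $\sigma$, let $n_{\sigma,\tau}$ be a lattice point in the relative interior of $\sigma$ whose image generates $N_\sigma/N_\tau$. For a fan $\Sigma$, let $N_\Sigma$ be the group of lattice points in the linear span of its support. A *tropical fan* $(\Sigma,\omega)$ of dimension $d$ is a pure $d$-dimensional fan with a weight function $\omega:\Sigma_d\to\mathbb Z_{>0}$ on its $d$-dimensional cones such that $\sum_{\sigma\succ\tau}\omega(\sigma)n_{\sigma,\tau}\in N_\tau$ for every $(d-1)$-dimensional cone $\tau$. It is *reduced* if $\omega\equiv 1$, and *complete* if its support is $N_{\mathbb R}$. A *tropical fan cycle* is a class of tropical fans modulo common tropical (weight-preserving) refinement. An *isomorphism of tropical fans* $\Sigma\to\Sigma'$ is a lattice isomorphism $N_\Sigma\to N_{\Sigma'}$ which identifies the cones and the weights; two tropical fan cycles are *isomorphic* if some fan structures on them are isomorphic. The *star fan* $\Sigma^\sigma$ at $\sigma\in\Sigma$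 is the fan in $N_{\mathbb R}/N_{\sigma,\mathbb R}$ (with the lattice $N/N_\sigma$) of the images of the cones containing $\sigma$, with the weights inherited from $\Sigma$. A *piecewise integral linear function* $\varphi$ on $\Sigma$ is a real function on the support whose restriction to each cone $\sigma$ agrees with some $\varphi_\sigma\in\operatorname{Hom}(N_\sigma,\mathbb Z)$. Its *divisor* $\operatorname{div}(\varphi)$ is the fan formed by the $(d-1)$-dimensional cones $\tau$ with $$\operatorname{ord}_\tau(\varphi)=\varphi_\tau\Big(\sum_{\sigma\succ\tau}\omega(\sigma)n_{\sigma,\tau}\Big)-\sum_{\sigma\succ\tau}\varphi_\sigma(\omega(\sigma)n_{\sigma,\tau})\neq 0$$ and their faces, with weights $\operatorname{ord}_\tau(\varphi)$; it is *trivial* if $\operatorname{ord}_\tau(\varphi)=0$ for all $\tau$. The *tropical modification* of $\Sigma$ with respect to $\varphi$ is the weighted fan in $N_{\mathbb R}\times\mathbb R$ with the cones $\tilde\sigma=\{(x,\varphi(x)):x\in\sigma\}$ for $\sigma\in\Sigma$, with weights $\omega(\sigma)$, and $\tau_{\ge}=\tilde\tau+\mathbb R_{\ge 0}(0,1)$ for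 $\tau\in\operatorname{div}(\varphi)$, with weights $\operatorname{ord}_\tau(\varphi)$. *Quasilinearity* is defined inductively: a reduced tropical fan cycle is quasilinear if it is isomorphic to a complete tropical fan cycle, or to the tropical modification of a quasilinear tropical fan cycle with respect to a piecewise integral linear function (on some fan structure) whose divisor is quasilinear; a tropical fan is quasilinear if the tropical fan cycle that it represents is. **Theorem.** Every star fan of a quasilinear tropical fan is quasilinear. Moreover, the property of being a quasilinear tropical fan is 1. intrinsic to the support: if two tropical fans represent the same tropical fan cycle, then one is quasilinear if and only if the other is; 2. local: every star fan of a quasilinear tropical fan is quasilinear; 3. stably invariant: for every tropical fan $\Sigma$ and every complete fan $\Delta$ of dimension $\ge 1$ (with all weights one), $\Sigma$ is quasilinear if and only if $\Sigma\times\Delta$ is quasilinear; 4. preserved by tropical modifications: if $\Sigma$ is quasilinear and $\varphi$ is a piecewise integral linear function on $\Sigma$ whose divisor is trivial or quasilinear, then the tropical modification of $\Sigma$ with respect to $\varphi$ is quasilinear. -/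

import Mathlib

universe u v

namespace Trop

/-! ### Lattices and rational polyhedral cones -/

/-- `L` is a (full rank) lattice in the real vector space `E`: the group generated by a finite
real basis of `E`. In the usual notation, `L` is `N` and `E` is `N_ℝ`. -/
def IsLattice {E : Type u} [AddCommGroup E] [Module ℝ E] (L : AddSubgroup E) : Prop :=
  ∃ (n : ℕ) (b : Module.Basis (Fin n) ℝ E), L = AddSubgroup.closure (Set.range b)

/-- The real linear span of a cone. -/
def coneSpan {E : Type u} [AddCommGroup E] [Module ℝ E] (σ : PointedCone ℝ E) : Submodule ℝ E :=
  Submodule.span ℝ (σ : Set E)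

/-- The dimension of a cone. -/
noncomputable def coneDim {E : Type u} [AddCommGroup E] [Module ℝ E] (σ : PointedCone ℝ E) : ℕ :=
  Module.finrank ℝ (coneSpan σ)

/-- The lattice `N_σ` of a cone: the lattice points in its linear span. (For a rational cone this
is the subgroup generated by the lattice points of the cone.) -/
def coneLattice {E : Type u} [AddCommGroup E] [Module ℝ E] (L : AddSubgroup E)
    (σ : PointedCone ℝ E) : AddSubgroup E :=
  L ⊓ (coneSpan σ).toAddSubgroup

/-- Strongly convex rational polyhedral cones: generated by finitely many lattice points and
containing no line. -/
structure IsRationalCone {E : Type u} [AddCommGroup E] [Module ℝ E] (L : AddSubgroup E)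
    (σ : PointedCone ℝ E) : Prop where
  generated : ∃ s : Set E, s.Finite ∧ s ⊆ (L : Set E) ∧ σ = PointedCone.hull ℝ s
  salient : ∀ x ∈ σ, -x ∈ σ → x = 0

/-- `x` lies in the relative interior of the polyhedral cone `σ`: it lies in `σ` and in no proper
face of `σ`. -/
def InRelInterior {E : Type u} [AddCommGroup E] [Module ℝ E] (σ : PointedCone ℝ E) (x : E) :
    Prop :=
  x ∈ σ ∧ ∀ ρ : PointedCone ℝ E, ρ.IsFaceOf σ → x ∈ ρ → ρ = σ

/-- `v` is a possible choice of `n_{σ,τ}`: a lattice point in the relative interior of `σ` whose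
image generates `N_σ / N_τ`. -/
def IsNormalVector {E : Type u} [AddCommGroup E] [Module ℝ E] (L : AddSubgroup E)
    (σ τ : PointedCone ℝ E) (v : E) : Prop :=
  v ∈ L ∧ InRelInterior σ v ∧
    coneLattice L σ = coneLattice L τ ⊔ AddSubgroup.zmultiples v

open Classical in
/-- A choice of the vector `n_{σ,τ}`. -/
noncomputable def normalVector {E : Type u} [AddCommGroup E] [Module ℝ E] (L : AddSubgroup E)
    (σ τ : PointedCone ℝ E) : E :=
  if h : ∃ v, IsNormalVector L σ τ v then h.choose else 0

/-! ### Weighted fans and tropical fans -/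

/-- The data of a fan with integer weights on its cones, relative to a lattice `L` in `E`: a set of
cones, the dimension `dim`, and a weight function, of which only the values on the
`dim`-dimensional cones of the fan are relevant. The axioms are in `IsFan` and `IsTropical`. -/
structure WeightedFan {E : Type u} [AddCommGroup E] [Module ℝ E] (L : AddSubgroup E) where
  cones : Set (PointedCone ℝ E)
  dim : ℕ
  weight : PointedCone ℝ E → ℤ

namespace WeightedFan

section Basic

variable {E : Type u} [AddCommGroup E] [Module ℝ E] {L : AddSubgroup E}

/-- The top-dimensional cones. -/
def topCones (S : WeightedFan L) : Set (PointedCone ℝ E) :=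
  {σ | σ ∈ S.cones ∧ coneDim σ = S.dim}

/-- The cones of codimension one. -/
def walls (S : WeightedFan L) : Set (PointedCone ℝ E) :=
  {τ | τ ∈ S.cones ∧ coneDim τ + 1 = S.dim}

/-- The top-dimensional cones that have `τ` as a face. -/
def topConesAbove (S : WeightedFan L) (τ : PointedCone ℝ E) : Set (PointedCone ℝ E) :=
  {σ | σ ∈ S.topCones ∧ τ.IsFaceOf σ}

/-- The support `|Σ|`. -/
def support (S : WeightedFan L) : Set E :=
  {x | ∃ σ ∈ S.cones, x ∈ σ}

/-- The lattice `N_Σ` of lattice points in the linear span of the support. -/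
def fanLattice (S : WeightedFan L) : AddSubgroup E :=
  L ⊓ (Submodule.span ℝ S.support).toAddSubgroup

/-- The cones form a (finite, nonempty) fan of strongly convex rational polyhedral cones. -/
structure IsFan (S : WeightedFan L) : Prop where
  finite : S.cones.Finite
  nonempty : S.cones.Nonempty
  rational : ∀ σ ∈ S.cones, IsRationalCone L σ
  face_mem : ∀ σ ∈ S.cones, ∀ τ : PointedCone ℝ E, τ.IsFaceOf σ → τ ∈ S.cones
  inter_face : ∀ σ ∈ S.cones, ∀ σ' ∈ S.cones, (σ ⊓ σ').IsFaceOf σ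

/-- Tropical fans: pure dimensional fans with positive integer weights on the top-dimensional
cones, balanced around every cone of codimension one. -/
structure IsTropical (S : WeightedFan L) : Prop where
  lattice : IsLattice L
  isFan : S.IsFan
  pure : ∀ σ ∈ S.cones, ∃ σ' ∈ S.topCones, σ.IsFaceOf σ'
  weight_pos : ∀ σ ∈ S.topCones, 0 < S.weight σ
  balanced : ∀ τ ∈ S.walls,
    ∑ᶠ σ ∈ S.topConesAbove τ, S.weight σ • normalVector L σ τ ∈ coneLattice L τ

/-- All weights are one. -/
def IsReduced (S : WeightedFan L) : Prop := ∀ σ ∈ S.topCones, S.weight σ = 1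

/-- The support is the whole space. -/
def IsComplete (S : WeightedFan L) : Prop := S.support = Set.univ

/-! ### Tropical equivalence; tropical fan cycles -/

/-- `R` is a tropical refinement of `S`. -/
structure IsRefinement (R S : WeightedFan L) : Prop where
  tropical_left : R.IsTropical
  tropical_right : S.IsTropical
  support_eq : R.support = S.support
  subdivides : ∀ ρ ∈ R.cones, ∃ σ ∈ S.cones, ρ ≤ σ
  weight_eq : ∀ ρ ∈ R.topCones, ∀ σ ∈ S.topCones, ρ ≤ σ → R.weight ρ = S.weight σ

/-- Two tropical fans are tropically equivalent, i.e. they represent the same tropical fan cycle,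
if they have a common tropical refinement. -/
def TropEquiv (S S' : WeightedFan L) : Prop :=
  ∃ R : WeightedFan L, R.IsRefinement S ∧ R.IsRefinement S'

/-! ### Star fans and products -/

/-- The star fan at a cone `σ`: the fan in `N_ℝ / N_{σ,ℝ}`, with the image lattice, whose cones are
the images of the cones containing `σ`, with the weights inherited from `S`. (The sum in the weight
has one term, as each cone of the star fan is the image of exactly one such cone.) -/
noncomputable def star (S : WeightedFan L) (σ : PointedCone ℝ E) :
    WeightedFan (L.map (coneSpan σ).mkQ.toAddMonoidHom) where
  cones := {c | ∃ τ ∈ S.cones, σ ≤ τ ∧ c = τ.map (coneSpan σ).mkQ}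
  dim := S.dim - coneDim σ
  weight c := ∑ᶠ τ ∈ {τ | τ ∈ S.cones ∧ σ ≤ τ ∧ c = τ.map (coneSpan σ).mkQ}, S.weight τ

/-- The product fan, with cones `σ × σ'` and weights `ω(σ) ω'(σ')`. -/
noncomputable def prod {E' : Type v} [AddCommGroup E'] [Module ℝ E'] {L' : AddSubgroup E'}
    (S : WeightedFan L) (S' : WeightedFan L') : WeightedFan (L.prod L') where
  cones := {c | ∃ σ ∈ S.cones, ∃ σ' ∈ S'.cones, c = Submodule.prod σ σ'}
  dim := S.dim + S'.dim
  weight c := S.weight (c.map (LinearMap.fst ℝ E E')) * S'.weight (c.map (LinearMap.snd ℝ E E'))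

/-! ### Isomorphisms -/

/-- The linear maps `f` and `g` induce mutually inverse isomorphisms between `N_Σ` and `N_Σ'`, and
these are an isomorphism of weighted fans. (Every isomorphism between the lattices spanned by two
fans is induced by linear maps between the ambient spaces.) -/
structure IsFanIso {E' : Type v} [AddCommGroup E'] [Module ℝ E'] {L' : AddSubgroup E'}
    (S : WeightedFan L) (S' : WeightedFan L') (f : E →ₗ[ℝ] E') (g : E' →ₗ[ℝ] E) : Prop where
  map_lattice : ∀ x ∈ S.fanLattice, f x ∈ S'.fanLattice
  inv_lattice : ∀ y ∈ S'.fanLattice, g y ∈ S.fanLattice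
  left_inv : ∀ x ∈ S.fanLattice, g (f x) = x
  right_inv : ∀ y ∈ S'.fanLattice, f (g y) = y
  map_cone : ∀ σ ∈ S.cones, σ.map f ∈ S'.cones
  inv_cone : ∀ σ' ∈ S'.cones, σ'.map g ∈ S.cones
  weight_map : ∀ σ ∈ S.topCones, S'.weight (σ.map f) = S.weight σ
  weight_inv : ∀ σ' ∈ S'.topCones, S.weight (σ'.map g) = S'.weight σ'

/-- The tropical fan cycles represented by `S` and `S'` are isomorphic: some fan structures on
them are isomorphic tropical fans. -/
def CycleIso {E' : Type v} [AddCommGroup E'] [Module ℝ E'] {L' : AddSubgroup E'}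
    (S : WeightedFan L) (S' : WeightedFan L') : Prop :=
  ∃ (R : WeightedFan L) (R' : WeightedFan L') (f : E →ₗ[ℝ] E') (g : E' →ₗ[ℝ] E),
    S.TropEquiv R ∧ S'.TropEquiv R' ∧ IsFanIso R R' f g

/-! ### Divisors and tropical modifications -/

/-- `φ` is (on the support of `S`) a piecewise integral linear function on the fan `S`. Only the
values on the support matter. -/
def IsPiecewiseLinear (S : WeightedFan L) (φ : E → ℝ) : Prop :=
  ∀ σ ∈ S.cones, ∃ ℓ : E →ₗ[ℝ] ℝ,
    (∀ x ∈ coneLattice L σ, ∃ k : ℤ, ℓ x = k) ∧ ∀ x ∈ σ, φ x = ℓ x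

open Classical in
/-- A linear function that agrees with `φ` on the cone `σ` (zero if there is none). Its values on
the span of `σ` do not depend on the choice. -/
noncomputable def linearPart (φ : E → ℝ) (σ : PointedCone ℝ E) : E →ₗ[ℝ] ℝ :=
  if h : ∃ ℓ : E →ₗ[ℝ] ℝ, ∀ x ∈ σ, φ x = ℓ x then h.choose else 0

/-- The order of vanishing `ord_τ(φ)`. It is an integer if `φ` is piecewise integral linear. -/
noncomputable def ord (S : WeightedFan L) (φ : E → ℝ) (τ : PointedCone ℝ E) : ℝ :=
  linearPart φ τ (∑ᶠ σ ∈ S.topConesAbove τ, S.weight σ • normalVector L σ τ)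
    - ∑ᶠ σ ∈ S.topConesAbove τ, linearPart φ σ (S.weight σ • normalVector L σ τ)

/-- The divisor `div(φ)` as a weighted fan: the codimension one cones with nonzero order of
vanishing, together with their faces, weighted by the order of vanishing. -/
noncomputable def divisor (S : WeightedFan L) (φ : E → ℝ) : WeightedFan L where
  cones := {ρ | ∃ τ ∈ S.walls, S.ord φ τ ≠ 0 ∧ ρ.IsFaceOf τ}
  dim := S.dim - 1
  weight τ := ⌊S.ord φ τ⌋

/-- `div(φ)` is trivial, i.e. the zero cycle. -/
def IsTrivialDivisor (S : WeightedFan L) (φ : E → ℝ) : Prop := ∀ τ ∈ S.walls, S.ord φ τ = 0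

open Classical in
/-- The tropical modification of `S` with respect to `φ`, a weighted fan in `N_ℝ × ℝ` with the
lattice `N × ℤ`. Its cones are the graphs of `φ` over the cones of `S`, and the sets of points on
or above the graph over the cones of `div(φ)`; the latter are those that contain `(0, 1)`. -/
noncomputable def modification (S : WeightedFan L) (φ : E → ℝ) :
    WeightedFan (L.prod (AddSubgroup.zmultiples (1 : ℝ))) where
  cones :=
    {c | ∃ σ ∈ S.cones, (c : Set (E × ℝ)) = {p | p.1 ∈ σ ∧ p.2 = φ p.1}} ∪
    {c | ∃ τ ∈ (S.divisor φ).cones, (c : Set (E × ℝ)) = {p | p.1 ∈ τ ∧ φ p.1 ≤ p.2}}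
  dim := S.dim
  weight c :=
    if ((0 : E), (1 : ℝ)) ∈ c then (S.divisor φ).weight (c.map (LinearMap.fst ℝ E ℝ))
    else S.weight (c.map (LinearMap.fst ℝ E ℝ))

end Basic

/-! ### Quasilinear fans -/

/-- Quasilinear tropical fans. A reduced tropical fan cycle is quasilinear if it is isomorphic to a
complete tropical fan cycle, or to a tropical modification of a quasilinear tropical fan cycle
along a quasilinear tropical divisor; a tropical fan is quasilinear if the tropical fan cycle that
it represents is. (`CycleIso` only depends on the cycles, and `T` below is an arbitrary fan
structure on which `φ` is piecewise integral linear.) -/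
inductive IsQuasilinear : ∀ {E : Type u} [AddCommGroup E] [Module ℝ E] {L : AddSubgroup E},
    WeightedFan L → Prop
  | complete {E E' : Type u} [AddCommGroup E] [Module ℝ E] [AddCommGroup E'] [Module ℝ E']
      {L : AddSubgroup E} {L' : AddSubgroup E'} (S : WeightedFan L) (T : WeightedFan L')
      (hS : S.IsTropical) (hred : S.IsReduced) (hT : T.IsTropical) (hcomplete : T.IsComplete)
      (hiso : S.CycleIso T) : IsQuasilinear S
  | modification {E E' : Type u} [AddCommGroup E] [Module ℝ E] [AddCommGroup E'] [Module ℝ E']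
      {L : AddSubgroup E} {L' : AddSubgroup E'} (S : WeightedFan L) (T : WeightedFan L')
      (φ : E' → ℝ) (hS : S.IsTropical) (hred : S.IsReduced) (hT : IsQuasilinear T)
      (hφ : T.IsPiecewiseLinear φ) (hdiv : IsQuasilinear (T.divisor φ))
      (hiso : S.CycleIso (T.modification φ)) : IsQuasilinear S

end WeightedFan

/-! ### Properties of tropical fans -/

/-- A property of (weighted) fans, in arbitrary ambient lattices. -/
abbrev FanProperty : Type (u + 1) :=
  ∀ (E : Type u) [AddCommGroup E] [Module ℝ E] (L : AddSubgroup E), WeightedFan L → Prop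

/-- The property only depends on the tropical fan cycle that a tropical fan represents. -/
def FanProperty.IntrinsicToSupport (P : FanProperty.{u}) : Prop :=
  ∀ (E : Type u) [AddCommGroup E] [Module ℝ E] (L : AddSubgroup E) (S S' : WeightedFan L),
    S.IsTropical → S'.IsTropical → S.TropEquiv S' → (P E L S ↔ P E L S')

/-- The property passes to star fans. -/
def FanProperty.IsLocal (P : FanProperty.{u}) : Prop :=
  ∀ (E : Type u) [AddCommGroup E] [Module ℝ E] (L : AddSubgroup E) (S : WeightedFan L),
    S.IsTropical → P E L S → ∀ σ ∈ S.cones, P (E ⧸ coneSpan σ) _ (S.star σ)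

/-- The property is intrinsic to the support, and a tropical fan `S` has it if and only if `S × D`
has it, for every complete fan `D` (with all weights one) of dimension at least one. -/
def FanProperty.StablyInvariant (P : FanProperty.{u}) : Prop :=
  P.IntrinsicToSupport ∧
  ∀ (E E' : Type u) [AddCommGroup E] [Module ℝ E] [AddCommGroup E'] [Module ℝ E']
    (L : AddSubgroup E) (L' : AddSubgroup E') (S : WeightedFan L) (D : WeightedFan L'),
    S.IsTropical → D.IsTropical → D.IsComplete → D.IsReduced → 1 ≤ D.dim →
    (P E L S ↔ P (E × E') _ (S.prod D))

/-- If `S` has the property and `φ` is piecewise integral linear on `S` with `div(φ)` trivial or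
having the property, then the tropical modification of `S` with respect to `φ` has the property. -/
def FanProperty.PreservedByModifications (P : FanProperty.{u}) : Prop :=
  ∀ (E : Type u) [AddCommGroup E] [Module ℝ E] (L : AddSubgroup E) (S : WeightedFan L)
    (φ : E → ℝ), S.IsTropical → P E L S → S.IsPiecewiseLinear φ →
    (S.IsTrivialDivisor φ ∨ P E L (S.divisor φ)) → P (E × ℝ) _ (S.modification φ)

/-- The property of being a quasilinear tropical fan. -/
def quasilinearity : FanProperty.{u} := fun _ _ _ _ S => S.IsQuasilinear

end Trop

/-! A reduced tropical fan cycle is determined by its support, so the proof works with sets.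
`TropSet` describes supports: unions of closed cells of a finite arrangement of integral
functionals, pure dimensional and balanced with weights one. The arrangement may be refined or
coarsened freely (`TropSet.of_cellular`). `QLs` is quasilinearity for sets. It is invariant under
integral isomorphisms of sets (`QLs.of_setIso`), and a reduced tropical fan with quasilinear support
is quasilinear (`QLs.isQuasilinear`). So the property is intrinsic to the support, and the rest goes
by induction on the construction from vector spaces by isomorphisms and modifications
(`QLs.induction`). The link with divisors is that the set obtained from `X` and `φ` by adding
everything above the graph over `D` is balanced exactly when `φ` has order one along `D` and order
zero along the other walls (`PLw.tropA_modSet`, `PLw.sum_dir_eq`).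

Locality. The support of the star at `σ` is the local cone of the support at an interior point of
`σ`, modulo the span of `σ`. The local cone of a modification of `X` along `D` is of one of three
kinds: above the graph it is a local cone of `D` times a line; on the graph over `D` it is the
modification of the local cone of `X` along that of `D`; on the graph outside `D` it is the graph of
the derivative of `φ`, which has trivial divisor. The last kind is harmless once that derivative is
known to be linear, for then the graph is isomorphic to the local cone of `X`. Hence locality is
proved together with `HL`: functions with trivial divisor are linear (`QLs.loc_and_hl`).

On a vector space, `HL` holds because such a function is affine on generic segments, which avoid all
cells of codimension two (`hl_univ`). On a modification, the function is affine on the vertical rays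
with one common slope `c`; subtracting `c` times the vertical coordinate leaves a function on `X`,
again with trivial divisor (`HL.modSet`). The vertical step needs `HL` for local cones of `D` times
a line, so the induction carries `HL` for products of local cones with arbitrary vector spaces.

Vector space factors can be added, since modifications commute with products (`QLs.prod_univ`), and
cancelled (`QLs.slice`): if a modification is invariant under the kernel of an integral projection,
this kernel is a graph over a subspace along which `X` and `D` are invariant and `φ` is additive, so
the slice is a modification of slices. Cancellation gives both the passage from local cones to star
fans and the converse half of stable invariance. Finally, a modification along a quasilinear divisor
is quasilinear because it is balanced, and one along a trivial divisor is by `HL` the graph of a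
linear function. -/

namespace Trop

open Filter Topology

/-! ### Cells of arrangements of functionals, and local cones -/

section Cells

variable {E : Type*} [AddCommGroup E] [Module ℝ E]

/-- The functional `a` takes integral values on the lattice `L`. -/
def IntegralOn (L : AddSubgroup E) (a : E →ₗ[ℝ] ℝ) : Prop := ∀ x ∈ L, ∃ k : ℤ, a x = k

/-- A finite set of functionals, integral on the lattice `L`. -/
structure Arr (L : AddSubgroup E) (A : Set (E →ₗ[ℝ] ℝ)) : Prop where
  finite : A.Finite
  integral : ∀ a ∈ A, IntegralOn L a

lemma Arr.union {L : AddSubgroup E} {A B : Set (E →ₗ[ℝ] ℝ)} (hA : Arr L A) (hB : Arr L B) :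
    Arr L (A ∪ B) :=
  ⟨hA.finite.union hB.finite, fun a ha => ha.elim (hA.integral a) (hB.integral a)⟩

lemma Arr.mono {L : AddSubgroup E} {A B : Set (E →ₗ[ℝ] ℝ)} (hB : Arr L B) (h : A ⊆ B) : Arr L A :=
  ⟨hB.finite.subset h, fun a ha => hB.integral a (h ha)⟩

/-- `y` lies in the closed cell of the arrangement `A` whose relative interior contains `x`. -/
def InCell (A : Set (E →ₗ[ℝ] ℝ)) (x y : E) : Prop :=
  ∀ a ∈ A, (0 ≤ a x → 0 ≤ a y) ∧ (a x ≤ 0 → a y ≤ 0)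

lemma InCell.refl (A : Set (E →ₗ[ℝ] ℝ)) (x : E) : InCell A x x := fun _ _ => ⟨id, id⟩

lemma InCell.trans {A : Set (E →ₗ[ℝ] ℝ)} {x y z : E} (h : InCell A x y) (h' : InCell A y z) :
    InCell A x z :=
  fun a ha => ⟨(h' a ha).1 ∘ (h a ha).1, (h' a ha).2 ∘ (h a ha).2⟩

lemma InCell.mono {A B : Set (E →ₗ[ℝ] ℝ)} (hAB : A ⊆ B) {x y : E} (h : InCell B x y) :
    InCell A x y := fun a ha => h a (hAB ha)

lemma InCell.eq_zero {A : Set (E →ₗ[ℝ] ℝ)} {x y : E} (h : InCell A x y) {a : E →ₗ[ℝ] ℝ}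
    (ha : a ∈ A) (hx : a x = 0) : a y = 0 :=
  le_antisymm ((h a ha).2 hx.le) ((h a ha).1 hx.ge)

lemma inCell_zero (A : Set (E →ₗ[ℝ] ℝ)) (x : E) : InCell A x 0 := fun a _ => by simp

/-- The linear span of the cell of `x`. -/
def Lin (A : Set (E →ₗ[ℝ] ℝ)) (x : E) : Submodule ℝ E where
  carrier := {v | ∀ a ∈ A, a x = 0 → a v = 0}
  add_mem' hv hw a ha hx := by rw [map_add, hv a ha hx, hw a ha hx, add_zero]
  zero_mem' a _ _ := map_zero a
  smul_mem' c v hv a ha hx := by rw [map_smul, hv a ha hx, smul_zero]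

lemma mem_lin {A : Set (E →ₗ[ℝ] ℝ)} {x v : E} : v ∈ Lin A x ↔ ∀ a ∈ A, a x = 0 → a v = 0 :=
  Iff.rfl

lemma self_mem_lin (A : Set (E →ₗ[ℝ] ℝ)) (x : E) : x ∈ Lin A x := fun _ _ => id

lemma InCell.mem_lin {A : Set (E →ₗ[ℝ] ℝ)} {x y : E} (h : InCell A x y) : y ∈ Lin A x :=
  fun _ ha hx => h.eq_zero ha hx

lemma InCell.lin_le {A : Set (E →ₗ[ℝ] ℝ)} {x y : E} (h : InCell A x y) : Lin A y ≤ Lin A x :=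
  fun _ hv a ha hx => hv a ha (h.eq_zero ha hx)

lemma lin_mono {A B : Set (E →ₗ[ℝ] ℝ)} (hAB : A ⊆ B) (x : E) : Lin B x ≤ Lin A x :=
  fun _ hv a ha => hv a (hAB ha)

lemma lin_congr {A : Set (E →ₗ[ℝ] ℝ)} {x y : E} (h : InCell A x y) (h' : InCell A y x) :
    Lin A x = Lin A y := le_antisymm h'.lin_le h.lin_le

/-- The closed cell of `x`, as a cone. -/
def cell (A : Set (E →ₗ[ℝ] ℝ)) (x : E) : PointedCone ℝ E where
  carrier := {y | InCell A x y}
  add_mem' hv hw a ha := ⟨fun h => by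
      rw [map_add]; exact add_nonneg ((hv a ha).1 h) ((hw a ha).1 h), fun h => by
      rw [map_add]; exact add_nonpos ((hv a ha).2 h) ((hw a ha).2 h)⟩
  zero_mem' := inCell_zero A x
  smul_mem' c v hv a ha := ⟨fun h => by
      rw [show c • v = (c : ℝ) • v from rfl, map_smul]
      exact mul_nonneg c.2 ((hv a ha).1 h), fun h => by
      rw [show c • v = (c : ℝ) • v from rfl, map_smul]
      exact mul_nonpos_of_nonneg_of_nonpos c.2 ((hv a ha).2 h)⟩

lemma mem_cell {A : Set (E →ₗ[ℝ] ℝ)} {x y : E} : y ∈ cell A x ↔ InCell A x y := Iff.rfl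

lemma cell_eq_iff {A : Set (E →ₗ[ℝ] ℝ)} {x y : E} :
    cell A x = cell A y ↔ InCell A x y ∧ InCell A y x := by
  refine ⟨fun h => ⟨?_, ?_⟩, fun h => ?_⟩
  · rw [← mem_cell, h]; exact InCell.refl A y
  · rw [← mem_cell, ← h]; exact InCell.refl A x
  · ext z; exact ⟨fun hz => h.2.trans hz, fun hz => h.1.trans hz⟩

lemma ev_pos : ∀ᶠ t in 𝓝[>] (0 : ℝ), 0 < t := eventually_mem_nhdsWithin

lemma ev_pos_add {α : ℝ} (hα : 0 < α) (β : ℝ) : ∀ᶠ t in 𝓝[>] (0 : ℝ), 0 < α + t * β := by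
  have h : Tendsto (fun t : ℝ => α + t * β) (𝓝[>] 0) (𝓝 (α + 0 * β)) :=
    Tendsto.mono_left (Continuous.tendsto (by fun_prop) 0) nhdsWithin_le_nhds
  exact h.eventually_const_lt (by simpa using hα)

/-- The signs of the functionals at `x + t v` are those at a point infinitely near to `x` in the
direction `v`. -/
def Near (A : Set (E →ₗ[ℝ] ℝ)) (x v : E) (t : ℝ) : Prop :=
  0 < t ∧ ∀ a ∈ A, (0 ≤ a (x + t • v) ↔ 0 < a x ∨ a x = 0 ∧ 0 ≤ a v) ∧
    (a (x + t • v) ≤ 0 ↔ a x < 0 ∨ a x = 0 ∧ a v ≤ 0)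

/-- For small `t` the sign of `a (x + t v)` is that of `a x`, or that of `a v` if `a x = 0`, and
there are only finitely many `a`. Germ arguments can therefore be made with a single `t`. -/
lemma ev_near {A : Set (E →ₗ[ℝ] ℝ)} (hA : A.Finite) (x v : E) :
    ∀ᶠ t in 𝓝[>] (0 : ℝ), Near A x v t := by
  refine ev_pos.and ((eventually_all_finite hA).2 fun a _ => ?_)
  rcases lt_trichotomy (a x) 0 with h | h | h
  · filter_upwards [ev_pos_add (neg_pos.2 h) (-a v)] with t ht
    have : a (x + t • v) < 0 := by simp; linarith
    exact ⟨⟨fun H => absurd this H.not_gt, fun H => by rcases H with H | H <;> linarith⟩,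
      fun _ => .inl h, fun _ => this.le⟩
  · filter_upwards [ev_pos] with t ht
    simp [h, mul_nonneg_iff_of_pos_left ht, ← not_lt, mul_pos_iff_of_pos_left ht]
  · filter_upwards [ev_pos_add h (a v)] with t ht
    have : 0 < a (x + t • v) := by simpa using ht
    exact ⟨⟨fun _ => .inl h, fun _ => this.le⟩, fun H => absurd this H.not_gt,
      fun H => by rcases H with H | H <;> linarith⟩

lemma Near.inCell {A : Set (E →ₗ[ℝ] ℝ)} {x v : E} {t : ℝ} (h : Near A x v t) :
    InCell A (x + t • v) x := fun a ha => by
  rw [(h.2 a ha).1, (h.2 a ha).2]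
  exact ⟨fun h => h.elim le_of_lt (fun h => h.1.ge), fun h => h.elim le_of_lt (fun h => h.1.le)⟩

/-- Functionals that do not vanish at `x` have the same sign at both points, so only those vanishing
at `x` have to be compared. -/
lemma Near.inCell_of {A : Set (E →ₗ[ℝ] ℝ)} {x v w : E} {s t : ℝ} (h : Near A x v t)
    (h' : Near A x w s) (hvw : ∀ a ∈ A, a x = 0 → (0 ≤ a v → 0 ≤ a w) ∧ (a v ≤ 0 → a w ≤ 0)) :
    InCell A (x + t • v) (x + s • w) := fun a ha => by
  rw [(h.2 a ha).1, (h.2 a ha).2, (h'.2 a ha).1, (h'.2 a ha).2]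
  exact ⟨Or.imp id fun H => ⟨H.1, (hvw a ha H.1).1 H.2⟩,
    Or.imp id fun H => ⟨H.1, (hvw a ha H.1).2 H.2⟩⟩

lemma Near.inCell_same {A : Set (E →ₗ[ℝ] ℝ)} {x v : E} {s t : ℝ} (h : Near A x v t)
    (h' : Near A x v s) : InCell A (x + t • v) (x + s • v) :=
  h.inCell_of h' fun _ _ _ => ⟨id, id⟩

lemma Near.eq_zero_iff {A : Set (E →ₗ[ℝ] ℝ)} {x v : E} {t : ℝ} (h : Near A x v t)
    {a : E →ₗ[ℝ] ℝ} (ha : a ∈ A) : a (x + t • v) = 0 ↔ a x = 0 ∧ a v = 0 := by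
  refine ⟨fun H => ?_, fun H => by simp [H.1, H.2]⟩
  have hx := h.inCell.eq_zero ha H
  refine ⟨hx, ?_⟩
  have : t * a v = 0 := by simpa [hx] using H
  exact (mul_eq_zero.1 this).resolve_left h.1.ne'

/-- Points of the span of a cell, near to its interior point `x`, are in the interior of the
cell. -/
lemma Near.inCell_lin {A : Set (E →ₗ[ℝ] ℝ)} {x v : E} {t : ℝ} (h : Near A x v t)
    (hv : v ∈ Lin A x) : InCell A x (x + t • v) := fun a ha => by
  rw [(h.2 a ha).1, (h.2 a ha).2]
  refine ⟨fun H => ?_, fun H => ?_⟩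
  · exact H.lt_or_eq.imp id fun H => ⟨H.symm, (hv a ha H.symm).ge⟩
  · exact H.lt_or_eq.imp id fun H => ⟨H, (hv a ha H).le⟩

/-- Starting at a point `x` of the closed cell of `y` and moving in the direction `y`, one enters
the relative interior of that cell at once. -/
lemma InCell.near_same {A : Set (E →ₗ[ℝ] ℝ)} {x y : E} (h : InCell A y x) {t : ℝ}
    (ht : Near A x y t) : InCell A y (x + t • y) ∧ InCell A (x + t • y) y := by
  constructor <;> intro a ha <;> rw [(ht.2 a ha).1, (ht.2 a ha).2]
  · have := h a ha
    have := h.eq_zero ha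
    grind
  · have := h a ha
    have := h.eq_zero ha
    grind

lemma exists_near {A : Set (E →ₗ[ℝ] ℝ)} (hA : A.Finite) (x v : E) : ∃ t, Near A x v t :=
  (ev_near hA x v).exists

/-- The cell is a neighbourhood of `x` in `Lin A x`, so every vector of `Lin A x` is a multiple of a
difference of points of the cell. -/
lemma span_cell {A : Set (E →ₗ[ℝ] ℝ)} (hA : A.Finite) (x : E) :
    Submodule.span ℝ (cell A x : Set E) = Lin A x := by
  apply le_antisymm
  · exact Submodule.span_le.2 fun y hy => InCell.mem_lin hy
  · intro v hv
    obtain ⟨t, ht⟩ := exists_near hA x v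
    have h1 : x + t • v ∈ Submodule.span ℝ (cell A x : Set E) :=
      Submodule.subset_span (ht.inCell_lin hv)
    have h2 : x ∈ Submodule.span ℝ (cell A x : Set E) := Submodule.subset_span (InCell.refl A x)
    have h3 := Submodule.smul_mem _ t⁻¹ (Submodule.sub_mem _ h1 h2)
    simpa [smul_smul, inv_mul_cancel₀ ht.1.ne'] using h3

/-- Generic points of a subspace, near to a given one. -/
lemma exists_generic {A : Set (E →ₗ[ℝ] ℝ)} (hA : A.Finite) (W : Submodule ℝ E) {w₀ : E}
    (hw₀ : w₀ ∈ W) : ∃ w ∈ W, InCell A w w₀ ∧ ∀ a ∈ A, a w = 0 → ∀ v ∈ W, a v = 0 := by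
  have key : ∀ B : Set (E →ₗ[ℝ] ℝ), B.Finite → B ⊆ A →
      ∃ w ∈ W, InCell A w w₀ ∧ ∀ a ∈ B, a w = 0 → ∀ v ∈ W, a v = 0 := by
    intro B hB
    induction B, hB using Set.Finite.induction_on with
    | empty => exact fun _ => ⟨w₀, hw₀, InCell.refl A w₀, by simp⟩
    | @insert b B _ _ ih =>
      intro hBA
      obtain ⟨w, hw, hwc, hgen⟩ := ih ((Set.subset_insert _ _).trans hBA)
      by_cases hb : ∀ v ∈ W, b v = 0
      · refine ⟨w, hw, hwc, fun a ha => ?_⟩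
        rcases ha with rfl | ha
        exacts [fun _ => hb, hgen a ha]
      · push Not at hb
        obtain ⟨v, hv, hbv⟩ := hb
        -- A small step in a direction on which `b` is nonzero makes `b` nonzero and keeps every
        -- nonzero value nonzero.
        obtain ⟨t, ht⟩ := exists_near hA w v
        refine ⟨w + t • v, W.add_mem hw (W.smul_mem _ hv), ht.inCell.trans hwc, fun a ha h0 => ?_⟩
        have := (ht.eq_zero_iff (hBA ha)).1 h0
        rcases ha with rfl | ha
        exacts [absurd this.2 hbv, hgen a ha this.1]
  exact key A hA subset_rfl

/-- `X` is a union of closed cells. -/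
def Cellular (A : Set (E →ₗ[ℝ] ℝ)) (X : Set E) : Prop := ∀ x ∈ X, ∀ y, InCell A x y → y ∈ X

lemma Cellular.mono {A B : Set (E →ₗ[ℝ] ℝ)} {X : Set E} (h : Cellular A X) (hAB : A ⊆ B) :
    Cellular B X := fun x hx y hy => h x hx y (hy.mono hAB)

lemma Cellular.zero_mem {A : Set (E →ₗ[ℝ] ℝ)} {X : Set E} (h : Cellular A X) (hX : X.Nonempty) :
    (0 : E) ∈ X := let ⟨x, hx⟩ := hX; h x hx 0 (inCell_zero A x)

lemma Cellular.smul_mem {A : Set (E →ₗ[ℝ] ℝ)} {X : Set E} (h : Cellular A X) {x : E} (hx : x ∈ X)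
    {t : ℝ} (ht : 0 ≤ t) : t • x ∈ X :=
  h x hx _ fun a _ => ⟨fun H => by simpa using mul_nonneg ht H,
    fun H => by simpa using mul_nonpos_of_nonneg_of_nonpos ht H⟩

/-- The local cone of `X` at `x`. -/
def Loc (X : Set E) (x : E) : Set E := {v | ∀ᶠ t in 𝓝[>] (0 : ℝ), x + t • v ∈ X}

lemma mem_loc {X : Set E} {x v : E} : v ∈ Loc X x ↔ ∀ᶠ t in 𝓝[>] (0 : ℝ), x + t • v ∈ X := Iff.rfl

lemma Cellular.mem_loc_of_near {A : Set (E →ₗ[ℝ] ℝ)} (hA : A.Finite) {X : Set E}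
    (h : Cellular A X) {x v : E} {t : ℝ} (ht : Near A x v t) (hm : x + t • v ∈ X) : v ∈ Loc X x :=
  (ev_near hA x v).mono fun _ hs => h _ hm _ (ht.inCell_same hs)

/-- All near points in a given direction lie in the interior of the same cell, so a cellular set
contains all of them or none. -/
lemma Cellular.near_mem_iff {A : Set (E →ₗ[ℝ] ℝ)} (hA : A.Finite) {X : Set E}
    (h : Cellular A X) {x v : E} {t : ℝ} (ht : Near A x v t) : x + t • v ∈ X ↔ v ∈ Loc X x := by
  refine ⟨h.mem_loc_of_near hA ht, fun H => ?_⟩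
  obtain ⟨s, hs, hs'⟩ := ((mem_loc.1 H).and (ev_near hA x v)).exists
  exact h _ hs _ (hs'.inCell_same ht)

lemma Cellular.mem_of_loc {A : Set (E →ₗ[ℝ] ℝ)} (hA : A.Finite) {X : Set E}
    (h : Cellular A X) {x v : E} (hv : v ∈ Loc X x) : x ∈ X := by
  obtain ⟨s, hs, hs'⟩ := ((mem_loc.1 hv).and (ev_near hA x v)).exists
  exact h _ hs _ hs'.inCell

lemma zero_mem_loc {X : Set E} {x : E} (hx : x ∈ X) : (0 : E) ∈ Loc X x := by
  simp [Loc, hx]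

/-- Near `x` only the functionals vanishing at `x` can change sign. -/
lemma Cellular.loc {A : Set (E →ₗ[ℝ] ℝ)} (hA : A.Finite) {X : Set E} (h : Cellular A X) (x : E) :
    Cellular {a ∈ A | a x = 0} (Loc X x) := by
  intro v hv w hw
  obtain ⟨t, ht⟩ := exists_near hA x v
  obtain ⟨s, hs⟩ := exists_near hA x w
  rw [← h.near_mem_iff hA ht] at hv
  rw [← h.near_mem_iff hA hs]
  exact h _ hv _ (ht.inCell_of hs fun a ha hx => hw a ⟨ha, hx⟩)

lemma Cellular.loc_congr {A : Set (E →ₗ[ℝ] ℝ)} (hA : A.Finite) {X : Set E} (h : Cellular A X)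
    {x y : E} (hxy : InCell A x y) (hyx : InCell A y x) : Loc X x = Loc X y := by
  ext v
  obtain ⟨t, ht⟩ := exists_near hA x v
  obtain ⟨s, hs⟩ := exists_near hA y v
  rw [← h.near_mem_iff hA ht, ← h.near_mem_iff hA hs]
  have h0 : ∀ a ∈ A, (0 < a x ↔ 0 < a y) ∧ (a x < 0 ↔ a y < 0) ∧ (a x = 0 ↔ a y = 0) := by
    intro a ha
    have h1 := hxy a ha
    have h2 := hyx a ha
    exact ⟨not_le.symm.trans ((not_congr ⟨h1.2, h2.2⟩).trans not_le),
      not_le.symm.trans ((not_congr ⟨h1.1, h2.1⟩).trans not_le),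
      ⟨hxy.eq_zero ha, hyx.eq_zero ha⟩⟩
  constructor <;> refine fun H => h _ H _ fun a ha => ?_
  · rw [(ht.2 a ha).1, (ht.2 a ha).2, (hs.2 a ha).1, (hs.2 a ha).2, (h0 a ha).1, (h0 a ha).2.1,
      (h0 a ha).2.2]
    exact ⟨id, id⟩
  · rw [(ht.2 a ha).1, (ht.2 a ha).2, (hs.2 a ha).1, (hs.2 a ha).2, (h0 a ha).1, (h0 a ha).2.1,
      (h0 a ha).2.2]
    exact ⟨id, id⟩

/-- The functionals that cut out the local cone vanish on `Lin A x`, so the local cone is invariant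
under these translations. -/
lemma Cellular.loc_add_lin {A : Set (E →ₗ[ℝ] ℝ)} (hA : A.Finite) {X : Set E} (h : Cellular A X)
    {x v w : E} (hv : v ∈ Loc X x) (hw : w ∈ Lin A x) : v + w ∈ Loc X x :=
  h.loc hA x v hv _ fun a ha => by simp [hw a ha.1 ha.2]

lemma Cellular.lin_subset_loc {A : Set (E →ₗ[ℝ] ℝ)} (hA : A.Finite) {X : Set E} (h : Cellular A X)
    {x : E} (hx : x ∈ X) : (Lin A x : Set E) ⊆ Loc X x := fun w hw => by
  simpa using h.loc_add_lin hA (zero_mem_loc hx) hw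

lemma Cellular.loc_zero {A : Set (E →ₗ[ℝ] ℝ)} {X : Set E} (h : Cellular A X) :
    Loc X 0 = X := by
  ext v
  simp only [mem_loc, zero_add]
  refine ⟨fun H => ?_, fun H => ev_pos.mono fun t ht => h.smul_mem H ht.le⟩
  obtain ⟨t, ht, ht0⟩ := (H.and ev_pos).exists
  simpa [smul_smul, inv_mul_cancel₀ ht0.ne'] using h.smul_mem ht (inv_nonneg.2 ht0.le)

lemma loc_univ (x : E) : Loc (Set.univ : Set E) x = Set.univ := by
  ext; simp [Loc]

/-- Sign pattern of `(x + t v) + s w` for infinitely small `s` after infinitely small `t`. -/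
lemma Cellular.loc_loc {A : Set (E →ₗ[ℝ] ℝ)} (hA : A.Finite) {X : Set E} (h : Cellular A X)
    {x v : E} {t : ℝ} (ht : Near A x v t) : Loc (Loc X x) v = Loc X (x + t • v) := by
  ext w
  obtain ⟨s, hs⟩ := exists_near hA v w
  obtain ⟨r, hr⟩ := exists_near hA x (v + s • w)
  obtain ⟨q, hq⟩ := exists_near hA (x + t • v) w
  have hs' : Near {a ∈ A | a x = 0} v w s := ⟨hs.1, fun a ha => hs.2 a ha.1⟩
  rw [← (h.loc hA x).near_mem_iff (hA.subset (Set.sep_subset _ _)) hs', ← h.near_mem_iff hA hr,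
    ← h.near_mem_iff hA hq]
  have key : ∀ a ∈ A, (0 ≤ a (x + r • (v + s • w)) ↔ 0 ≤ a (x + t • v + q • w)) ∧
      (a (x + r • (v + s • w)) ≤ 0 ↔ a (x + t • v + q • w) ≤ 0) := by
    intro a ha
    rw [(hr.2 a ha).1, (hr.2 a ha).2, (hq.2 a ha).1, (hq.2 a ha).2, (hs.2 a ha).1, (hs.2 a ha).2,
      ht.eq_zero_iff ha]
    have h1 := (ht.2 a ha).1
    have h2 := (ht.2 a ha).2
    grind
  exact ⟨fun H => h _ H _ fun a ha => ⟨(key a ha).1.1, (key a ha).2.1⟩,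
    fun H => h _ H _ fun a ha => ⟨(key a ha).1.2, (key a ha).2.2⟩⟩

lemma Near.lin_eq {A : Set (E →ₗ[ℝ] ℝ)} {x v : E} {t : ℝ} (ht : Near A x v t) :
    Lin A (x + t • v) = Lin {a ∈ A | a x = 0} v := by
  ext w
  simp only [mem_lin, Set.mem_sep_iff, and_imp]
  exact forall₂_congr fun a ha => by rw [ht.eq_zero_iff ha, and_imp]

end Cells

end Trop

namespace Trop

open Filter Topology

/-! ### Lattices, rational subspaces and rational cones -/

section Lattices

variable {E : Type*} [AddCommGroup E] [Module ℝ E] {L : AddSubgroup E}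

lemma IntegralOn.sub {a b : E →ₗ[ℝ] ℝ} (ha : IntegralOn L a) (hb : IntegralOn L b) :
    IntegralOn L (a - b) := fun x hx => by
  obtain ⟨k, hk⟩ := ha x hx
  obtain ⟨l, hl⟩ := hb x hx
  exact ⟨k - l, by simp [hk, hl]⟩

lemma IntegralOn.add {a b : E →ₗ[ℝ] ℝ} (ha : IntegralOn L a) (hb : IntegralOn L b) :
    IntegralOn L (a + b) := fun x hx => by
  obtain ⟨k, hk⟩ := ha x hx
  obtain ⟨l, hl⟩ := hb x hx
  exact ⟨k + l, by simp [hk, hl]⟩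

lemma IntegralOn.neg {a : E →ₗ[ℝ] ℝ} (ha : IntegralOn L a) : IntegralOn L (-a) := fun x hx => by
  obtain ⟨k, hk⟩ := ha x hx
  exact ⟨-k, by simp [hk]⟩

lemma IntegralOn.smul {a b : E →ₗ[ℝ] ℝ} (ha : IntegralOn L a) (hb : IntegralOn L b) {v : E}
    (hv : v ∈ L) : IntegralOn L (a v • b) := fun x hx => by
  obtain ⟨k, hk⟩ := ha v hv
  obtain ⟨l, hl⟩ := hb x hx
  exact ⟨k * l, by simp [hk, hl]⟩

lemma IntegralOn.smul_mem {a : E →ₗ[ℝ] ℝ} (ha : IntegralOn L a) {u v : E} (hu : u ∈ L)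
    (hv : v ∈ L) : a u • v ∈ L := by
  obtain ⟨k, hk⟩ := ha u hu
  rw [hk, Int.cast_smul_eq_zsmul]
  exact L.zsmul_mem hv k

lemma IntegralOn.comp {E' : Type*} [AddCommGroup E'] [Module ℝ E'] {L' : AddSubgroup E'}
    {a : E →ₗ[ℝ] ℝ} (ha : IntegralOn L a) {f : E' →ₗ[ℝ] E} (hf : ∀ x ∈ L', f x ∈ L) :
    IntegralOn L' (a ∘ₗ f) := fun x hx => ha _ (hf x hx)

lemma IsLattice.finiteDimensional (hL : IsLattice L) : FiniteDimensional ℝ E :=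
  let ⟨_, b, _⟩ := hL; Module.Basis.finiteDimensional_of_finite b

lemma IsLattice.span_eq_top (hL : IsLattice L) : Submodule.span ℝ (L : Set E) = ⊤ := by
  obtain ⟨n, b, rfl⟩ := hL
  rw [eq_top_iff, ← b.span_eq]
  exact Submodule.span_mono AddSubgroup.subset_closure

/-- The coordinates of a lattice basis. Adjoined to an arrangement, they make its cells strongly
convex. -/
lemma IsLattice.exists_separating (hL : IsLattice L) :
    ∃ C : Set (E →ₗ[ℝ] ℝ), Arr L C ∧ ∀ v, (∀ a ∈ C, a v = 0) → v = 0 := by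
  obtain ⟨n, b, rfl⟩ := hL
  refine ⟨Set.range b.coord, ⟨Set.finite_range _, ?_⟩, fun v hv => ?_⟩
  · rintro _ ⟨i, rfl⟩ x hx
    induction hx using AddSubgroup.closure_induction with
    | mem x hx =>
      obtain ⟨j, rfl⟩ := hx
      by_cases h : j = i
      · exact ⟨1, by simp [h]⟩
      · exact ⟨0, by simp [h]⟩
    | zero => exact ⟨0, by simp⟩
    | add x y _ _ hx hy =>
      obtain ⟨k, hk⟩ := hx
      obtain ⟨l, hl⟩ := hy
      exact ⟨k + l, by rw [map_add, hk, hl]; push_cast; rfl⟩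
    | neg x _ hx =>
      obtain ⟨k, hk⟩ := hx
      exact ⟨-k, by rw [map_neg, hk]; push_cast; rfl⟩
  · exact b.ext_elem fun i => by simpa using hv _ ⟨i, rfl⟩

/-- The functionals embed `E` in `C → ℝ`, where by integrality a lattice vector of sup norm less
than one is zero. So `L` is discrete and spanning, and a ℤ-basis of it is a real basis of `E`. -/
lemma isLattice_of_separating (hspan : Submodule.span ℝ (L : Set E) = ⊤)
    {C : Set (E →ₗ[ℝ] ℝ)} (hC : Arr L C) (hsep : ∀ v, (∀ a ∈ C, a v = 0) → v = 0) :
    IsLattice L := by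
  have : Fintype C := hC.finite.fintype
  let Φ : E →ₗ[ℝ] (C → ℝ) := LinearMap.pi fun a => (a : E →ₗ[ℝ] ℝ)
  have hinj : Function.Injective Φ := by
    rw [injective_iff_map_eq_zero]
    exact fun v hv => hsep v fun a ha => congr_fun hv ⟨a, ha⟩
  have : FiniteDimensional ℝ E := Module.Finite.of_injective Φ hinj
  let i1 : NormedAddCommGroup E := NormedAddCommGroup.induced E (C → ℝ) Φ hinj
  let i2 : NormedSpace ℝ E := NormedSpace.induced ℝ E (C → ℝ) Φ
  let M : Submodule ℤ E := AddSubgroup.toIntSubmodule L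
  have : DiscreteTopology M := by
    rw [discreteTopology_iff_isOpen_singleton_zero, Metric.isOpen_singleton_iff]
    refine ⟨1, one_pos, fun y hy => ?_⟩
    rw [dist_zero_right] at hy
    ext1
    refine hsep _ fun a ha => ?_
    obtain ⟨k, hk⟩ := hC.integral a ha y y.2
    have h1 : ‖Φ y‖ < 1 := hy
    have h2 : ‖a y‖ < 1 := (norm_le_pi_norm (Φ y) ⟨a, ha⟩).trans_lt h1
    rw [hk, Real.norm_eq_abs] at h2
    have : |k| < 1 := by exact_mod_cast h2
    rw [hk, Int.abs_lt_one_iff.1 this, Int.cast_zero]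
  have : IsZLattice ℝ M := ⟨hspan⟩
  have := ZLattice.module_free ℝ M
  have := ZLattice.module_finite ℝ M
  let e := Module.finBasis ℤ M
  refine ⟨_, e.ofZLatticeBasis ℝ M, ?_⟩
  have := e.ofZLatticeBasis_span ℝ M
  rw [← Submodule.span_int_eq_addSubgroupClosure, this]
  rfl

/-- A rational subspace: it is spanned by its lattice points. -/
def IsRational (L : AddSubgroup E) (W : Submodule ℝ E) : Prop :=
  W ≤ Submodule.span ℝ {x | x ∈ L ∧ x ∈ W}

/-- The lattice points of `W` form a saturated subgroup, because a real subspace contains `x` once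
it contains a nonzero multiple of `x`. The quotient is thus finitely generated and torsion-free,
hence free, and the subgroup splits off; rationality of `W` makes the real extension the identity on
`W`. -/
lemma IsLattice.exists_projection (hL : IsLattice L) {W : Submodule ℝ E} (hW : IsRational L W) :
    ∃ P : E →ₗ[ℝ] E, (∀ x, P x ∈ W) ∧ (∀ x ∈ W, P x = x) ∧ ∀ x ∈ L, P x ∈ L := by
  obtain ⟨n, b, rfl⟩ := hL
  set L := AddSubgroup.closure (Set.range b) with hL
  let M : Submodule ℤ E := AddSubgroup.toIntSubmodule L
  let K : Submodule ℤ M := (W.restrictScalars ℤ).comap M.subtype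
  have : Module.Finite ℤ M := by
    rw [Module.Finite.iff_fg]
    refine ⟨(Set.finite_range b).toFinset, Submodule.toAddSubgroup_injective ?_⟩
    rw [Submodule.span_int_eq_addSubgroupClosure, Set.Finite.coe_toFinset]
    rfl
  have : Module.IsTorsionFree ℤ (M ⧸ K) := by
    refine Module.IsTorsionFree.mk fun k hk x y hxy => ?_
    induction x using Submodule.Quotient.induction_on with | _ x
    induction y using Submodule.Quotient.induction_on with | _ y
    rw [Submodule.Quotient.eq]
    have h1 : k • (x - y) ∈ K := by
      rw [smul_sub, ← Submodule.Quotient.eq]; exact hxy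
    have h2 : (k : ℝ) • ((x : E) - y) ∈ W := by
      rw [Int.cast_smul_eq_zsmul]; exact h1
    exact (W.smul_mem_iff (by exact_mod_cast hk.ne_zero)).1 h2
  have : Module.Free ℤ (M ⧸ K) := Module.free_of_finite_type_torsion_free'
  obtain ⟨s, hs⟩ := Module.projective_lifting_property K.mkQ LinearMap.id K.mkQ_surjective
  let p : M →ₗ[ℤ] M := LinearMap.id - s ∘ₗ K.mkQ
  have hpK : ∀ x, p x ∈ K := fun x => by
    rw [← Submodule.Quotient.mk_eq_zero, ← Submodule.mkQ_apply]
    have := LinearMap.congr_fun hs (K.mkQ x)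
    simp only [LinearMap.comp_apply, LinearMap.id_apply] at this
    simp [p, -Submodule.mkQ_apply, this]
  have hpid : ∀ x ∈ K, p x = x := fun x hx => by
    have : K.mkQ x = 0 := by simpa using hx
    simp [p, -Submodule.mkQ_apply, this]
  have hbM : ∀ i, b i ∈ M := fun i => AddSubgroup.subset_closure ⟨i, rfl⟩
  let P : E →ₗ[ℝ] E := b.constr ℝ fun i => (p ⟨b i, hbM i⟩ : E)
  have hP : ∀ x (hx : x ∈ M), P x = p ⟨x, hx⟩ := by
    intro x hx
    induction hx using AddSubgroup.closure_induction with
    | mem x hx =>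
      obtain ⟨j, rfl⟩ := hx
      simp [P]
    | zero => rw [map_zero]; exact (congr_arg Subtype.val (map_zero p)).symm
    | add x y hx hy h1 h2 =>
      rw [map_add, h1, h2]; exact (congr_arg Subtype.val (map_add p ⟨x, hx⟩ ⟨y, hy⟩)).symm
    | neg x hx h1 =>
      rw [map_neg, h1]; exact (congr_arg Subtype.val (map_neg p ⟨x, hx⟩)).symm
  refine ⟨P, fun x => ?_, fun x hx => ?_, fun x hx => ?_⟩
  · rw [← b.sum_repr x, map_sum]
    refine W.sum_mem fun i _ => ?_
    rw [map_smul, hP _ (hbM i)]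
    exact W.smul_mem _ (hpK _)
  · have := hW hx
    clear hx
    induction this using Submodule.span_induction with
    | mem x hx => rw [hP x hx.1, hpid ⟨x, hx.1⟩ hx.2]
    | zero => simp
    | add x y _ _ h1 h2 => rw [map_add, h1, h2]
    | smul c x _ h1 => rw [map_smul, h1]
  · rw [hP x hx]; exact (p ⟨x, hx⟩).2

lemma smul_mem_hull {s : Set E} {x : E} (hx : x ∈ PointedCone.hull ℝ s) {t : ℝ} (ht : 0 ≤ t) :
    t • x ∈ PointedCone.hull ℝ s := PointedCone.smul_mem _ ht hx

/-- Fourier–Motzkin elimination: the new generators are the old ones in the half-space, and for each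
pair on opposite sides the point where their segment meets the hyperplane, up to scaling. -/
lemma hull_inter_halfspace (a : E →ₗ[ℝ] ℝ) (s : Set E) (x : E) :
    x ∈ PointedCone.hull ℝ ({u | u ∈ s ∧ 0 ≤ a u} ∪
      Set.image2 (fun u v => a u • v - a v • u) {u | u ∈ s ∧ 0 < a u} {v | v ∈ s ∧ a v < 0}) ↔
    x ∈ PointedCone.hull ℝ s ∧ 0 ≤ a x := by
  set s' := {u | u ∈ s ∧ 0 ≤ a u} ∪
      Set.image2 (fun u v => a u • v - a v • u) {u | u ∈ s ∧ 0 < a u} {v | v ∈ s ∧ a v < 0}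
  constructor
  · intro hx
    induction hx using Submodule.span_induction with
    | mem x hx =>
      rcases hx with hx | ⟨u, hu, v, hv, rfl⟩
      · exact ⟨PointedCone.subset_hull hx.1, hx.2⟩
      · refine ⟨?_, by simp [mul_comm]⟩
        beta_reduce
        rw [sub_eq_add_neg, ← neg_smul]
        exact Submodule.add_mem _ (smul_mem_hull (PointedCone.subset_hull hv.1) hu.2.le)
          (smul_mem_hull (PointedCone.subset_hull hu.1) (neg_nonneg.2 hv.2.le))
    | zero => exact ⟨Submodule.zero_mem _, by simp⟩
    | add x y _ _ h1 h2 =>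
      exact ⟨Submodule.add_mem _ h1.1 h2.1, by rw [map_add]; exact add_nonneg h1.2 h2.2⟩
    | smul c x _ h1 =>
      refine ⟨Submodule.smul_mem _ _ h1.1, ?_⟩
      rw [show c • x = (c : ℝ) • x from rfl, map_smul]
      exact mul_nonneg c.2 h1.2
  · rintro ⟨hx, hax⟩
    have hs : s = {u | u ∈ s ∧ 0 ≤ a u} ∪ {u | u ∈ s ∧ a u < 0} := by
      ext u; simp only [Set.mem_union, Set.mem_ofPred_eq]; have := le_or_gt 0 (a u); tauto
    rw [hs, PointedCone.hull, Submodule.span_union, Submodule.mem_sup] at hx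
    obtain ⟨p, hp, q, hq, rfl⟩ := hx
    have hq0 : a q < 0 ∨ q = 0 := by
      clear hax
      induction hq using Submodule.span_induction with
      | mem x hx => exact .inl hx.2
      | zero => exact .inr rfl
      | add x y _ _ h1 h2 =>
        rcases h1 with h1 | h1 <;> rcases h2 with h2 | h2
        · left; rw [map_add]; exact add_neg h1 h2
        · left; rwa [h2, add_zero]
        · left; rwa [h1, zero_add]
        · right; rw [h1, h2, add_zero]
      | smul c x _ h1 =>
        rcases h1 with h1 | h1
        · rcases c.2.eq_or_lt with hc | hc
          · right; rw [show c • x = (c : ℝ) • x from rfl, ← hc, zero_smul]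
          · left; rw [show c • x = (c : ℝ) • x from rfl, map_smul]; exact mul_neg_of_pos_of_neg hc h1
        · right; rw [h1, smul_zero]
    have hp0 : p ∈ PointedCone.hull ℝ s' := Submodule.span_mono Set.subset_union_left hp
    rcases hq0 with hq0 | rfl
    swap
    · rwa [add_zero]
    -- The expression is bilinear in `p` and `q`, so it suffices to treat generators: a pair gives
    -- one of the new generators or, if `a u = 0`, a nonnegative multiple of `u`. Then `p + q` is a
    -- nonnegative combination of this vector and `p`, since `a (p + q)` is nonnegative.
    have key : a p • q - a q • p ∈ PointedCone.hull ℝ s' := by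
      clear hax hq0 hp0
      induction hp using Submodule.span_induction with
      | zero => simp
      | add x y _ _ h1 h2 =>
        have := Submodule.add_mem _ h1 h2
        rw [map_add]
        convert this using 1; module
      | smul c x _ h1 =>
        have := Submodule.smul_mem _ c h1
        rw [show c • x = (c : ℝ) • x from rfl, map_smul]
        convert this using 1
        rw [show c • (a x • q - a q • x) = (c : ℝ) • (a x • q - a q • x) from rfl, smul_eq_mul]
        module
      | mem u hu =>
        induction hq using Submodule.span_induction with
        | zero => simp
        | add x y _ _ h1 h2 =>
          have := Submodule.add_mem _ h1 h2
          rw [map_add]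
          convert this using 1; module
        | smul c x _ h1 =>
          have := Submodule.smul_mem _ c h1
          rw [show c • x = (c : ℝ) • x from rfl, map_smul]
          convert this using 1
          rw [show c • (a u • x - a x • u) = (c : ℝ) • (a u • x - a x • u) from rfl, smul_eq_mul]
          module
        | mem v hv =>
          rcases hu.2.eq_or_lt with h0 | h0
          · rw [← h0, zero_smul, zero_sub, ← neg_smul]
            exact smul_mem_hull (PointedCone.subset_hull (.inl hu)) (neg_nonneg.2 hv.2.le)
          · exact PointedCone.subset_hull (.inr ⟨u, ⟨hu.1, h0⟩, v, hv, rfl⟩)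
    rw [map_add] at hax
    have hap : 0 < a p := by linarith
    have : p + q = (a p)⁻¹ • (a p • q - a q • p) + ((a p)⁻¹ * (a p + a q)) • p := by
      have h1 : p + q = ((a p)⁻¹ * a p) • (p + q) := by rw [inv_mul_cancel₀ hap.ne', one_smul]
      rw [h1]
      module
    rw [this]
    exact add_mem (smul_mem_hull key (inv_nonneg.2 hap.le))
      (smul_mem_hull hp0 (mul_nonneg (inv_nonneg.2 hap.le) hax))

lemma IsLattice.hull_eq_top (hL : IsLattice L) :
    ∃ s : Set E, s.Finite ∧ s ⊆ (L : Set E) ∧ ∀ x, x ∈ PointedCone.hull ℝ s := by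
  obtain ⟨n, b, rfl⟩ := hL
  refine ⟨Set.range b ∪ Set.range (fun i => -b i),
    (Set.finite_range _).union (Set.finite_range _), ?_, fun x => ?_⟩
  · rintro _ (⟨i, rfl⟩ | ⟨i, rfl⟩)
    · exact AddSubgroup.subset_closure ⟨i, rfl⟩
    · exact neg_mem (AddSubgroup.subset_closure ⟨i, rfl⟩)
  · rw [← b.sum_repr x]
    refine Submodule.sum_mem _ fun i _ => ?_
    rcases le_total 0 (b.repr x i) with h | h
    · exact smul_mem_hull (PointedCone.subset_hull (.inl ⟨i, rfl⟩)) h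
    · rw [← neg_smul_neg]
      exact smul_mem_hull (PointedCone.subset_hull (.inr ⟨i, rfl⟩)) (neg_nonneg.2 h)

/-- A cone cut out by integral inequalities is generated by finitely many lattice points. -/
lemma IsLattice.exists_generators (hL : IsLattice L) {A : Set (E →ₗ[ℝ] ℝ)} (hA : Arr L A) :
    ∃ s : Set E, s.Finite ∧ s ⊆ (L : Set E) ∧
      ∀ x, x ∈ PointedCone.hull ℝ s ↔ ∀ a ∈ A, 0 ≤ a x := by
  obtain ⟨hfin, hint⟩ := hA
  induction A, hfin using Set.Finite.induction_on with
  | empty => simpa using hL.hull_eq_top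
  | @insert a A _ _ ih =>
    obtain ⟨s, hs, hsL, h⟩ := ih fun b hb => hint b (.inr hb)
    refine ⟨_, ?_, ?_, fun x => (hull_inter_halfspace a s x).trans ?_⟩
    · exact (hs.subset fun u hu => hu.1).union
        (Set.Finite.image2 _ (hs.subset fun u hu => hu.1) (hs.subset fun u hu => hu.1))
    · rintro _ (hu | ⟨u, hu, v, hv, rfl⟩)
      · exact hsL hu.1
      · have ha := hint a (.inl rfl)
        exact sub_mem (ha.smul_mem (hsL hu.1) (hsL hv.1)) (ha.smul_mem (hsL hv.1) (hsL hu.1))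
    · rw [h, Set.forall_mem_insert, and_comm]

/-- A cone generated by finitely many lattice points is cut out by integral inequalities. -/
lemma IsLattice.exists_inequalities (hL : IsLattice L) {s : Set E} (hs : s.Finite)
    (hsL : s ⊆ (L : Set E)) :
    ∃ A : Set (E →ₗ[ℝ] ℝ), Arr L A ∧ ∀ x, x ∈ PointedCone.hull ℝ s ↔ ∀ a ∈ A, 0 ≤ a x := by
  induction s, hs using Set.Finite.induction_on with
  | empty =>
    obtain ⟨C, hC, hsep⟩ := hL.exists_separating
    refine ⟨C ∪ (fun a => -a) '' C, ⟨hC.finite.union (hC.finite.image _), ?_⟩, fun x => ?_⟩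
    · rintro _ (ha | ⟨a, ha, rfl⟩)
      exacts [hC.integral _ ha, (hC.integral _ ha).neg]
    · simp only [PointedCone.hull, Submodule.span_empty, Submodule.mem_bot]
      refine ⟨fun h => by simp [h], fun h => hsep x fun a ha => ?_⟩
      have h1 := h a (.inl ha)
      have h2 := h (-a) (.inr ⟨a, ha, rfl⟩)
      simp only [LinearMap.neg_apply] at h2
      linarith
  | @insert v s _ _ ih =>
    have hv : v ∈ L := hsL (.inl rfl)
    obtain ⟨A, hA, h⟩ := ih ((Set.subset_insert _ _).trans hsL)
    refine ⟨{a | a ∈ A ∧ 0 ≤ a v} ∪ Set.image2 (fun a b => a v • b - b v • a)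
      {a | a ∈ A ∧ 0 < a v} {b | b ∈ A ∧ b v < 0}, ⟨?_, ?_⟩, fun x => ?_⟩
    · exact (hA.finite.subset fun u hu => hu.1).union
        (Set.Finite.image2 _ (hA.finite.subset fun u hu => hu.1)
          (hA.finite.subset fun u hu => hu.1))
    · rintro _ (ha | ⟨a, ha, b, hb, rfl⟩)
      · exact hA.integral _ ha.1
      · have ha := hA.integral _ ha.1
        have hb := hA.integral _ hb.1
        exact (ha.smul hb hv).sub (hb.smul ha hv)
    · rw [PointedCone.hull, Submodule.mem_span_insert]
      constructor
      · rintro ⟨t, z, hz, rfl⟩ c hc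
        have hz := (h z).1 hz
        have ht : (0 : ℝ) ≤ t := t.2
        rw [show t • v = (t : ℝ) • v from rfl]
        rcases hc with hc | ⟨a, ha, b, hb, rfl⟩
        · rw [map_add, map_smul]
          exact add_nonneg (mul_nonneg ht hc.2) (hz c hc.1)
        · have h1 := hz a ha.1
          have h2 := hz b hb.1
          have := add_nonneg (mul_nonneg ha.2.le h2) (mul_nonneg (neg_nonneg.2 hb.2.le) h1)
          simp only [map_add, map_smul, LinearMap.sub_apply, LinearMap.smul_apply, smul_eq_mul]
          linarith
      · intro hx
        -- Each `b` with `b v < 0` demands `t ≥ b x / b v`. The largest of these bounds works,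
        -- unless none is positive, when zero does; the mixed inequalities keep it below the upper
        -- bounds from `a v > 0`.
        obtain ⟨t, ht, hz⟩ : ∃ t : ℝ, 0 ≤ t ∧ ∀ a ∈ A, 0 ≤ a (x - t • v) := by
          by_cases hall : ∀ b ∈ A, b v < 0 → 0 ≤ b x
          · refine ⟨0, le_rfl, fun a ha => ?_⟩
            rw [zero_smul, sub_zero]
            rcases le_or_gt 0 (a v) with h0 | h0
            exacts [hx a (.inl ⟨ha, h0⟩), hall a ha h0]
          · push Not at hall
            obtain ⟨b', hb', hb'v, hb'x⟩ := hall
            obtain ⟨b, ⟨hb, hbv⟩, hmax⟩ := Set.exists_max_image {b | b ∈ A ∧ b v < 0}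
              (fun b => b x / b v) (hA.finite.subset fun u hu => hu.1) ⟨b', hb', hb'v⟩
            have ht : 0 ≤ b x / b v :=
              (div_nonneg_of_nonpos hb'x.le hb'v.le).trans (hmax b' ⟨hb', hb'v⟩)
            refine ⟨b x / b v, ht, fun a ha => ?_⟩
            rw [map_sub, map_smul, smul_eq_mul, sub_nonneg]
            rcases lt_trichotomy (a v) 0 with h0 | h0 | h0
            · have := hmax a ⟨ha, h0⟩
              rwa [div_le_iff_of_neg h0] at this
            · rw [h0, mul_zero]; exact hx a (.inl ⟨ha, h0.ge⟩)
            · have := hx _ (.inr ⟨a, ⟨ha, h0⟩, b, ⟨hb, hbv⟩, rfl⟩)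
              simp only [LinearMap.sub_apply, LinearMap.smul_apply, smul_eq_mul] at this
              rw [div_mul_eq_mul_div, div_le_iff_of_neg hbv]
              linarith
        exact ⟨⟨t, ht⟩, x - t • v, (h _).2 hz, by
          rw [show (⟨t, ht⟩ : {c : ℝ // 0 ≤ c}) • v = t • v from rfl]; abel⟩

lemma exists_cell_inequalities {A : Set (E →ₗ[ℝ] ℝ)} (hA : Arr L A) (x : E) :
    ∃ B : Set (E →ₗ[ℝ] ℝ), Arr L B ∧ ∀ y, InCell A x y ↔ ∀ b ∈ B, 0 ≤ b y := by
  refine ⟨{a | a ∈ A ∧ 0 ≤ a x} ∪ (fun a => -a) '' {a | a ∈ A ∧ a x ≤ 0}, ⟨?_, ?_⟩, fun y => ?_⟩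
  · exact (hA.finite.subset fun u hu => hu.1).union
      ((hA.finite.subset fun u hu => hu.1).image _)
  · rintro _ (ha | ⟨a, ha, rfl⟩)
    exacts [hA.integral _ ha.1, (hA.integral _ ha.1).neg]
  · constructor
    · rintro h _ (ha | ⟨a, ha, rfl⟩)
      exacts [(h _ ha.1).1 ha.2, by simpa using (h _ ha.1).2 ha.2]
    · exact fun h a ha => ⟨fun h0 => h a (.inl ⟨ha, h0⟩),
        fun h0 => by simpa using h (-a) (.inr ⟨a, ⟨ha, h0⟩, rfl⟩)⟩

lemma IsLattice.cell_generators (hL : IsLattice L) {A : Set (E →ₗ[ℝ] ℝ)} (hA : Arr L A) (x : E) :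
    ∃ s : Set E, s.Finite ∧ s ⊆ (L : Set E) ∧ cell A x = PointedCone.hull ℝ s := by
  obtain ⟨B, hB, h⟩ := exists_cell_inequalities hA x
  obtain ⟨s, hs, hsL, h'⟩ := hL.exists_generators hB
  exact ⟨s, hs, hsL, by ext y; rw [mem_cell, h, h']⟩

lemma isRational_span {s : Set E} (hs : s ⊆ (L : Set E)) : IsRational L (Submodule.span ℝ s) :=
  Submodule.span_mono fun _ hx => ⟨hs hx, Submodule.subset_span hx⟩

lemma span_hull (s : Set E) :
    Submodule.span ℝ (PointedCone.hull ℝ s : Set E) = Submodule.span ℝ s :=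
  le_antisymm (Submodule.span_le.2 (PointedCone.hull_le_span (R := ℝ) s))
    (Submodule.span_mono PointedCone.subset_hull)

lemma IsLattice.isRational_lin (hL : IsLattice L) {A : Set (E →ₗ[ℝ] ℝ)} (hA : Arr L A) (x : E) :
    IsRational L (Lin A x) := by
  obtain ⟨s, -, hsL, h⟩ := hL.cell_generators hA x
  rw [← span_cell hA.finite, h, span_hull]
  exact isRational_span hsL

/-- On a rational subspace, an integral functional generates a discrete group of values. -/
lemma IsRational.exists_generator {W : Submodule ℝ E} (hW : IsRational L W) {a : E →ₗ[ℝ] ℝ}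
    (ha : IntegralOn L a) (h0 : ∃ w ∈ W, a w ≠ 0) :
    ∃ n ∈ L, n ∈ W ∧ 0 < a n ∧ ∀ m ∈ L, m ∈ W → ∃ k : ℤ, a m = k * a n := by
  -- The group of values of `a` on the lattice points of `W` is cyclic, and it is nonzero because
  -- these points span `W`.
  let H : AddSubgroup ℤ :=
    { carrier := {k | ∃ m ∈ L, m ∈ W ∧ a m = k}
      add_mem' := by
        rintro k l ⟨m, h1, h2, h3⟩ ⟨n, h4, h5, h6⟩
        exact ⟨m + n, add_mem h1 h4, add_mem h2 h5, by rw [map_add, h3, h6]; push_cast; rfl⟩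
      zero_mem' := ⟨0, zero_mem _, zero_mem _, by simp⟩
      neg_mem' := by
        rintro k ⟨m, h1, h2, h3⟩
        exact ⟨-m, neg_mem h1, neg_mem h2, by rw [map_neg, h3]; push_cast; rfl⟩ }
  obtain ⟨g, hg⟩ := Int.subgroup_cyclic H
  have hmem : ∀ k, k ∈ H ↔ ∃ l : ℤ, l * g = k := fun k => by
    rw [hg, ← AddSubgroup.zmultiples_eq_closure, AddSubgroup.mem_zmultiples_iff]; simp
  have hval : ∀ m ∈ L, m ∈ W → ∃ l : ℤ, a m = l * g := by
    intro m hm hmW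
    obtain ⟨k, hk⟩ := ha m hm
    obtain ⟨l, hl⟩ := (hmem k).1 ⟨m, hm, hmW, hk⟩
    exact ⟨l, by rw [hk, ← hl]; push_cast; rfl⟩
  have hg0 : g ≠ 0 := by
    rintro rfl
    obtain ⟨w, hw, hw0⟩ := h0
    apply hw0
    have : Submodule.span ℝ {x | x ∈ L ∧ x ∈ W} ≤ LinearMap.ker a := by
      refine Submodule.span_le.2 fun x hx => ?_
      obtain ⟨l, hl⟩ := hval x hx.1 hx.2
      simpa using hl
    exact this (hW hw)
  obtain ⟨n, hn, hnW, hna⟩ := (hmem g).2 ⟨1, by simp⟩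
  rcases hg0.lt_or_gt with hg0 | hg0
  · refine ⟨-n, neg_mem hn, neg_mem hnW, by rw [map_neg, hna]; exact_mod_cast neg_pos.2 hg0,
      fun m hm hmW => ?_⟩
    obtain ⟨l, hl⟩ := hval m hm hmW
    exact ⟨-l, by rw [map_neg, hna, hl]; push_cast; ring⟩
  · refine ⟨n, hn, hnW, by rw [hna]; exact_mod_cast hg0, fun m hm hmW => ?_⟩
    obtain ⟨l, hl⟩ := hval m hm hmW
    exact ⟨l, by rw [hna, hl]⟩

end Lattices

end Trop

namespace Trop

open Filter Topology

/-! ### Normal vectors, balancing and tropical sets -/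

section TropicalSets

variable {E : Type*} [AddCommGroup E] [Module ℝ E] {L : AddSubgroup E}

/-- `N` is a system of primitive normal vectors of the half-spaces `V + ℝ≥0 n` that make up `Y`. -/
structure NormalSystem (L : AddSubgroup E) (V : Submodule ℝ E) (Y : Set E) (N : Finset E) :
    Prop where
  mem_iff : ∀ v, v ∈ Y ↔ ∃ n ∈ N, ∃ s : ℝ, 0 ≤ s ∧ v - s • n ∈ V
  mem_lattice : ∀ n ∈ N, n ∈ L
  notMem : ∀ n ∈ N, n ∉ V
  primitive : ∀ n ∈ N, ∀ m ∈ L, ∀ s : ℝ, m - s • n ∈ V → ∃ k : ℤ, s = k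
  inj : ∀ n ∈ N, ∀ n' ∈ N, ∀ s : ℝ, 0 ≤ s → n - s • n' ∈ V → n = n'

/-- Modulo `V`, each of two generators of the same ray is a nonnegative multiple of the other. By
primitivity both factors are integers; their product is one, so they are one. -/
lemma NormalSystem.exists_partner {V : Submodule ℝ E} {Y : Set E} {N N' : Finset E}
    (h : NormalSystem L V Y N) (h' : NormalSystem L V Y N') {n : E} (hn : n ∈ N) :
    ∃ n' ∈ N', n - n' ∈ V := by
  obtain ⟨n', hn', s, hs, hns⟩ := (h'.mem_iff n).1
    ((h.mem_iff n).2 ⟨n, hn, 1, zero_le_one, by simp⟩)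
  obtain ⟨n'', hn'', r, hr, hnr⟩ := (h.mem_iff n').1
    ((h'.mem_iff n').2 ⟨n', hn', 1, zero_le_one, by simp⟩)
  have h1 : n - (s * r) • n'' ∈ V := by
    have := V.add_mem hns (V.smul_mem s hnr)
    convert this using 1; module
  obtain rfl := h.inj n hn n'' hn'' _ (mul_nonneg hs hr) h1
  have hsr : s * r = 1 := by
    by_contra hne
    apply h.notMem n hn
    rw [← one_smul ℝ n, smul_smul, ← sub_smul] at h1
    simp only [mul_one] at h1
    exact (V.smul_mem_iff (sub_ne_zero.2 (Ne.symm hne))).1 h1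
  obtain ⟨k, rfl⟩ := h'.primitive n' hn' n (h.mem_lattice n hn) s hns
  obtain ⟨l, rfl⟩ := h.primitive n hn n' (h'.mem_lattice n' hn') r hnr
  have hk : k = 1 := Int.eq_one_of_mul_eq_one_right (by exact_mod_cast hs) (by exact_mod_cast hsr)
  subst hk
  exact ⟨n', hn', by simpa using hns⟩

/-- The sum of the normal vectors is well-defined modulo `V`. -/
lemma NormalSystem.sum_sub_mem {V : Submodule ℝ E} {Y : Set E} {N N' : Finset E}
    (h : NormalSystem L V Y N) (h' : NormalSystem L V Y N') :
    ∑ n ∈ N, n - ∑ n ∈ N', n ∈ V := by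
  choose! p hp hpV using fun n (hn : n ∈ N) => h.exists_partner h' hn
  have hsum : ∑ n ∈ N, p n = ∑ n ∈ N', n := by
    refine Finset.sum_bij (fun n _ => p n) hp ?_ ?_ fun _ _ => rfl
    · intro n hn m hm hnm
      refine h.inj n hn m hm 1 zero_le_one ?_
      have h1 := V.sub_mem (hpV n hn) (hpV m hm)
      rw [hnm] at h1
      convert h1 using 1; module
    · intro n' hn'
      obtain ⟨n, hn, hnV⟩ := h'.exists_partner h hn'
      refine ⟨n, hn, h'.inj _ (hp n hn) n' hn' 1 zero_le_one ?_⟩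
      have h1 := V.add_mem (hpV n hn) hnV
      rw [← neg_mem_iff]
      convert h1 using 1; module
  rw [← hsum, ← Finset.sum_sub_distrib]
  exact V.sum_mem hpV

lemma NormalSystem.sum_mem {V : Submodule ℝ E} {Y : Set E} {N N' : Finset E}
    (h : NormalSystem L V Y N) (h' : NormalSystem L V Y N') (hN : ∑ n ∈ N, n ∈ V) :
    ∑ n ∈ N', n ∈ V := by
  have := V.sub_mem hN (h.sum_sub_mem h')
  rwa [sub_sub_cancel] at this

/-- The two normal vectors of a rational hyperplane in a rational vector space. -/
lemma exists_normalSystem_of_submodule [DecidableEq E] {V W : Submodule ℝ E} (hW : IsRational L W) (hVW : V ≤ W)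
    {a : E →ₗ[ℝ] ℝ} (ha : IntegralOn L a) (haW : ∃ w ∈ W, a w ≠ 0)
    (hV : ∀ w ∈ W, a w = 0 → w ∈ V) (haV : ∀ v ∈ V, a v = 0) :
    ∃ n : E, n ≠ -n ∧ n ∈ W ∧ NormalSystem L V (W : Set E) {n, -n} := by
  obtain ⟨n, hn, hnW, hpos, hgen⟩ := hW.exists_generator ha haW
  have hmem : ∀ m ∈ ({n, -n} : Finset E), m = n ∨ m = -n := by simp
  have hmW : ∀ m ∈ ({n, -n} : Finset E), m ∈ W := fun m hm => by
    rcases hmem m hm with rfl | rfl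
    exacts [hnW, neg_mem hnW]
  have hne : n ≠ -n := fun h => by
    have := congr_arg a h
    rw [map_neg] at this
    linarith
  refine ⟨n, hne, hnW, ⟨fun v => ⟨fun hv => ?_, ?_⟩, ?_, ?_, ?_, ?_⟩⟩
  · rcases le_total 0 (a v) with h | h
    · refine ⟨n, by simp, a v / a n, div_nonneg h hpos.le,
        hV _ (sub_mem hv (W.smul_mem _ hnW)) ?_⟩
      simp [hpos.ne']
    · refine ⟨-n, by simp, -(a v / a n), neg_nonneg.2 (div_nonpos_of_nonpos_of_nonneg h hpos.le),
        hV _ (sub_mem hv (W.smul_mem _ (neg_mem hnW))) ?_⟩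
      simp [hpos.ne']
  · rintro ⟨m, hm, s, -, h⟩
    have := W.add_mem (hVW h) (W.smul_mem s (hmW m hm))
    rwa [sub_add_cancel] at this
  · intro m hm
    rcases hmem m hm with rfl | rfl
    exacts [hn, neg_mem hn]
  · intro m hm hmV
    have := haV m hmV
    rcases hmem m hm with rfl | rfl
    · exact hpos.ne' this
    · rw [map_neg, neg_eq_zero] at this; exact hpos.ne' this
  · intro m hm l hl s h
    have hlW : l ∈ W := by
      have := W.add_mem (hVW h) (W.smul_mem s (hmW m hm))
      rwa [sub_add_cancel] at this
    obtain ⟨k, hk⟩ := hgen l hl hlW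
    have := haV _ h
    rcases hmem m hm with rfl | rfl
    · refine ⟨k, mul_right_cancel₀ hpos.ne' ?_⟩
      simp only [map_sub, map_smul, smul_eq_mul] at this
      linarith
    · refine ⟨-k, mul_right_cancel₀ hpos.ne' ?_⟩
      simp only [map_sub, map_smul, smul_eq_mul, map_neg] at this
      push_cast
      linarith
  · intro m hm m' hm' s hs h
    have := haV _ h
    simp only [map_sub, map_smul, smul_eq_mul] at this
    have h0 := mul_nonneg hs hpos.le
    rcases hmem m hm with rfl | rfl <;> rcases hmem m' hm' with rfl | rfl
    · rfl
    · rw [map_neg] at this; linarith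
    · rw [map_neg] at this; linarith
    · rfl

/-- A finite union of cells of pure dimension `d`, balanced (with all weights one). -/
structure TropA (L : AddSubgroup E) (d : ℕ) (A : Set (E →ₗ[ℝ] ℝ)) (X : Set E) : Prop where
  arr : Arr L A
  cellular : Cellular A X
  pure : ∀ x ∈ X, ∃ y ∈ X, InCell A y x ∧ Module.finrank ℝ (Lin A y) = d
  balanced : ∀ x ∈ X, Module.finrank ℝ (Lin A x) + 1 = d →
    ∃ N, NormalSystem L (Lin A x) (Loc X x) N ∧ ∑ n ∈ N, n ∈ Lin A x

/-- The support of a reduced tropical fan of dimension `d` (or the empty set). -/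
def TropSet (L : AddSubgroup E) (d : ℕ) (X : Set E) : Prop := ∃ A, TropA L d A X

lemma tropA_empty {A : Set (E →ₗ[ℝ] ℝ)} (hA : Arr L A) (d : ℕ) : TropA L d A (∅ : Set E) :=
  ⟨hA, fun _ h => h.elim, fun _ h => h.elim, fun _ h => h.elim⟩

lemma TropA.finrank_le [FiniteDimensional ℝ E] {d : ℕ} {A : Set (E →ₗ[ℝ] ℝ)} {X : Set E}
    (h : TropA L d A X) {x : E} (hx : x ∈ X) : Module.finrank ℝ (Lin A x) ≤ d := by
  obtain ⟨y, -, hyx, hd⟩ := h.pure x hx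
  rw [← hd]
  exact Submodule.finrank_mono hyx.lin_le

/-- Moving away from `x` inside `X` can only enlarge the span of the cell, but here it is already of
maximal dimension. -/
lemma TropA.loc_eq_lin [FiniteDimensional ℝ E] {d : ℕ} {A : Set (E →ₗ[ℝ] ℝ)} {X : Set E}
    (h : TropA L d A X) {x : E} (hx : x ∈ X) (hd : Module.finrank ℝ (Lin A x) = d) :
    Loc X x = Lin A x := by
  refine subset_antisymm (fun v hv => ?_) (h.cellular.lin_subset_loc h.arr.finite hx)
  obtain ⟨t, ht⟩ := exists_near h.arr.finite x v
  rw [← h.cellular.near_mem_iff h.arr.finite ht] at hv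
  have h1 : Lin A x = Lin A (x + t • v) :=
    Submodule.eq_of_le_of_finrank_le ht.inCell.lin_le (by rw [hd]; exact h.finrank_le hv)
  have h2 := self_mem_lin A (x + t • v)
  rw [← h1] at h2
  have h3 := (Submodule.add_mem_iff_right _ (self_mem_lin A x)).1 h2
  exact (Submodule.smul_mem_iff _ ht.1.ne').1 h3

/-- A generic point of `Lin A x` near `x` stays in the interior of the `A`-cell, and no functional
of `B` vanishes at it without vanishing on all of `Lin A x`. -/
lemma exists_generic_in_cell {A B : Set (E →ₗ[ℝ] ℝ)} (hB : B.Finite) (hAB : A ⊆ B)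
    (x : E) : ∃ y, InCell A x y ∧ InCell B y x ∧ Lin B y = Lin A x := by
  obtain ⟨w, hw, hwx, hgen⟩ := exists_generic hB (Lin A x) (self_mem_lin A x)
  have hxw : InCell A x w := by
    intro a ha
    refine ⟨fun h => ?_, fun h => ?_⟩
    · rcases h.eq_or_lt with h | h
      · exact (hw a ha h.symm).ge
      · exact le_of_not_gt fun h' => h.not_ge ((hwx a (hAB ha)).2 h'.le)
    · rcases h.eq_or_lt with h | h
      · exact (hw a ha h).le
      · exact le_of_not_gt fun h' => h.not_ge ((hwx a (hAB ha)).1 h'.le)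
  refine ⟨w, hxw, hwx, le_antisymm ?_ ?_⟩
  · exact (lin_mono hAB w).trans hxw.lin_le
  · exact fun v hv a ha haw => hgen a ha haw v hv

/-- Balancing where the local cone is a vector space. -/
lemma exists_balanced_of_loc_eq [DecidableEq E] (hL : IsLattice L) {B : Set (E →ₗ[ℝ] ℝ)} (hB : Arr L B)
    {W : Submodule ℝ E} (hW : IsRational L W) {x : E} (hle : Lin B x ≤ W)
    (hdim : Module.finrank ℝ (Lin B x) + 1 = Module.finrank ℝ W) :
    ∃ n : E, n ≠ -n ∧ n ∈ W ∧ NormalSystem L (Lin B x) (W : Set E) {n, -n} := by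
  have := hL.finiteDimensional
  have hne : ¬ W ≤ Lin B x := fun h => by
    have := Submodule.finrank_mono h; omega
  obtain ⟨w, hw, hwB⟩ := SetLike.not_le_iff_exists.1 hne
  simp only [mem_lin, not_forall] at hwB
  obtain ⟨b, hb, hbx, hbw⟩ := hwB
  have h1 : Lin B x ≤ W ⊓ LinearMap.ker b := le_inf hle fun v hv => hv b hb hbx
  have h2 : W ⊓ LinearMap.ker b < W :=
    lt_of_le_of_ne inf_le_left fun h => hbw (by rw [← h] at hw; exact hw.2)
  have h3 : Lin B x = W ⊓ LinearMap.ker b :=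
    Submodule.eq_of_le_of_finrank_le h1 (by have := Submodule.finrank_lt_finrank_of_lt h2; omega)
  exact exists_normalSystem_of_submodule hW hle (hB.integral b hb) ⟨w, hw, hbw⟩
    (fun v hv hbv => by rw [h3]; exact ⟨hv, hbv⟩) fun v hv => hv b hb hbx

/-- A wall of the refinement either has the span of an old wall, with the same balancing condition,
or lies inside a top-dimensional cell, where the local cone is a vector space and the two normal
vectors `n` and `-n` cancel. -/
lemma TropA.mono (hL : IsLattice L) {d : ℕ} {A B : Set (E →ₗ[ℝ] ℝ)} {X : Set E}
    (h : TropA L d A X) (hB : Arr L B) (hAB : A ⊆ B) : TropA L d B X := by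
  classical
  have := hL.finiteDimensional
  refine ⟨hB, h.cellular.mono hAB, fun x hx => ?_, fun x hx hd => ?_⟩
  · obtain ⟨y, hy, hyx, hd⟩ := h.pure x hx
    obtain ⟨z, hyz, hzy, hlin⟩ := exists_generic_in_cell hB.finite hAB y
    have hzyA := hzy.mono hAB
    -- The closed `B`-cell of `z` need not contain `x`, but that of `x + t • z` does, and the span
    -- is the same.
    obtain ⟨t, ht⟩ := exists_near hB.finite x z
    have htA : Near A x z t := ⟨ht.1, fun a ha => ht.2 a (hAB ha)⟩
    have hzx : InCell A z x := hzyA.trans hyx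
    have hsame := hzx.near_same htA
    refine ⟨x + t • z, h.cellular y hy _ (hyz.trans hsame.1), ht.inCell, ?_⟩
    have hle : Lin B (x + t • z) = Lin B z := by
      refine le_antisymm (fun v hv b hb hbz => ?_) fun v hv b hb hb0 =>
        hv b hb ((ht.eq_zero_iff hb).1 hb0).2
      have hbx : b x = 0 := by
        have : x ∈ Lin B z := by rw [hlin]; exact hyx.mem_lin
        exact this b hb hbz
      exact hv b hb (by simp [hbx, hbz])
    rw [hle, hlin, hd]
  · have hle := lin_mono hAB x
    have h1 := Submodule.finrank_mono hle
    have h2 := h.finrank_le hx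
    rcases (show Module.finrank ℝ (Lin A x) + 1 = d ∨ Module.finrank ℝ (Lin A x) = d by omega)
      with h3 | h3
    · have h4 : Lin B x = Lin A x := Submodule.eq_of_le_of_finrank_le hle (by omega)
      rw [h4]
      exact h.balanced x hx h3
    · obtain ⟨n, hne, -, hn⟩ := exists_balanced_of_loc_eq hL hB
        (hL.isRational_lin h.arr x) hle (by omega)
      refine ⟨{n, -n}, by rwa [h.loc_eq_lin hx h3], ?_⟩
      rw [Finset.sum_pair hne, add_neg_cancel]
      exact zero_mem _

/-- Every coarse cell contains in its interior a generic point whose fine cell has the same span.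
Dimensions and balancing are read off there. -/
lemma TropA.descend (hL : IsLattice L) {d : ℕ} {A B : Set (E →ₗ[ℝ] ℝ)} {X : Set E}
    (h : TropA L d B X) (hAB : A ⊆ B) (hX : Cellular A X) : TropA L d A X := by
  have := hL.finiteDimensional
  have hA := h.arr.mono hAB
  refine ⟨hA, hX, fun x hx => ?_, fun x hx hd => ?_⟩
  · obtain ⟨y, hy, hyx, hd⟩ := h.pure x hx
    refine ⟨y, hy, hyx.mono hAB, le_antisymm ?_ ?_⟩
    · obtain ⟨z, hyz, hzy, hlin⟩ := exists_generic_in_cell h.arr.finite hAB y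
      rw [← hlin]
      exact h.finrank_le (hX _ hy _ hyz)
    · rw [← hd]
      exact Submodule.finrank_mono (lin_mono hAB y)
  · obtain ⟨z, hxz, hzx, hlin⟩ := exists_generic_in_cell h.arr.finite hAB x
    have := h.balanced z (hX _ hx _ hxz) (by rw [hlin, hd])
    rwa [hlin, ← hX.loc_congr hA.finite hxz (hzx.mono hAB)] at this

lemma TropSet.of_cellular (hL : IsLattice L) {d : ℕ} {A : Set (E →ₗ[ℝ] ℝ)} {X : Set E}
    (h : TropSet L d X) (hA : Arr L A) (hX : Cellular A X) : TropA L d A X := by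
  obtain ⟨B, hB⟩ := h
  exact (hB.mono hL (hA.union hB.arr) Set.subset_union_right).descend hL Set.subset_union_left hX

/-- The cell and the local cone at a direction `v` of `Loc X x` are those of `X` at a point `x + t
v` infinitely near to `x`. -/
lemma TropA.loc {d : ℕ} {A : Set (E →ₗ[ℝ] ℝ)} {X : Set E}
    (h : TropA L d A X) (x : E) : TropA L d {a ∈ A | a x = 0} (Loc X x) := by
  have hfin := h.arr.finite
  refine ⟨h.arr.mono (Set.sep_subset _ _), h.cellular.loc hfin x, fun v hv => ?_, fun v hv hd => ?_⟩
  · obtain ⟨t, ht⟩ := exists_near hfin x v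
    have hm := (h.cellular.near_mem_iff hfin ht).2 hv
    obtain ⟨y, hy, hyx, hd⟩ := h.pure _ hm
    obtain ⟨r, hr⟩ := exists_near hfin x y
    have hyx0 := hyx.trans ht.inCell
    have hsame := hyx0.near_same hr
    refine ⟨y, ?_, ?_, ?_⟩
    · rw [← h.cellular.near_mem_iff hfin hr]
      exact h.cellular y hy _ hsame.1
    · intro a ha
      have h1 := hyx a ha.1
      rw [(ht.2 a ha.1).1, (ht.2 a ha.1).2] at h1
      have := ha.2
      grind
    · rw [← hr.lin_eq, ← lin_congr hsame.1 hsame.2, hd]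
  · obtain ⟨t, ht⟩ := exists_near hfin x v
    rw [h.cellular.loc_loc hfin ht, ← ht.lin_eq]
    exact h.balanced _ ((h.cellular.near_mem_iff hfin ht).2 hv) (by rwa [ht.lin_eq])

lemma TropSet.loc {d : ℕ} {X : Set E} (h : TropSet L d X) (x : E) : TropSet L d (Loc X x) :=
  let ⟨_, hA⟩ := h; ⟨_, hA.loc x⟩

lemma TropSet.zero_mem {d : ℕ} {X : Set E} (h : TropSet L d X) (hX : X.Nonempty) : (0 : E) ∈ X :=
  let ⟨_, hA⟩ := h; hA.cellular.zero_mem hX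

/-- The empty arrangement has a single cell and no walls. -/
lemma tropA_univ (L : AddSubgroup E) :
    TropA L (Module.finrank ℝ E) ∅ (Set.univ : Set E) := by
  have hlin : ∀ x : E, Lin ∅ x = ⊤ := fun x => eq_top_iff.2 fun v _ a ha => ha.elim
  refine ⟨⟨Set.finite_empty, fun _ h => h.elim⟩, fun _ _ _ _ => trivial, fun x hx => ?_,
    fun x hx hd => ?_⟩
  · exact ⟨x, hx, InCell.refl _ _, by rw [hlin, finrank_top]⟩
  · rw [hlin, finrank_top] at hd; omega

end TropicalSets

/-! ### Integral isomorphisms of sets -/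

section Transport

variable {E E' : Type*} [AddCommGroup E] [Module ℝ E] [AddCommGroup E'] [Module ℝ E']
  {L : AddSubgroup E} {L' : AddSubgroup E'}

/-- The integral linear maps `f` and `g` restrict to mutually inverse bijections of `X` and `X'`. -/
structure SetIso (L : AddSubgroup E) (X : Set E) (L' : AddSubgroup E') (X' : Set E')
    (f : E →ₗ[ℝ] E') (g : E' →ₗ[ℝ] E) : Prop where
  lattice : ∀ x ∈ L, f x ∈ L'
  inv_lattice : ∀ y ∈ L', g y ∈ L
  map : ∀ x ∈ X, f x ∈ X'
  inv_map : ∀ y ∈ X', g y ∈ X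
  left_inv : ∀ x ∈ X, g (f x) = x
  right_inv : ∀ y ∈ X', f (g y) = y

variable {X : Set E} {X' : Set E'} {f : E →ₗ[ℝ] E'} {g : E' →ₗ[ℝ] E}

lemma SetIso.symm (h : SetIso L X L' X' f g) : SetIso L' X' L X g f :=
  ⟨h.inv_lattice, h.lattice, h.inv_map, h.map, h.right_inv, h.left_inv⟩

lemma SetIso.refl (L : AddSubgroup E) (X : Set E) :
    SetIso L X L X LinearMap.id LinearMap.id :=
  ⟨fun _ h => h, fun _ h => h, fun _ h => h, fun _ h => h, fun _ _ => rfl, fun _ _ => rfl⟩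

lemma SetIso.trans {E'' : Type*} [AddCommGroup E''] [Module ℝ E''] {L'' : AddSubgroup E''}
    {X'' : Set E''} {f' : E' →ₗ[ℝ] E''} {g' : E'' →ₗ[ℝ] E'}
    (h : SetIso L X L' X' f g) (h' : SetIso L' X' L'' X'' f' g') :
    SetIso L X L'' X'' (f' ∘ₗ f) (g ∘ₗ g') :=
  ⟨fun x hx => h'.lattice _ (h.lattice x hx), fun x hx => h.inv_lattice _ (h'.inv_lattice x hx),
    fun x hx => h'.map _ (h.map x hx), fun x hx => h.inv_map _ (h'.inv_map x hx),
    fun x hx => by simp [h'.left_inv _ (h.map x hx), h.left_inv x hx],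
    fun x hx => by simp [h.right_inv _ (h'.inv_map x hx), h'.right_inv x hx]⟩

lemma SetIso.loc (h : SetIso L X L' X' f g) (x : E) (hx : x ∈ X) :
    SetIso L (Loc X x) L' (Loc X' (f x)) f g := by
  refine ⟨h.lattice, h.inv_lattice, fun v hv => ?_, fun w hw => ?_, fun v hv => ?_, fun w hw => ?_⟩
  · exact (mem_loc.1 hv).mono fun t ht => by simpa using h.map _ ht
  · exact (mem_loc.1 hw).mono fun t ht => by simpa [h.left_inv x hx] using h.inv_map _ ht
  · obtain ⟨t, ht, ht0⟩ := ((mem_loc.1 hv).and ev_pos).exists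
    have := h.left_inv _ ht
    simp only [map_add, map_smul, h.left_inv x hx, add_right_inj] at this
    exact smul_right_injective E ht0.ne' this
  · obtain ⟨t, ht, ht0⟩ := ((mem_loc.1 hw).and ev_pos).exists
    have := h.right_inv _ ht
    simp only [map_add, map_smul, h.left_inv x hx, add_right_inj] at this
    exact smul_right_injective E' ht0.ne' this

/-- Transport of tropical sets along isomorphisms, with matching cells. -/
lemma SetIso.exists_tropA (h : SetIso L X L' X' f g) (hL : IsLattice L) (hL' : IsLattice L')
    {d : ℕ} {A₀ : Set (E →ₗ[ℝ] ℝ)} (hX : TropA L d A₀ X) :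
    ∃ A A', A₀ ⊆ A ∧ TropA L d A X ∧ TropA L' d A' X' ∧ (∀ v, (∀ a ∈ A, a v = 0) → v = 0) ∧
      (∀ v, (∀ a ∈ A', a v = 0) → v = 0) ∧ ∀ x ∈ X, ∀ y, InCell A' (f x) y ↔
        f (g y) = y ∧ InCell A x (g y) := by
  have := hL.finiteDimensional
  have := hL'.finiteDimensional
  obtain ⟨C, hC, hCsep⟩ := hL.exists_separating
  obtain ⟨C', hC', hCsep'⟩ := hL'.exists_separating
  -- The maps are mutually inverse only on `X` and `X'`. The functionals built from `id - g ∘ f` and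
  -- `id - f ∘ g` vanish there, which forces the maps to be mutually inverse on the spans of all
  -- cells that occur.
  set A : Set (E →ₗ[ℝ] ℝ) := A₀ ∪ (C ∪ (fun c => c ∘ₗ (LinearMap.id - g ∘ₗ f)) '' C) with hAdef
  set A' : Set (E' →ₗ[ℝ] ℝ) := (fun a => a ∘ₗ g) '' A ∪
    (fun c => c ∘ₗ (LinearMap.id - f ∘ₗ g)) '' C' with hA'def
  have hArr : Arr L A := by
    refine hX.arr.union (hC.union ⟨hC.finite.image _, ?_⟩)
    rintro _ ⟨c, hc, rfl⟩
    exact (hC.integral c hc).comp fun x hx =>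
      sub_mem hx (h.inv_lattice _ (h.lattice x hx))
  have hArr' : Arr L' A' := by
    refine ⟨(hArr.finite.image _).union (hC'.finite.image _), ?_⟩
    rintro _ (⟨a, ha, rfl⟩ | ⟨c, hc, rfl⟩)
    · exact (hArr.integral a ha).comp h.inv_lattice
    · exact (hC'.integral c hc).comp fun x hx =>
        sub_mem hx (h.lattice _ (h.inv_lattice x hx))
  have hXA := hX.mono hL hArr Set.subset_union_left
  have hAsep : ∀ v, (∀ a ∈ A, a v = 0) → v = 0 := fun v hv =>
    hCsep v fun a ha => hv a (.inr (.inl ha))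
  have hfg : ∀ y ∈ X', ∀ w, InCell A' y w → f (g w) = w := by
    intro y hy w hw
    have : w - f (g w) = 0 := hCsep' _ fun c hc =>
      hw.eq_zero (.inr ⟨c, hc, rfl⟩) (by simp [h.right_inv y hy])
    exact (sub_eq_zero.1 this).symm
  have hfgL : ∀ y ∈ X', ∀ w ∈ Lin A' y, f (g w) = w := by
    intro y hy w hw
    have : w - f (g w) = 0 := hCsep' _ fun c hc =>
      hw _ (.inr ⟨c, hc, rfl⟩) (by simp [h.right_inv y hy])
    exact (sub_eq_zero.1 this).symm
  have hgfL : ∀ x ∈ X, ∀ w ∈ Lin A x, g (f w) = w := by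
    intro x hx w hw
    have : w - g (f w) = 0 := hCsep _ fun c hc =>
      hw _ (.inr (.inr ⟨c, hc, rfl⟩)) (by simp [h.left_inv x hx])
    exact (sub_eq_zero.1 this).symm
  have hcell : ∀ x ∈ X, ∀ y, InCell A' (f x) y ↔ f (g y) = y ∧ InCell A x (g y) := by
    intro x hx y
    refine ⟨fun H => ⟨hfg _ (h.map x hx) y H, fun a ha => ?_⟩, ?_⟩
    · simpa [h.left_inv x hx] using H _ (.inl ⟨a, ha, rfl⟩)
    · rintro ⟨h1, h2⟩ _ (⟨a, ha, rfl⟩ | ⟨c, hc, rfl⟩)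
      · simpa [h.left_inv x hx] using h2 a ha
      · simp [h1]
  have hlin : ∀ x ∈ X, ∀ v, v ∈ Lin A' (f x) ↔ f (g v) = v ∧ g v ∈ Lin A x := by
    intro x hx y
    refine ⟨fun H => ⟨hfgL _ (h.map x hx) y H, fun a ha h0 => ?_⟩, ?_⟩
    · exact H _ (.inl ⟨a, ha, rfl⟩) (by simpa [h.left_inv x hx] using h0)
    · rintro ⟨h1, h2⟩ _ (⟨a, ha, rfl⟩ | ⟨c, hc, rfl⟩) h0
      · exact h2 a ha (by simpa [h.left_inv x hx] using h0)
      · simp [h1]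
  have hrank : ∀ x ∈ X, Module.finrank ℝ (Lin A' (f x)) = Module.finrank ℝ (Lin A x) := by
    intro x hx
    have hmem : ∀ v ∈ Lin A x, f v ∈ Lin A' (f x) := fun v hv => by
      rw [hlin x hx, hgfL x hx v hv]; exact ⟨rfl, hv⟩
    refine (LinearEquiv.finrank_eq (LinearEquiv.ofLinearMap (f.restrict hmem)
      (g.restrict fun v hv => ((hlin x hx v).1 hv).2) ?_ ?_)).symm
    · ext v; exact ((hlin x hx v).1 v.2).1
    · ext v; exact hgfL x hx v v.2
  refine ⟨A, A', Set.subset_union_left, hXA, ⟨hArr', fun y hy w hw => ?_, fun y hy => ?_,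
    fun y hy hd => ?_⟩, hAsep, fun v hv => ?_, hcell⟩
  · have h1 := hw
    rw [← h.right_inv y hy, hcell _ (h.inv_map y hy)] at h1
    rw [← h1.1]
    exact h.map _ (hXA.cellular _ (h.inv_map y hy) _ h1.2)
  · obtain ⟨z, hz, hzx, hd⟩ := hXA.pure _ (h.inv_map y hy)
    exact ⟨f z, h.map z hz, (hcell z hz y).2 ⟨h.right_inv y hy, hzx⟩, by rw [hrank z hz, hd]⟩
  · obtain ⟨x, hx, rfl⟩ : ∃ x ∈ X, y = f x := ⟨g y, h.inv_map y hy, (h.right_inv y hy).symm⟩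
    rw [hrank x hx] at hd
    obtain ⟨N, hN, hsum⟩ := hXA.balanced x hx hd
    have hiso := h.loc x hx
    have hNloc : ∀ n ∈ N, n ∈ Loc X x := fun n hn => (hN.mem_iff n).2 ⟨n, hn, 1, by simp⟩
    have hgf : ∀ n ∈ N, g (f n) = n := fun n hn => hiso.left_inv n (hNloc n hn)
    have hmemV : ∀ v, g (f v) = v → (f v ∈ Lin A' (f x) ↔ v ∈ Lin A x) := fun v hv => by
      rw [hlin x hx, hv]; simp
    classical
    refine ⟨N.image f, ⟨fun v => ⟨fun hv => ?_, ?_⟩, ?_, ?_, ?_, ?_⟩, ?_⟩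
    · obtain ⟨n, hn, s, hs, hv'⟩ := (hN.mem_iff _).1 (hiso.inv_map v hv)
      refine ⟨f n, Finset.mem_image_of_mem f hn, s, hs, ?_⟩
      rw [hlin x hx]
      simp [hiso.right_inv v hv, hgf n hn, hv']
    · rintro ⟨_, hm, s, hs, hv⟩
      obtain ⟨n, hn, rfl⟩ := Finset.mem_image.1 hm
      have h1 := (hlin x hx _).1 hv
      simp only [map_sub, map_smul, hgf n hn, sub_left_inj] at h1
      rw [← h1.1]
      exact hiso.map _ ((hN.mem_iff _).2 ⟨n, hn, s, hs, h1.2⟩)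
    · intro _ hm
      obtain ⟨n, hn, rfl⟩ := Finset.mem_image.1 hm
      exact h.lattice _ (hN.mem_lattice n hn)
    · intro _ hm
      obtain ⟨n, hn, rfl⟩ := Finset.mem_image.1 hm
      rw [hmemV n (hgf n hn)]
      exact hN.notMem n hn
    · intro _ hm m hmL s hv
      obtain ⟨n, hn, rfl⟩ := Finset.mem_image.1 hm
      have h1 := (hlin x hx _).1 hv
      simp only [map_sub, map_smul, hgf n hn] at h1
      exact hN.primitive n hn _ (h.inv_lattice m hmL) s h1.2
    · intro _ hm _ hm' s hs hv
      obtain ⟨n, hn, rfl⟩ := Finset.mem_image.1 hm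
      obtain ⟨n', hn', rfl⟩ := Finset.mem_image.1 hm'
      have h1 := (hlin x hx _).1 hv
      simp only [map_sub, map_smul, hgf n hn, hgf n' hn'] at h1
      rw [hN.inj n hn n' hn' s hs h1.2]
    · rw [Finset.sum_image fun n hn m hm hnm => by rw [← hgf n hn, hnm, hgf m hm], ← map_sum,
        hmemV _ (hgfL x hx _ hsum)]
      exact hsum
  · refine hCsep' v fun c hc => ?_
    have hgv : g v = 0 := hAsep _ fun a ha => hv _ (.inl ⟨a, ha, rfl⟩)
    simpa [hgv] using hv _ (.inr ⟨c, hc, rfl⟩)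

lemma SetIso.tropSet (h : SetIso L X L' X' f g) (hL : IsLattice L) (hL' : IsLattice L')
    {d : ℕ} (hX : TropSet L d X) : TropSet L' d X' := by
  obtain ⟨A₀, hA₀⟩ := hX
  obtain ⟨A, A', -, -, h', -⟩ := h.exists_tropA hL hL' hA₀
  exact ⟨A', h'⟩

end Transport

end Trop

namespace Trop

open Filter Topology

set_option linter.unusedSectionVars false

/-! ### Products with vector spaces -/

section Product

variable {E F : Type*} [AddCommGroup E] [Module ℝ E] [AddCommGroup F] [Module ℝ F]
  {L : AddSubgroup E} {Λ : AddSubgroup F}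

lemma finrank_submodule_prod [FiniteDimensional ℝ E] [FiniteDimensional ℝ F]
    (V : Submodule ℝ E) (W : Submodule ℝ F) :
    Module.finrank ℝ (V.prod W) = Module.finrank ℝ V + Module.finrank ℝ W := by
  rw [← Module.finrank_prod]
  exact LinearEquiv.finrank_eq
    { toFun := fun x => (⟨x.1.1, x.2.1⟩, ⟨x.1.2, x.2.2⟩)
      invFun := fun x => ⟨(x.1.1, x.2.1), x.1.2, x.2.2⟩
      map_add' := fun _ _ => rfl
      map_smul' := fun _ _ => rfl
      left_inv := fun _ => rfl
      right_inv := fun _ => rfl }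

lemma IsLattice.prod (hL : IsLattice L) (hΛ : IsLattice Λ) : IsLattice (L.prod Λ) := by
  obtain ⟨C, hC, hsep⟩ := hL.exists_separating
  obtain ⟨C', hC', hsep'⟩ := hΛ.exists_separating
  refine isLattice_of_separating (C := (fun c => c ∘ₗ LinearMap.fst ℝ E F) '' C ∪
    (fun c => c ∘ₗ LinearMap.snd ℝ E F) '' C') ?_
    ⟨(hC.finite.image _).union (hC'.finite.image _), ?_⟩ fun v hv => ?_
  · have h1 : Submodule.map (LinearMap.inl ℝ E F) (Submodule.span ℝ (L : Set E)) ≤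
        Submodule.span ℝ (L.prod Λ : Set (E × F)) := by
      rw [Submodule.map_span_le]
      exact fun m hm => Submodule.subset_span ⟨hm, Λ.zero_mem⟩
    have h2 : Submodule.map (LinearMap.inr ℝ E F) (Submodule.span ℝ (Λ : Set F)) ≤
        Submodule.span ℝ (L.prod Λ : Set (E × F)) := by
      rw [Submodule.map_span_le]
      exact fun m hm => Submodule.subset_span ⟨zero_mem L, hm⟩
    rw [hL.span_eq_top] at h1
    rw [hΛ.span_eq_top] at h2
    rw [eq_top_iff]
    rintro ⟨x, y⟩ -
    have := add_mem (h1 ⟨x, trivial, rfl⟩) (h2 ⟨y, trivial, rfl⟩)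
    simpa using this
  · rintro _ (⟨c, hc, rfl⟩ | ⟨c, hc, rfl⟩)
    · exact (hC.integral c hc).comp fun x hx => hx.1
    · exact (hC'.integral c hc).comp fun x hx => hx.2
  · exact Prod.ext (hsep _ fun a ha => hv _ (.inl ⟨a, ha, rfl⟩))
      (hsep' _ fun a ha => hv _ (.inr ⟨a, ha, rfl⟩))

lemma isLattice_int : IsLattice (AddSubgroup.zmultiples (1 : ℝ)) := by
  refine ⟨1, Module.Basis.singleton (Fin 1) ℝ, ?_⟩
  rw [AddSubgroup.zmultiples_eq_closure]
  congr 1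
  ext x
  simp

lemma loc_prod_univ (X : Set E) (x : E) (y : F) :
    Loc (X ×ˢ (Set.univ : Set F)) (x, y) = Loc X x ×ˢ Set.univ := by
  ext ⟨v, w⟩
  simp [mem_loc]

lemma lin_comp_fst (A : Set (E →ₗ[ℝ] ℝ)) (x : E) (y : F) :
    Lin ((fun a => a ∘ₗ LinearMap.fst ℝ E F) '' A) (x, y) = (Lin A x).prod ⊤ := by
  ext ⟨v, w⟩
  simp [mem_lin]

lemma inCell_comp_fst {A : Set (E →ₗ[ℝ] ℝ)} {x x' : E} {y y' : F} :
    InCell ((fun a => a ∘ₗ LinearMap.fst ℝ E F) '' A) (x, y) (x', y') ↔ InCell A x x' := by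
  simp [InCell]

lemma Arr.comp_fst {A : Set (E →ₗ[ℝ] ℝ)} (hA : Arr L A) (Λ : AddSubgroup F) :
    Arr (L.prod Λ) ((fun a => a ∘ₗ LinearMap.fst ℝ E F) '' A) := by
  refine ⟨hA.finite.image _, ?_⟩
  rintro _ ⟨a, ha, rfl⟩
  exact (hA.integral a ha).comp fun x hx => hx.1

lemma NormalSystem.prod_univ {V : Submodule ℝ E} {Y : Set E} {N : Finset E}
    [DecidableEq (E × F)] (h : NormalSystem L V Y N) (Λ : AddSubgroup F) :
    NormalSystem (L.prod Λ) (V.prod (⊤ : Submodule ℝ F)) (Y ×ˢ Set.univ)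
      (N.image fun n => (n, (0 : F))) := by
  refine ⟨?_, ?_, ?_, ?_, ?_⟩
  · rintro ⟨v, w⟩
    simp [h.mem_iff v, Submodule.mem_prod]
  · simpa [AddSubgroup.mem_prod] using h.mem_lattice
  · simpa using h.notMem
  · simp only [Finset.forall_mem_image]
    rintro n hn ⟨m, l⟩ hm s hs
    exact h.primitive n hn m hm.1 s (by simpa [Submodule.mem_prod] using hs)
  · simp only [Finset.forall_mem_image]
    intro n hn n' hn' s hs hV
    rw [h.inj n hn n' hn' s hs (by simpa [Submodule.mem_prod] using hV)]

lemma sum_image_inl [DecidableEq (E × F)] (N : Finset E) :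
    ∑ n ∈ N.image (fun n => (n, (0 : F))), n = (∑ n ∈ N, n, 0) := by
  rw [Finset.sum_image fun n _ m _ h => (Prod.ext_iff.1 h).1]
  ext <;> simp [Prod.fst_sum, Prod.snd_sum]

lemma TropA.prod_univ [FiniteDimensional ℝ E] [FiniteDimensional ℝ F]
    {d : ℕ} {A : Set (E →ₗ[ℝ] ℝ)} {X : Set E} (h : TropA L d A X) (Λ : AddSubgroup F) :
    TropA (L.prod Λ) (d + Module.finrank ℝ F) ((fun a => a ∘ₗ LinearMap.fst ℝ E F) '' A)
      (X ×ˢ Set.univ) := by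
  have hrank : ∀ (x : E) (y : F), Module.finrank ℝ
      (Lin ((fun a => a ∘ₗ LinearMap.fst ℝ E F) '' A) (x, y)) =
        Module.finrank ℝ (Lin A x) + Module.finrank ℝ F := fun x y => by
    rw [lin_comp_fst, finrank_submodule_prod, finrank_top]
  refine ⟨h.arr.comp_fst Λ, ?_, ?_, ?_⟩
  · rintro ⟨x, y⟩ ⟨hx, -⟩ ⟨x', y'⟩ h'
    exact ⟨h.cellular x hx x' (inCell_comp_fst.1 h'), trivial⟩
  · rintro ⟨x, y⟩ ⟨hx, -⟩
    obtain ⟨z, hz, hzx, hd⟩ := h.pure x hx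
    exact ⟨(z, y), ⟨hz, trivial⟩, inCell_comp_fst.2 hzx, by rw [hrank, hd]⟩
  · rintro ⟨x, y⟩ ⟨hx, -⟩ hd
    rw [hrank] at hd
    obtain ⟨N, hN, hsum⟩ := h.balanced x hx (by omega)
    classical
    refine ⟨_, by rw [lin_comp_fst, loc_prod_univ]; exact hN.prod_univ Λ, ?_⟩
    rw [lin_comp_fst, sum_image_inl]
    exact ⟨hsum, trivial⟩

lemma TropSet.prod_univ [FiniteDimensional ℝ E] [FiniteDimensional ℝ F]
    {d : ℕ} {X : Set E} (h : TropSet L d X) (Λ : AddSubgroup F) :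
    TropSet (L.prod Λ) (d + Module.finrank ℝ F) (X ×ˢ (Set.univ : Set F)) :=
  let ⟨_, hA⟩ := h; ⟨_, hA.prod_univ Λ⟩

/-- The set is invariant under translation by `F`. Near a generic point `(0, k)` only functionals
vanishing at it matter, and by genericity these vanish on all of `F`; the others cannot be needed to
cut out the set. -/
lemma Cellular.of_prod_univ {B : Set (E × F →ₗ[ℝ] ℝ)} (hB : B.Finite) {X : Set E}
    (h : Cellular B (X ×ˢ (Set.univ : Set F))) :
    Cellular {b ∈ B | b ∘ₗ LinearMap.inr ℝ E F = 0} (X ×ˢ (Set.univ : Set F)) := by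
  rintro ⟨x, y⟩ ⟨hx, -⟩ ⟨x', y'⟩ h'
  refine ⟨?_, trivial⟩
  obtain ⟨k, -, -, hk⟩ := exists_generic (hB.image fun b => b ∘ₗ LinearMap.inr ℝ E F)
    (⊤ : Submodule ℝ F) (w₀ := 0) trivial
  obtain ⟨t, ht, ht'⟩ :=
    ((ev_near hB ((0 : E), k) (x, (0 : F))).and (ev_near hB ((0 : E), k) (x', (0 : F)))).exists
  have hmem : (0, k) + t • (x, (0 : F)) ∈ X ×ˢ (Set.univ : Set F) := by
    have : t • (x, (0 : F)) ∈ X ×ˢ (Set.univ : Set F) := h.smul_mem ⟨hx, trivial⟩ ht.1.le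
    exact ⟨by simpa using this.1, trivial⟩
  have hmem' : (0, k) + t • (x', (0 : F)) ∈ X ×ˢ (Set.univ : Set F) := by
    refine h _ hmem _ (ht.inCell_of ht' fun b hb hb0 => ?_)
    have hbr : b ∘ₗ LinearMap.inr ℝ E F = 0 :=
      LinearMap.ext fun v => hk _ ⟨b, hb, rfl⟩ (by simpa using hb0) v trivial
    have hsplit : ∀ u (v : F), b (u, v) = b (u, 0) := fun u v => by
      have h1 : b (0, v) = 0 := LinearMap.congr_fun hbr v
      have : (u, v) = (u, (0 : F)) + (0, v) := by simp
      rw [this, map_add, h1, add_zero]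
    have := h' b ⟨hb, hbr⟩
    rwa [hsplit, hsplit x'] at this
  have : t • x' ∈ X := by simpa using hmem'.1
  have := h.smul_mem (x := (t • x', (0 : F))) ⟨this, trivial⟩ (inv_nonneg.2 ht.1.le)
  simpa [smul_smul, inv_mul_cancel₀ ht.1.ne'] using this.1

/-- Once the arrangement has been coarsened to one pulled back from `E`, cells, dimensions and
normal vectors of the product project to those of `X`. -/
lemma TropSet.of_prod_univ (hL : IsLattice L) (hΛ : IsLattice Λ) {d : ℕ} {X : Set E}
    (h : TropSet (L.prod Λ) (d + Module.finrank ℝ F) (X ×ˢ (Set.univ : Set F))) :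
    TropSet L d X := by
  have := hL.finiteDimensional
  have := hΛ.finiteDimensional
  obtain ⟨B, hB⟩ := h
  set A : Set (E →ₗ[ℝ] ℝ) := (fun b => b ∘ₗ LinearMap.inl ℝ E F) ''
    {b ∈ B | b ∘ₗ LinearMap.inr ℝ E F = 0} with hA
  have hArr : Arr L A := by
    refine ⟨(hB.arr.finite.subset (Set.sep_subset _ _)).image _, ?_⟩
    rintro _ ⟨b, hb, rfl⟩
    exact (hB.arr.integral b hb.1).comp fun x hx => ⟨hx, Λ.zero_mem⟩
  have hArr' := hArr.comp_fst Λ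
  have hsub : (fun a => a ∘ₗ LinearMap.fst ℝ E F) '' A =
      {b ∈ B | b ∘ₗ LinearMap.inr ℝ E F = 0} := by
    rw [hA, Set.image_image]
    refine (Set.image_congr fun b hb => ?_).trans (Set.image_id' _)
    ext v
    · simp
    · exact (map_zero b).trans (LinearMap.congr_fun hb.2 v).symm
  have hcell : Cellular ((fun a => a ∘ₗ LinearMap.fst ℝ E F) '' A) (X ×ˢ (Set.univ : Set F)) := by
    rw [hsub]
    exact hB.cellular.of_prod_univ hB.arr.finite
  have hT := TropSet.of_cellular (hL.prod hΛ) ⟨B, hB⟩ hArr' hcell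
  have hrank : ∀ (x : E), Module.finrank ℝ
      (Lin ((fun a => a ∘ₗ LinearMap.fst ℝ E F) '' A) (x, (0 : F))) =
        Module.finrank ℝ (Lin A x) + Module.finrank ℝ F := fun x => by
    rw [lin_comp_fst, finrank_submodule_prod, finrank_top]
  refine ⟨A, hArr, fun x hx y hy => ?_, fun x hx => ?_, fun x hx hd => ?_⟩
  · exact (hT.cellular (x, (0 : F)) ⟨hx, trivial⟩ (y, 0) (inCell_comp_fst.2 hy)).1
  · obtain ⟨⟨z, w⟩, hz, hzx, hd⟩ := hT.pure (x, (0 : F)) ⟨hx, trivial⟩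
    refine ⟨z, hz.1, inCell_comp_fst.1 hzx, ?_⟩
    rw [lin_comp_fst, finrank_submodule_prod, finrank_top] at hd
    omega
  · obtain ⟨N, hN, hsum⟩ := hT.balanced (x, (0 : F)) ⟨hx, trivial⟩ (by rw [hrank]; omega)
    rw [lin_comp_fst, loc_prod_univ] at hN
    rw [lin_comp_fst] at hsum
    have hinj : ∀ n ∈ N, ∀ n' ∈ N, ∀ s : ℝ, 0 ≤ s → n.1 - s • n'.1 ∈ Lin A x → n = n' :=
      fun n hn n' hn' s hs h => hN.inj n hn n' hn' s hs ⟨h, trivial⟩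
    classical
    refine ⟨N.image Prod.fst, ⟨fun v => ?_, ?_, ?_, ?_, ?_⟩, ?_⟩
    · have := hN.mem_iff (v, 0)
      simp only [Set.mem_prod, Set.mem_univ, and_true, Submodule.mem_prod, Prod.fst_sub,
        Prod.smul_fst, Submodule.mem_top] at this
      rw [this, Finset.exists_mem_image]
    · simp only [Finset.forall_mem_image]
      exact fun n hn => (hN.mem_lattice n hn).1
    · simp only [Finset.forall_mem_image]
      exact fun n hn h => hN.notMem n hn ⟨h, trivial⟩
    · simp only [Finset.forall_mem_image]
      exact fun n hn m hm s h => hN.primitive n hn (m, 0) ⟨hm, Λ.zero_mem⟩ s ⟨h, trivial⟩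
    · simp only [Finset.forall_mem_image]
      exact fun n hn n' hn' s hs h => congr_arg _ (hinj n hn n' hn' s hs h)
    · rw [Finset.sum_image fun n hn m hm h => hinj n hn m hm 1 zero_le_one (by simp [h]),
        ← Prod.fst_sum]
      exact hsum.1

end Product

/-! ### Piecewise linear functions, their derivatives and modifications of sets -/

section Functions

variable {E : Type*} [AddCommGroup E] [Module ℝ E] {L : AddSubgroup E}

/-- The directional derivative of `φ` at `x`. -/
noncomputable def dir (φ : E → ℝ) (x v : E) : ℝ :=
  limUnder (𝓝[>] (0 : ℝ)) fun t => t⁻¹ * (φ (x + t • v) - φ x)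

lemma dir_eq {φ : E → ℝ} {x v : E} {c : ℝ}
    (h : ∀ᶠ t in 𝓝[>] (0 : ℝ), φ (x + t • v) = φ x + t * c) : dir φ x v = c := by
  refine Tendsto.limUnder_eq (tendsto_const_nhds.congr' ?_)
  filter_upwards [h, ev_pos] with t ht ht0
  rw [ht]
  field_simp
  ring

/-- `φ` is integral linear on the cells of `A` in `X`; `B` is the set of linear functions. -/
structure PLw (L : AddSubgroup E) (A B : Set (E →ₗ[ℝ] ℝ)) (X : Set E) (φ : E → ℝ) : Prop where
  arr : Arr L B
  -- This fixes the order of the functions of `B` on each cell; two of them that agree at `x` agree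
  -- on all of `Lin A x`.
  diff : ∀ ℓ ∈ B, ∀ ℓ' ∈ B, ℓ - ℓ' ∈ A
  linear : ∀ x ∈ X, ∃ ℓ ∈ B, ∀ y, InCell A x y → φ y = ℓ y

variable {A B : Set (E →ₗ[ℝ] ℝ)} {X : Set E} {φ : E → ℝ}

lemma PLw.mono {A' : Set (E →ₗ[ℝ] ℝ)} (h : PLw L A B X φ) (hA : A ⊆ A') : PLw L A' B X φ :=
  ⟨h.arr, fun ℓ hℓ ℓ' hℓ' => hA (h.diff ℓ hℓ ℓ' hℓ'), fun x hx =>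
    let ⟨ℓ, hℓ, H⟩ := h.linear x hx; ⟨ℓ, hℓ, fun y hy => H y (hy.mono hA)⟩⟩

lemma PLw.subset {Y : Set E} (h : PLw L A B X φ) (hY : Y ⊆ X) : PLw L A B Y φ :=
  ⟨h.arr, h.diff, fun x hx => h.linear x (hY hx)⟩

/-- The linear function that represents `φ` on the cell of a near point `x + t v` gives the value at
`x`, the values infinitely near to `x` in the direction `v`, and the derivative on the whole cell of
`v`. -/
lemma PLw.exists_germ (h : PLw L A B X φ) (hA : A.Finite) (hX : Cellular A X) {x v : E}
    (hv : v ∈ Loc X x) : ∃ ℓ ∈ B, φ x = ℓ x ∧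
      (∀ t, Near A x v t → ∀ y, InCell A (x + t • v) y → φ y = ℓ y) ∧
      ∀ w, InCell {a ∈ A | a x = 0} v w → dir φ x w = ℓ w := by
  obtain ⟨t, ht⟩ := exists_near hA x v
  obtain ⟨ℓ, hℓ, H⟩ := h.linear _ ((hX.near_mem_iff hA ht).2 hv)
  have hx := H x ht.inCell
  refine ⟨ℓ, hℓ, hx, fun s hs y hy => H y ((ht.inCell_same hs).trans hy), fun w hw => dir_eq ?_⟩
  filter_upwards [ev_near hA x w] with s hs
  rw [H _ (ht.inCell_of hs fun a ha hax => hw a ⟨ha, hax⟩), hx]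
  simp

lemma PLw.exists_germ_lin (h : PLw L A B X φ) (hA : A.Finite) (hX : Cellular A X) {x : E}
    (hx : x ∈ X) : ∃ ℓ ∈ B, φ x = ℓ x ∧ ∀ v ∈ Lin A x, dir φ x v = ℓ v := by
  obtain ⟨ℓ, hℓ, h1, -, h2⟩ := h.exists_germ hA hX (zero_mem_loc hx)
  exact ⟨ℓ, hℓ, h1, fun v hv => h2 v fun a ha => by simp [hv a ha.1 ha.2]⟩

lemma PLw.dir_add (h : PLw L A B X φ) (hA : A.Finite) (hX : Cellular A X) {x v w : E}
    (hv : v ∈ Loc X x) (hw : w ∈ Lin A x) : dir φ x (v + w) = dir φ x v + dir φ x w := by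
  obtain ⟨ℓ, -, -, -, H⟩ := h.exists_germ hA hX hv
  rw [H v (InCell.refl _ v), H w fun a ha => by simp [hw a ha.1 ha.2],
    H (v + w) fun a ha => by simp [hw a ha.1 ha.2], map_add]

lemma PLw.dir_smul (h : PLw L A B X φ) (hA : A.Finite) (hX : Cellular A X) {x v : E}
    (hv : v ∈ Loc X x) {s : ℝ} (hs : 0 ≤ s) : dir φ x (s • v) = s * dir φ x v := by
  obtain ⟨ℓ, -, -, -, H⟩ := h.exists_germ hA hX hv
  rw [H v (InCell.refl _ v), H (s • v) fun a ha => ⟨fun h => by simpa using mul_nonneg hs h,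
    fun h => by simpa using mul_nonpos_of_nonneg_of_nonpos hs h⟩, map_smul, smul_eq_mul]

lemma PLw.loc (h : PLw L A B X φ) (hA : A.Finite) (hX : Cellular A X) (x : E) :
    PLw L {a ∈ A | a x = 0} {ℓ ∈ B | φ x = ℓ x} (Loc X x) (dir φ x) := by
  refine ⟨h.arr.mono (Set.sep_subset _ _), fun ℓ hℓ ℓ' hℓ' =>
    ⟨h.diff ℓ hℓ.1 ℓ' hℓ'.1, by simp [← hℓ.2, ← hℓ'.2]⟩, fun v hv => ?_⟩
  obtain ⟨ℓ, hℓ, h1, -, h2⟩ := h.exists_germ hA hX hv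
  exact ⟨ℓ, ⟨hℓ, h1⟩, h2⟩

/-- The graph of `φ` over `X` together with the points above the graph over `D`. -/
def modSet (X : Set E) (φ : E → ℝ) (D : Set E) : Set (E × ℝ) :=
  {p | p.1 ∈ X ∧ p.2 = φ p.1} ∪ {p | p.1 ∈ D ∧ φ p.1 ≤ p.2}

lemma mem_modSet {X D : Set E} {φ : E → ℝ} {x : E} {t : ℝ} :
    (x, t) ∈ modSet X φ D ↔ x ∈ X ∧ t = φ x ∨ x ∈ D ∧ φ x ≤ t := Iff.rfl

/-- The arrangement for a modification. -/
def modArr (A B : Set (E →ₗ[ℝ] ℝ)) : Set (E × ℝ →ₗ[ℝ] ℝ) :=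
  (fun a => a ∘ₗ LinearMap.fst ℝ E ℝ) '' A ∪
    (fun ℓ => LinearMap.snd ℝ E ℝ - ℓ ∘ₗ LinearMap.fst ℝ E ℝ) '' B

lemma Arr.modArr (hA : Arr L A) (hB : Arr L B) :
    Arr (L.prod (AddSubgroup.zmultiples (1 : ℝ))) (modArr A B) := by
  refine (hA.comp_fst _).union ⟨hB.finite.image _, ?_⟩
  rintro _ ⟨ℓ, hℓ, rfl⟩
  refine IntegralOn.sub (fun x hx => ?_) ((hB.integral ℓ hℓ).comp fun x hx => hx.1)
  obtain ⟨k, hk⟩ := AddSubgroup.mem_zmultiples_iff.1 hx.2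
  exact ⟨k, by simpa using hk.symm⟩

lemma inCell_modArr {x y : E} {s t : ℝ} : InCell (modArr A B) (x, s) (y, t) ↔
    InCell A x y ∧ ∀ ℓ ∈ B, (ℓ x ≤ s → ℓ y ≤ t) ∧ (s ≤ ℓ x → t ≤ ℓ y) := by
  simp [InCell, modArr, or_imp, forall_and]
  tauto

lemma mem_lin_modArr {x v : E} {s t : ℝ} : (v, t) ∈ Lin (modArr A B) (x, s) ↔
    v ∈ Lin A x ∧ ∀ ℓ ∈ B, s = ℓ x → t = ℓ v := by
  simp [mem_lin, modArr, or_imp, forall_and, sub_eq_zero]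

variable {D : Set E}

/-- Along a near segment `φ` is its value at `x` plus `t` times its derivative, so the conditions
defining the modification can be divided by `t`. If `x` is not in `D`, only a graph remains. -/
lemma PLw.loc_modSet (h : PLw L A B X φ) (hA : A.Finite) (hX : Cellular A X)
    (hD : Cellular A D) (hDX : D ⊆ X) (x : E) :
    Loc (modSet X φ D) (x, φ x) = modSet (Loc X x) (dir φ x) (Loc D x) := by
  have hLoc : Loc D x ⊆ Loc X x := fun v hv => (mem_loc.1 hv).mono fun t ht => hDX ht
  ext ⟨v, s⟩
  have key : ∀ t, Near A x v t → ((x, φ x) + t • (v, s) ∈ modSet X φ D ↔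
      (v, s) ∈ modSet (Loc X x) (dir φ x) (Loc D x)) := by
    intro t ht
    simp only [Prod.smul_mk, Prod.mk_add_mk, mem_modSet, smul_eq_mul,
      hX.near_mem_iff hA ht, hD.near_mem_iff hA ht]
    by_cases hv : v ∈ Loc X x
    · obtain ⟨ℓ, -, h1, h2, h3⟩ := h.exists_germ hA hX hv
      rw [h2 t ht _ (InCell.refl _ _), h3 v (InCell.refl _ _), h1, map_add, map_smul, smul_eq_mul,
        add_right_inj, mul_right_inj' ht.1.ne', add_le_add_iff_left, mul_le_mul_iff_right₀ ht.1]
    · have hv' : v ∉ Loc D x := fun h => hv (hLoc h)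
      simp [hv, hv']
  rw [mem_loc]
  exact ⟨fun H => let ⟨t, h1, h2⟩ := (H.and (ev_near hA x v)).exists; (key t h2).1 h1,
    fun H => (ev_near hA x v).mono fun t ht => (key t ht).2 H⟩

/-- The strict inequality persists under small steps within `X`, so only membership in `D` is left
to decide. -/
lemma PLw.loc_modSet_above (h : PLw L A B X φ) (hA : A.Finite) (hX : Cellular A X)
    (hDX : D ⊆ X) {x : E} {t₀ : ℝ} (ht₀ : φ x < t₀) :
    Loc (modSet X φ D) (x, t₀) = Loc D x ×ˢ Set.univ := by
  have hev : ∀ v s, v ∈ Loc X x → ∀ᶠ t in 𝓝[>] (0 : ℝ), φ (x + t • v) < t₀ + t * s := by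
    intro v s hv
    obtain ⟨ℓ, -, h1, h2, h3⟩ := h.exists_germ hA hX hv
    filter_upwards [ev_near hA x v, ev_pos_add (sub_pos.2 ht₀) (s - ℓ v)] with t ht ht'
    rw [h2 t ht _ (InCell.refl _ _), map_add, map_smul, smul_eq_mul, ← h1]
    linarith
  ext ⟨v, s⟩
  simp only [Set.mem_prod, Set.mem_univ, and_true]
  constructor
  · intro H
    have hvX : v ∈ Loc X x := (mem_loc.1 H).mono fun t ht => by
      rcases ht with ht | ht
      exacts [by simpa using ht.1, hDX (by simpa using ht.1)]
    refine ((mem_loc.1 H).and (hev v s hvX)).mono fun t ht => ?_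
    rcases ht.1 with h1 | h1
    · have := h1.2; simp at this; linarith [ht.2]
    · simpa using h1.1
  · intro H
    have hvX : v ∈ Loc X x := (mem_loc.1 H).mono fun t ht => hDX ht
    refine ((mem_loc.1 H).and (hev v s hvX)).mono fun t ht => Or.inr ⟨?_, ?_⟩
    · simpa using ht.1
    · simpa using ht.2.le

end Functions
end Trop

namespace Trop

open Filter Topology

/-! ### Balancing of modifications -/

section Modifications

variable {E : Type*} [AddCommGroup E] [Module ℝ E] {L : AddSubgroup E}
  {A B : Set (E →ₗ[ℝ] ℝ)} {X D : Set E} {φ : E → ℝ}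

/-- All functions of `B` that take the value `φ x` at `x` have the same restriction to `Lin A x`,
namely the derivative of `φ`. -/
lemma PLw.mem_lin_graph (h : PLw L A B X φ) (hA : A.Finite) (hX : Cellular A X) {x v : E}
    (hx : x ∈ X) {s : ℝ} :
    (v, s) ∈ Lin (modArr A B) (x, φ x) ↔ v ∈ Lin A x ∧ s = dir φ x v := by
  obtain ⟨ℓ, hℓ, h1, h2⟩ := h.exists_germ_lin hA hX hx
  rw [mem_lin_modArr]
  refine and_congr_right fun hv => ⟨fun H => by rw [H ℓ hℓ h1, h2 v hv], fun H ℓ' hℓ' h' => ?_⟩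
  have := hv _ (h.diff ℓ hℓ ℓ' hℓ') (by simp [← h1, ← h'])
  rw [H, h2 v hv]
  simpa [sub_eq_zero] using this

lemma PLw.finrank_lin_graph (h : PLw L A B X φ) (hA : A.Finite) (hX : Cellular A X) {x : E}
    (hx : x ∈ X) :
    Module.finrank ℝ (Lin (modArr A B) (x, φ x)) = Module.finrank ℝ (Lin A x) := by
  obtain ⟨ℓ, hℓ, h1, h2⟩ := h.exists_germ_lin hA hX hx
  have hinj : Function.Injective (LinearMap.id.prod ℓ) := fun u v huv => (Prod.ext_iff.1 huv).1
  have : Lin (modArr A B) (x, φ x) = (Lin A x).map (LinearMap.id.prod ℓ) := by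
    ext ⟨v, s⟩
    rw [h.mem_lin_graph hA hX hx, Submodule.mem_map]
    constructor
    · rintro ⟨hv, rfl⟩
      exact ⟨v, hv, by simp [h2 v hv]⟩
    · rintro ⟨w, hw, hwv⟩
      obtain ⟨rfl, rfl⟩ := Prod.ext_iff.1 hwv
      exact ⟨hw, (h2 w hw).symm⟩
  rw [this]
  exact (LinearEquiv.finrank_eq (Submodule.equivMapOfInjective _ hinj _)).symm

open Classical in
/-- The normal vectors of a modification. -/
noncomputable def modNormals (φ : E → ℝ) (D : Set E) (x : E) (N : Finset E) : Finset (E × ℝ) :=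
  N.image (fun n => (n, dir φ x n)) ∪ if x ∈ D then {(0, 1)} else ∅

lemma mem_modNormals {x : E} {N : Finset E} {m : E × ℝ} :
    m ∈ modNormals φ D x N ↔ (∃ n ∈ N, (n, dir φ x n) = m) ∨ x ∈ D ∧ m = (0, 1) := by
  unfold modNormals
  split_ifs with h <;> simp [h, or_comm]

open Classical in
lemma sum_modNormals_apply {M : Type*} [AddCommMonoid M] (f : E × ℝ → M) {x : E} {N : Finset E}
    (h0 : (0 : E) ∉ N) : ∑ m ∈ modNormals φ D x N, f m =
      ∑ n ∈ N, f (n, dir φ x n) + if x ∈ D then f (0, 1) else 0 := by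
  unfold modNormals
  rw [Finset.sum_union, Finset.sum_image fun n _ m _ h => (Prod.ext_iff.1 h).1]
  · split_ifs <;> simp
  · rw [Finset.disjoint_left]
    intro m hm hm'
    obtain ⟨n, hn, rfl⟩ := Finset.mem_image.1 hm
    split_ifs at hm'
    · rw [Finset.mem_singleton, Prod.ext_iff] at hm'
      exact h0 ((show n = 0 from hm'.1) ▸ hn)
    · simp at hm'

open Classical in
lemma sum_modNormals {x : E} {N : Finset E} (h0 : (0 : E) ∉ N) :
    ∑ m ∈ modNormals φ D x N, m =
      (∑ n ∈ N, n, ∑ n ∈ N, dir φ x n + if x ∈ D then 1 else 0) := by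
  rw [sum_modNormals_apply (fun m => m) h0]
  split_ifs <;> ext <;> simp [Prod.fst_sum, Prod.snd_sum]

/-- The normal vectors around a wall of the graph are the lifts of those of `X` by the derivative
and, over `D`, the vertical vector. For the latter to sweep out the part above the graph, `D` has to
fill the span of the wall. -/
lemma PLw.normalSystem_modSet (h : PLw L A B X φ) (hA : A.Finite) (hX : Cellular A X)
    (hD : Cellular A D) (hDX : D ⊆ X) {x : E} (hx : x ∈ X) (hDloc : x ∈ D → Loc D x = Lin A x)
    {N : Finset E} (hN : NormalSystem L (Lin A x) (Loc X x) N) :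
    NormalSystem (L.prod (AddSubgroup.zmultiples (1 : ℝ))) (Lin (modArr A B) (x, φ x))
      (Loc (modSet X φ D) (x, φ x)) (modNormals φ D x N) := by
  have hNloc : ∀ n ∈ N, n ∈ Loc X x := fun n hn => (hN.mem_iff n).2 ⟨n, hn, 1, by simp⟩
  have hmem : ∀ v s, (v, s) ∈ Lin (modArr A B) (x, φ x) ↔ v ∈ Lin A x ∧ s = dir φ x v :=
    fun v s => h.mem_lin_graph hA hX hx
  obtain ⟨ℓ, hℓ, -, hlin⟩ := h.exists_germ_lin hA hX hx
  have hdir0 : dir φ x 0 = 0 := by rw [hlin 0 (zero_mem _), map_zero]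
  have hint : ∀ n ∈ N, dir φ x n ∈ AddSubgroup.zmultiples (1 : ℝ) := by
    intro n hn
    obtain ⟨ℓ, hℓ, -, -, H⟩ := h.exists_germ hA hX (hNloc n hn)
    obtain ⟨k, hk⟩ := h.arr.integral ℓ hℓ n (hN.mem_lattice n hn)
    exact AddSubgroup.mem_zmultiples_iff.2 ⟨k, by simp [H n (InCell.refl _ n), hk]⟩
  refine ⟨?_, ?_, ?_, ?_, ?_⟩
  · rintro ⟨v, s⟩
    rw [h.loc_modSet hA hX hD hDX, mem_modSet]
    constructor
    · rintro (⟨hv, rfl⟩ | ⟨hv, hs⟩)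
      · obtain ⟨n, hn, r, hr, hV⟩ := (hN.mem_iff v).1 hv
        refine ⟨_, mem_modNormals.2 (.inl ⟨n, hn, rfl⟩), r, hr, (hmem _ _).2 ⟨hV, ?_⟩⟩
        have h1 := h.dir_add hA hX ((hN.mem_iff (r • n)).2 ⟨n, hn, r, hr, by simp⟩) hV
        rw [add_sub_cancel, h.dir_smul hA hX (hNloc n hn) hr] at h1
        simp [h1]
      · have hxD := hD.mem_of_loc hA hv
        rw [hDloc hxD] at hv
        refine ⟨(0, 1), mem_modNormals.2 (.inr ⟨hxD, rfl⟩), s - dir φ x v, sub_nonneg.2 hs, ?_⟩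
        rw [Prod.smul_mk, Prod.mk_sub_mk, hmem]
        simpa using hv
    · rintro ⟨m, hm, r, hr, hV⟩
      rcases mem_modNormals.1 hm with ⟨n, hn, rfl⟩ | ⟨hxD, rfl⟩
      · rw [Prod.smul_mk, Prod.mk_sub_mk, hmem] at hV
        refine .inl ⟨(hN.mem_iff v).2 ⟨n, hn, r, hr, hV.1⟩, ?_⟩
        have h1 := h.dir_add hA hX ((hN.mem_iff (r • n)).2 ⟨n, hn, r, hr, by simp⟩) hV.1
        rw [add_sub_cancel, h.dir_smul hA hX (hNloc n hn) hr, ← hV.2] at h1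
        rw [h1]; simp
      · rw [Prod.smul_mk, Prod.mk_sub_mk, hmem, smul_zero, sub_zero] at hV
        refine .inr ⟨by rw [hDloc hxD]; exact hV.1, ?_⟩
        rw [← hV.2]; simpa using hr
  · intro m hm
    rcases mem_modNormals.1 hm with ⟨n, hn, rfl⟩ | ⟨hxD, rfl⟩
    · exact ⟨hN.mem_lattice n hn, hint n hn⟩
    · exact ⟨zero_mem _, AddSubgroup.mem_zmultiples _⟩
  · intro m hm hV
    rcases mem_modNormals.1 hm with ⟨n, hn, rfl⟩ | ⟨hxD, rfl⟩
    · exact hN.notMem n hn ((hmem _ _).1 hV).1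
    · have := ((hmem _ _).1 hV).2
      rw [hdir0] at this
      exact one_ne_zero this
  · rintro m hm ⟨l, t⟩ hl s hV
    rcases mem_modNormals.1 hm with ⟨n, hn, rfl⟩ | ⟨hxD, rfl⟩
    · rw [Prod.smul_mk, Prod.mk_sub_mk, hmem] at hV
      exact hN.primitive n hn l hl.1 s hV.1
    · rw [Prod.smul_mk, Prod.mk_sub_mk, hmem, smul_zero, sub_zero] at hV
      obtain ⟨k, hk⟩ := h.arr.integral ℓ hℓ l hl.1
      obtain ⟨j, hj⟩ := AddSubgroup.mem_zmultiples_iff.1 hl.2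
      have h2 := hV.2
      rw [hlin l hV.1, hk] at h2
      simp only [zsmul_eq_mul, mul_one, smul_eq_mul] at hj h2
      exact ⟨j - k, by push_cast; rw [hj, ← h2]; ring⟩
  · intro m hm m' hm' s hs hV
    rcases mem_modNormals.1 hm with ⟨n, hn, rfl⟩ | ⟨hxD, rfl⟩ <;>
      rcases mem_modNormals.1 hm' with ⟨n', hn', rfl⟩ | ⟨-, rfl⟩ <;>
      rw [Prod.smul_mk, Prod.mk_sub_mk, hmem] at hV
    · rw [hN.inj n hn n' hn' s hs hV.1]
    · rw [smul_zero, sub_zero] at hV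
      exact absurd hV.1 (hN.notMem n hn)
    · have h1 : s • n' ∈ Lin A x := by simpa using hV.1
      rcases eq_or_ne s 0 with rfl | hs0
      · have := hV.2
        simp [hdir0] at this
      · exact absurd ((Submodule.smul_mem_iff _ hs0).1 h1) (hN.notMem n' hn')

open Classical in
/-- The sum of the normal vectors of a modification expresses the order of vanishing. -/
lemma PLw.sum_modNormals_mem_iff (h : PLw L A B X φ) (hA : A.Finite) (hX : Cellular A X) {x : E}
    (hx : x ∈ X) {N : Finset E} (hN : NormalSystem L (Lin A x) (Loc X x) N) :
    ∑ m ∈ modNormals φ D x N, m ∈ Lin (modArr A B) (x, φ x) ↔ ∑ n ∈ N, n ∈ Lin A x ∧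
      ∑ n ∈ N, dir φ x n + (if x ∈ D then 1 else 0) = dir φ x (∑ n ∈ N, n) := by
  rw [sum_modNormals fun h0 => hN.notMem 0 h0 (zero_mem _), h.mem_lin_graph hA hX hx]

lemma PLw.cellular_modSet (h : PLw L A B X φ) (hX : Cellular A X)
    (hD : Cellular A D) (hDX : D ⊆ X) : Cellular (modArr A B) (modSet X φ D) := by
  rintro ⟨x, s⟩ hx ⟨y, t⟩ hy
  rw [inCell_modArr] at hy
  have hxX : x ∈ X := hx.elim (fun h => h.1) fun h => hDX h.1
  obtain ⟨ℓ, hℓ, H⟩ := h.linear x hxX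
  have h1 := hy.2 ℓ hℓ
  rw [← H x (InCell.refl _ _), ← H y hy.1] at h1
  rcases hx with ⟨h2, h3⟩ | ⟨h2, h3⟩
  · exact .inl ⟨hX x hxX y hy.1, le_antisymm (h1.2 h3.le) (h1.1 h3.ge)⟩
  · exact .inr ⟨hD x h2 y hy.1, h1.1 h3⟩

open Classical in
/-- A modification along a divisor is balanced. -/
theorem PLw.tropA_modSet (hL : IsLattice L) (h : PLw L A B X φ) {d d' : ℕ} (hX : TropA L d A X)
    (hD : TropA L d' A D) (hDX : D ⊆ X) (hd : D.Nonempty → d' + 1 = d)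
    (hbal : ∀ x ∈ X, Module.finrank ℝ (Lin A x) + 1 = d →
      ∃ N, NormalSystem L (Lin A x) (Loc X x) N ∧ ∑ n ∈ N, n ∈ Lin A x ∧
        ∑ n ∈ N, dir φ x n + (if x ∈ D then 1 else 0) = dir φ x (∑ n ∈ N, n)) :
    TropA (L.prod (AddSubgroup.zmultiples (1 : ℝ))) d (modArr A B) (modSet X φ D) := by
  have := hL.finiteDimensional
  have hfin := hX.arr.finite
  have hArr := hX.arr.modArr h.arr
  have hlt : ∀ x t, φ x < t → x ∈ D → Lin (modArr A B) (x, t) ≤ (Lin A x).prod ⊤ :=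
    fun x t _ _ ⟨v, s⟩ hv => ⟨(mem_lin_modArr.1 hv).1, trivial⟩
  refine ⟨hArr, h.cellular_modSet hX.cellular hD.cellular hDX, ?_, ?_⟩
  · rintro ⟨x, t⟩ (⟨hx, ht⟩ | ⟨hx, ht⟩)
    · obtain rfl : t = φ x := ht
      obtain ⟨y, hy, hyx, hrank⟩ := hX.pure x hx
      refine ⟨(y, φ y), .inl ⟨hy, rfl⟩, inCell_modArr.2 ⟨hyx, fun ℓ hℓ => ?_⟩, ?_⟩
      · obtain ⟨ℓ', hℓ', H⟩ := h.linear y hy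
        have h1 := hyx _ (h.diff ℓ hℓ ℓ' hℓ')
        simp only [LinearMap.sub_apply, sub_nonneg, sub_nonpos] at h1
        rw [H y (InCell.refl _ _), H x hyx]
        exact ⟨h1.2, h1.1⟩
      · rw [h.finrank_lin_graph hfin hX.cellular hy, hrank]
    · obtain ⟨y, hy, hyx, hrank⟩ := hD.pure x hx
      obtain ⟨ℓ', hℓ', H⟩ := h.linear y (hDX hy)
      -- The direction `(y, s + 1)` lies strictly above the graphs of all functions of `B`, so after
      -- a small step no functional `snd - ℓ ∘ fst` vanishes and the span becomes vertical.
      obtain ⟨s, hs⟩ := (h.arr.finite.image fun ℓ => ℓ y).bddAbove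
      obtain ⟨r, hr⟩ := exists_near hArr.finite (x, t) (y, s + 1)
      have hrA : Near A x y r := ⟨hr.1, fun a ha => by
        simpa using hr.2 _ (.inl ⟨a, ha, rfl⟩)⟩
      have hsame := hyx.near_same hrA
      refine ⟨(x, t) + r • (y, s + 1), .inr ⟨?_, ?_⟩, hr.inCell, ?_⟩
      · simpa using hD.cellular y hy _ hsame.1
      · have h1 := H _ hsame.1
        have h2 : ℓ' y ≤ s := hs ⟨ℓ', hℓ', rfl⟩
        have h3 := H x hyx
        simp only [Prod.smul_mk, Prod.mk_add_mk, smul_eq_mul]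
        rw [h1, map_add, map_smul, smul_eq_mul, ← h3]
        have := mul_le_mul_of_nonneg_left h2 hr.1.le
        dsimp only at ht
        nlinarith [hr.1]
      · have : Lin (modArr A B) ((x, t) + r • (y, s + 1)) = (Lin A y).prod ⊤ := by
          ext ⟨v, u⟩
          rw [Prod.smul_mk, Prod.mk_add_mk, mem_lin_modArr, lin_congr hsame.1 hsame.2]
          simp only [Submodule.mem_prod, Submodule.mem_top, and_true, and_iff_left_iff_imp]
          intro _ ℓ hℓ h0
          have h1 := (hr.eq_zero_iff (a := LinearMap.snd ℝ E ℝ - ℓ ∘ₗ LinearMap.fst ℝ E ℝ)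
            (.inr ⟨ℓ, hℓ, rfl⟩)).1 (by simpa [sub_eq_zero] using h0)
          have h2 : ℓ y ≤ s := hs ⟨ℓ, hℓ, rfl⟩
          have h3 := h1.2
          simp [sub_eq_zero] at h3
          linarith
        rw [this, finrank_submodule_prod, finrank_top, hrank, Module.finrank_self,
          hd ⟨x, hx⟩]
  · rintro ⟨x, t⟩ hx hrank
    -- On the graph, balancing is the assumption on orders. Above it the local cone is `Loc D x`
    -- times a line, balanced because `D` is; if the wall comes only from the graph of some function
    -- of `B`, this local cone is a vector space.
    by_cases hgraph : x ∈ X ∧ t = φ x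
    · obtain ⟨hxX, rfl⟩ := hgraph
      rw [h.finrank_lin_graph hfin hX.cellular hxX] at hrank
      obtain ⟨N, hN, hsum, heq⟩ := hbal x hxX hrank
      refine ⟨_, h.normalSystem_modSet hfin hX.cellular hD.cellular hDX hxX (fun hxD => ?_) hN,
        (h.sum_modNormals_mem_iff hfin hX.cellular hxX hN).2 ⟨hsum, heq⟩⟩
      refine hD.loc_eq_lin hxD ?_
      have := hd ⟨x, hxD⟩
      omega
    · have hxD : x ∈ D ∧ φ x < t := by
        rcases hx with hx | hx
        · exact absurd hx hgraph
        · exact ⟨hx.1, lt_of_le_of_ne hx.2 fun h => hgraph ⟨hDX hx.1, h.symm⟩⟩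
      have hle := hlt x t hxD.2 hxD.1
      have hloc := h.loc_modSet_above hfin hX.cellular hDX hxD.2
      have h1 := Submodule.finrank_mono hle
      rw [finrank_submodule_prod, finrank_top, Module.finrank_self] at h1
      have h2 := hD.finrank_le hxD.1
      have h3 := hd ⟨x, hxD.1⟩
      rcases (show Module.finrank ℝ (Lin A x) + 1 = d' ∨ Module.finrank ℝ (Lin A x) = d' by omega)
        with h4 | h4
      · obtain ⟨N, hN, hsum⟩ := hD.balanced x hxD.1 h4
        have h5 : Lin (modArr A B) (x, t) = (Lin A x).prod ⊤ := by
          refine Submodule.eq_of_le_of_finrank_le hle ?_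
          rw [finrank_submodule_prod, finrank_top, Module.finrank_self]
          omega
        refine ⟨_, by rw [h5, hloc]; exact hN.prod_univ _, ?_⟩
        rw [h5, sum_image_inl]
        exact ⟨hsum, trivial⟩
      · have hrat : IsRational (L.prod (AddSubgroup.zmultiples (1 : ℝ)))
            ((Lin A x).prod (⊤ : Submodule ℝ ℝ)) := by
          rw [← lin_comp_fst A x (0 : ℝ)]
          exact (hL.prod isLattice_int).isRational_lin (hX.arr.comp_fst _) _
        obtain ⟨n, hne, -, hn⟩ := exists_balanced_of_loc_eq (hL.prod isLattice_int) hArr hrat hle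
          (by rw [finrank_submodule_prod, finrank_top, Module.finrank_self]; omega)
        refine ⟨{n, -n}, ?_, ?_⟩
        · rw [hloc, hD.loc_eq_lin hxD.1 h4]
          exact hn
        · rw [Finset.sum_pair hne, add_neg_cancel]
          exact zero_mem _

open Classical in
/-- If a modification is balanced, then the order of vanishing along the divisor is one, and it is
zero elsewhere. -/
theorem PLw.sum_dir_eq (hL : IsLattice L) (h : PLw L A B X φ) {d d' : ℕ} (hX : TropA L d A X)
    (hD : TropA L d' A D) (hDX : D ⊆ X) (hd : D.Nonempty → d' + 1 = d)
    (hM : TropSet (L.prod (AddSubgroup.zmultiples (1 : ℝ))) d (modSet X φ D)) {x : E} (hx : x ∈ X)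
    (hrank : Module.finrank ℝ (Lin A x) + 1 = d) {N : Finset E}
    (hN : NormalSystem L (Lin A x) (Loc X x) N) :
    ∑ n ∈ N, dir φ x n + (if x ∈ D then 1 else 0) = dir φ x (∑ n ∈ N, n) := by
  have := hL.finiteDimensional
  have hfin := hX.arr.finite
  have hM' := hM.of_cellular (hL.prod isLattice_int) (hX.arr.modArr h.arr)
    (h.cellular_modSet hX.cellular hD.cellular hDX)
  obtain ⟨N', hN', hsum⟩ := hM'.balanced (x, φ x) (.inl ⟨hx, rfl⟩)
    (by rw [h.finrank_lin_graph hfin hX.cellular hx, hrank])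
  have hN'' := h.normalSystem_modSet hfin hX.cellular hD.cellular hDX hx (fun hxD => by
    refine hD.loc_eq_lin hxD ?_
    have := hd ⟨x, hxD⟩
    omega) hN
  exact ((h.sum_modNormals_mem_iff hfin hX.cellular hx hN).1 (hN'.sum_mem hN'' hsum)).2

end Modifications
end Trop

namespace Trop

open Filter Topology

/-! ### Rational cones as cells; faces and normal vectors -/

section Cones

variable {E : Type*} [AddCommGroup E] [Module ℝ E] {L : AddSubgroup E}

/-- Each functional has constant sign on `s`, so sums cannot cancel: add one witness for each
functional that is not identically zero on `s`. Staying in the additive monoid makes the point a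
lattice point if `s` consists of lattice points. -/
lemma exists_interior {A : Set (E →ₗ[ℝ] ℝ)} (hA : A.Finite) {s : Set E}
    (hs : ∀ a ∈ A, (∀ z ∈ s, 0 ≤ a z) ∨ ∀ z ∈ s, a z ≤ 0) :
    ∃ y ∈ AddSubmonoid.closure s, ∀ a ∈ A, a y = 0 → ∀ z ∈ s, a z = 0 := by
  have hcl : ∀ a ∈ A, (∀ z ∈ AddSubmonoid.closure s, 0 ≤ a z) ∨
      ∀ z ∈ AddSubmonoid.closure s, a z ≤ 0 := fun a ha => by
    refine (hs a ha).imp (fun h z hz => ?_) fun h z hz => ?_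
    · induction hz using AddSubmonoid.closure_induction with
      | mem x hx => exact h x hx
      | zero => simp
      | add x y _ _ h1 h2 => rw [map_add]; exact add_nonneg h1 h2
    · induction hz using AddSubmonoid.closure_induction with
      | mem x hx => exact h x hx
      | zero => simp
      | add x y _ _ h1 h2 => rw [map_add]; exact add_nonpos h1 h2
  induction A, hA using Set.Finite.induction_on with
  | empty => exact ⟨0, zero_mem _, by simp⟩
  | @insert b B _ _ ih =>
    obtain ⟨y, hy, hgen⟩ := ih (fun a ha => hs a (.inr ha)) fun a ha => hcl a (.inr ha)
    by_cases hb : ∀ z ∈ s, b z = 0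
    · exact ⟨y, hy, fun a ha h0 => ha.elim (fun h => by rwa [h]) fun h => hgen a h h0⟩
    · push Not at hb
      obtain ⟨z, hz, hbz⟩ := hb
      have hz' := AddSubmonoid.subset_closure hz
      have key : ∀ a ∈ insert b B, a (y + z) = 0 → a y = 0 ∧ a z = 0 := fun a ha h0 => by
        rw [map_add] at h0
        rcases hcl a ha with h | h
        · exact ⟨by linarith [h y hy, h z hz'], by linarith [h y hy, h z hz']⟩
        · exact ⟨by linarith [h y hy, h z hz'], by linarith [h y hy, h z hz']⟩
      refine ⟨y + z, add_mem hy hz', fun a ha h0 => ?_⟩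
      have := key a ha h0
      rcases ha with rfl | ha
      exacts [absurd this.2 hbz, hgen a ha this.1]

/-- Describe the cone by integral inequalities. It is the cell of a point at which as few of them as
possible are equalities. -/
lemma IsRationalCone.exists_cell (hL : IsLattice L) {σ : PointedCone ℝ E}
    (hσ : IsRationalCone L σ) : ∃ A, Arr L A ∧ ∃ y, σ = cell A y := by
  obtain ⟨s, hs, hsL, rfl⟩ := hσ.generated
  obtain ⟨A, hA, H⟩ := hL.exists_inequalities hs hsL
  obtain ⟨y, hy, hgen⟩ := exists_interior (s := (PointedCone.hull ℝ s : Set E)) hA.finite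
    fun a ha => .inl fun z hz => (H z).1 hz a ha
  have hy' : y ∈ PointedCone.hull ℝ s :=
    (AddSubmonoid.closure_le (S := (PointedCone.hull ℝ s).toAddSubmonoid)).2 subset_rfl hy
  refine ⟨A, hA, y, ?_⟩
  ext z
  rw [mem_cell]
  refine ⟨fun hz a ha => ⟨fun _ => (H z).1 hz a ha, fun h => ?_⟩, fun h => (H z).2 fun a ha =>
    (h a ha).1 ((H y).1 hy' a ha)⟩
  exact (hgen a ha (le_antisymm h ((H y).1 hy' a ha)) z hz).le

lemma isFaceOf_cell {A : Set (E →ₗ[ℝ] ℝ)} {x y : E} (h : InCell A x y) :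
    (cell A y).IsFaceOf (cell A x) := by
  refine .of_mem_of_add_mem_left (fun z hz => h.trans hz) fun {u v} hu hv huv a ha => ?_
  have h1 := hu a ha
  have h2 := hv a ha
  have h3 := huv a ha
  have h4 := h a ha
  rw [map_add] at h3
  rcases le_total 0 (a x) with h0 | h0
  · exact ⟨fun _ => h1.1 h0, fun h5 => by linarith [h3.2 h5, h2.1 h0]⟩
  · exact ⟨fun h5 => by linarith [h3.1 h5, h2.2 h0], fun _ => h1.2 h0⟩

/-- A face is the cell of any of its interior points: it contains that cell because an interior
point can be prolonged slightly beyond itself. -/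
lemma isFaceOf_cell_iff {A : Set (E →ₗ[ℝ] ℝ)} (hA : A.Finite) {x : E} {τ : PointedCone ℝ E} :
    τ.IsFaceOf (cell A x) ↔ ∃ y, InCell A x y ∧ τ = cell A y := by
  refine ⟨fun h => ?_, fun ⟨y, hy, h⟩ => h ▸ isFaceOf_cell hy⟩
  obtain ⟨y, hy, hgen⟩ := exists_interior (s := (τ : Set E)) hA fun a ha =>
    (le_total 0 (a x)).imp (fun h0 z hz => (h.le hz a ha).1 h0)
      fun h0 z hz => (h.le hz a ha).2 h0
  replace hy : y ∈ τ := (AddSubmonoid.closure_le (S := τ.toAddSubmonoid)).2 subset_rfl hy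
  have hxy := h.le hy
  refine ⟨y, hxy, le_antisymm (fun z hz a ha => ?_) fun z hz => ?_⟩
  · have h1 := hgen a ha
    have h2 := hxy a ha
    have h3 := h.le hz a ha
    rcases le_total 0 (a x) with h0 | h0
    · exact ⟨fun _ => h3.1 h0, fun h5 => (h1 (le_antisymm h5 (h2.1 h0)) z hz).le⟩
    · exact ⟨fun h5 => (h1 (le_antisymm (h2.2 h0) h5) z hz).ge, fun _ => h3.2 h0⟩
  · obtain ⟨t, ht⟩ := exists_near hA y (-z)
    have h1 : InCell A y (y + t • -z) := ht.inCell_lin (neg_mem (InCell.mem_lin hz))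
    refine h.mem_of_smul_add_mem (a := t) (hxy.trans hz) (hxy.trans h1) ht.1 ?_
    simpa using hy

lemma inRelInterior_cell_iff {A : Set (E →ₗ[ℝ] ℝ)} (hA : A.Finite) {x z : E} :
    InRelInterior (cell A x) z ↔ InCell A x z ∧ InCell A z x := by
  constructor
  · rintro ⟨h1, h2⟩
    exact ⟨h1, (cell_eq_iff.1 (h2 _ (isFaceOf_cell h1) (InCell.refl A z))).1⟩
  · refine fun ⟨h1, h2⟩ => ⟨h1, fun ρ hρ hz => ?_⟩
    obtain ⟨w, hw, rfl⟩ := (isFaceOf_cell_iff hA).1 hρ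
    exact cell_eq_iff.2 ⟨InCell.trans hz h2, hw⟩

lemma coneSpan_cell {A : Set (E →ₗ[ℝ] ℝ)} (hA : A.Finite) (x : E) : coneSpan (cell A x) = Lin A x :=
  span_cell hA x

lemma coneDim_cell {A : Set (E →ₗ[ℝ] ℝ)} (hA : A.Finite) (x : E) :
    coneDim (cell A x) = Module.finrank ℝ (Lin A x) := by rw [coneDim, coneSpan_cell hA]

lemma InCell.symm_of_lin_eq {A : Set (E →ₗ[ℝ] ℝ)} {x y : E} (h : InCell A x y)
    (hlin : Lin A y = Lin A x) : InCell A y x := fun a ha => by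
  have h0 : a y = 0 → a x = 0 := fun h0 => by
    have : x ∈ Lin A y := hlin ▸ self_mem_lin A x
    exact this a ha h0
  have h1 := h a ha
  exact ⟨fun h2 => by by_contra! h3; exact h3.ne (h0 (le_antisymm (h1.2 h3.le) h2)),
    fun h2 => by by_contra! h3; exact h3.ne' (h0 (le_antisymm h2 (h1.1 h3.le)))⟩

variable {σ τ : PointedCone ℝ E} {x y v : E}

lemma InRelInterior.add (h : InRelInterior σ x) (hy : y ∈ σ) : InRelInterior σ (x + y) :=
  ⟨add_mem h.1 hy, fun ρ hρ hxy => h.2 ρ hρ (hρ.mem_of_add_mem_left h.1 hy hxy)⟩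

lemma InRelInterior.smul (h : InRelInterior σ x) {t : ℝ} (ht : 0 < t) : InRelInterior σ (t • x) :=
  ⟨σ.smul_mem ht.le h.1, fun ρ hρ hxy => h.2 ρ hρ <| by
    have := ρ.smul_mem (inv_nonneg.2 ht.le) hxy
    rwa [smul_smul, inv_mul_cancel₀ ht.ne', one_smul] at this⟩

lemma mem_coneSpan (h : x ∈ σ) : x ∈ coneSpan σ := Submodule.subset_span h

lemma IsRationalCone.exists_relInterior (hL : IsLattice L) (hσ : IsRationalCone L σ) :
    ∃ x, InRelInterior σ x := by
  obtain ⟨A, hA, y, rfl⟩ := hσ.exists_cell hL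
  exact ⟨y, (inRelInterior_cell_iff hA.finite).2 ⟨InCell.refl A y, InCell.refl A y⟩⟩

lemma IsRationalCone.exists_relInterior_lattice (hL : IsLattice L) (hσ : IsRationalCone L σ) :
    ∃ x ∈ L, InRelInterior σ x := by
  obtain ⟨s, hs, hsL, h⟩ := hσ.generated
  obtain ⟨A, hA, y, rfl⟩ := hσ.exists_cell hL
  have hsub : s ⊆ cell A y := by rw [h]; exact PointedCone.subset_hull
  obtain ⟨p, hp, hgen⟩ := exists_interior (s := s) hA.finite fun a ha =>
    (le_total 0 (a y)).imp (fun h0 z hz => (hsub hz a ha).1 h0)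
      fun h0 z hz => (hsub hz a ha).2 h0
  have hpL : p ∈ L := (AddSubmonoid.closure_le (S := L.toAddSubmonoid)).2 hsL hp
  have hpy : p ∈ cell A y :=
    (AddSubmonoid.closure_le (S := (cell A y).toAddSubmonoid)).2 hsub hp
  refine ⟨p, hpL, (inRelInterior_cell_iff hA.finite).2 ⟨hpy, InCell.symm_of_lin_eq hpy
    (le_antisymm (InCell.lin_le hpy) ?_)⟩⟩
  rw [← span_cell hA.finite y, h, span_hull, Submodule.span_le]
  exact fun z hz a ha h0 => hgen a ha h0 z hz

lemma IsRationalCone.ev_mem (hL : IsLattice L) (hσ : IsRationalCone L σ) (hx : InRelInterior σ x)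
    (hv : v ∈ coneSpan σ) : ∀ᶠ t in 𝓝[>] (0 : ℝ), x + t • v ∈ σ := by
  obtain ⟨A, hA, y, rfl⟩ := hσ.exists_cell hL
  rw [inRelInterior_cell_iff hA.finite] at hx
  rw [coneSpan_cell hA.finite, lin_congr hx.1 hx.2] at hv
  exact (ev_near hA.finite x v).mono fun t ht => hx.1.trans (ht.inCell_lin hv)

lemma IsRationalCone.isRational (hσ : IsRationalCone L σ) : IsRational L (coneSpan σ) := by
  obtain ⟨s, hs, hsL, rfl⟩ := hσ.generated
  rw [coneSpan, span_hull]
  exact isRational_span hsL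

lemma IsRationalCone.eq_of_isFaceOf (hL : IsLattice L) (hσ : IsRationalCone L σ)
    (h : τ.IsFaceOf σ) (hd : coneDim τ = coneDim σ) : τ = σ := by
  have := hL.finiteDimensional
  obtain ⟨A, hA, y, rfl⟩ := hσ.exists_cell hL
  obtain ⟨z, hz, rfl⟩ := (isFaceOf_cell_iff hA.finite).1 h
  rw [coneDim_cell hA.finite, coneDim_cell hA.finite] at hd
  exact cell_eq_iff.2 ⟨hz.symm_of_lin_eq (Submodule.eq_of_le_of_finrank_eq hz.lin_le hd), hz⟩

/-- A facet of a rational cone is cut out by an integral functional that is nonnegative on the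
cone. -/
lemma IsRationalCone.exists_facet_functional (hL : IsLattice L) (hσ : IsRationalCone L σ)
    (hτ : τ.IsFaceOf σ) (hdim : coneDim τ + 1 = coneDim σ) :
    ∃ a : E →ₗ[ℝ] ℝ, IntegralOn L a ∧ (∀ v ∈ σ, 0 ≤ a v) ∧ (∃ w ∈ coneSpan σ, a w ≠ 0) ∧
      ∀ v ∈ coneSpan σ, a v = 0 ↔ v ∈ coneSpan τ := by
  have := hL.finiteDimensional
  obtain ⟨A, hA, y, rfl⟩ := hσ.exists_cell hL
  obtain ⟨x, hyx, rfl⟩ := (isFaceOf_cell_iff hA.finite).1 hτ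
  simp only [coneDim_cell hA.finite] at hdim
  simp only [coneSpan_cell hA.finite]
  have hne : ¬ Lin A y ≤ Lin A x := fun h => by
    have := Submodule.finrank_mono h; omega
  obtain ⟨w, hw, hwB⟩ := SetLike.not_le_iff_exists.1 hne
  simp only [mem_lin, not_forall] at hwB
  obtain ⟨b, hb, hbx, hbw⟩ := hwB
  have h1 : Lin A x ≤ Lin A y ⊓ LinearMap.ker b := le_inf hyx.lin_le fun v hv => hv b hb hbx
  have h2 : Lin A y ⊓ LinearMap.ker b < Lin A y :=
    lt_of_le_of_ne inf_le_left fun h => hbw (by rw [← h] at hw; exact hw.2)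
  have h3 : Lin A x = Lin A y ⊓ LinearMap.ker b :=
    Submodule.eq_of_le_of_finrank_le h1 (by have := Submodule.finrank_lt_finrank_of_lt h2; omega)
  have h4 : ∀ v ∈ Lin A y, b v = 0 ↔ v ∈ Lin A x := fun v hv => by
    rw [h3]; exact ⟨fun h => ⟨hv, h⟩, fun h => h.2⟩
  rcases le_total 0 (b y) with h0 | h0
  · exact ⟨b, hA.integral b hb, fun v hv => (hv b hb).1 h0, ⟨w, hw, hbw⟩, h4⟩
  · exact ⟨-b, (hA.integral b hb).neg, fun v hv => neg_nonneg.2 ((hv b hb).2 h0),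
      ⟨w, hw, neg_ne_zero.2 hbw⟩, fun v hv => by rw [← h4 v hv]; simp⟩

/-- A lattice point `n` with minimal positive value of the facet functional has the right class but
may lie outside `σ`. Adding a large multiple of an interior lattice point `p` of `τ` moves it into
the interior of `σ` without changing the class. -/
lemma exists_isNormalVector (hL : IsLattice L) (hσ : IsRationalCone L σ) (hτr : IsRationalCone L τ)
    (hτ : τ.IsFaceOf σ) (hdim : coneDim τ + 1 = coneDim σ) : ∃ v, IsNormalVector L σ τ v := by
  obtain ⟨a, ha, hpos, hne, hker⟩ := hσ.exists_facet_functional hL hτ hdim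
  obtain ⟨n, hn, hnσ, han, hgen⟩ := hσ.isRational.exists_generator ha hne
  obtain ⟨p, hp, hpτ⟩ := hτr.exists_relInterior_lattice hL
  have hspan : coneSpan τ ≤ coneSpan σ := Submodule.span_mono hτ.le
  obtain ⟨y, hy⟩ := hσ.exists_relInterior hL
  have hay : 0 < a y := by
    refine (hpos y hy.1).lt_of_ne fun h0 => ?_
    obtain ⟨w, hw, haw⟩ := hne
    obtain ⟨t, ht, ht0⟩ := ((hσ.ev_mem hL hy (neg_mem (Submodule.smul_mem _ (a w) hw))).and
      ev_pos).exists
    have := hpos _ ht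
    rw [map_add, ← h0, map_smul, map_neg, map_smul, smul_eq_mul, smul_eq_mul, zero_add] at this
    have := mul_self_pos.2 haw
    nlinarith
  set r := a n / a y with hr
  have hr0 : 0 < r := div_pos han hay
  have hw : n - r • y ∈ coneSpan τ := by
    rw [← hker _ (sub_mem hnσ (Submodule.smul_mem _ _ (mem_coneSpan hy.1)))]
    simp [hr, hay.ne']
  -- For large `k` the point `p + k⁻¹ (n - r y)` lies in `τ`, and `n + k p` is `r y`, an interior
  -- point of `σ`, plus `k` times that point.
  have htend : Tendsto (fun k : ℕ => (k : ℝ)⁻¹) atTop (𝓝[>] 0) :=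
    tendsto_inv_atTop_nhdsGT_zero.comp tendsto_natCast_atTop_atTop
  obtain ⟨k, hk, hk0⟩ := ((htend.eventually (hτr.ev_mem hL hpτ hw)).and
    (eventually_gt_atTop 0)).exists
  have hk0' : (0 : ℝ) < k := by exact_mod_cast hk0
  have hv : n + k • p = r • y + (k : ℝ) • (p + (k : ℝ)⁻¹ • (n - r • y)) := by
    rw [smul_add, smul_smul, mul_inv_cancel₀ hk0'.ne', one_smul, Nat.cast_smul_eq_nsmul]
    abel
  have hp' : p ∈ coneSpan τ := mem_coneSpan hpτ.1
  refine ⟨n + k • p, add_mem hn (nsmul_mem hp k), ?_, le_antisymm ?_ (sup_le ?_ ?_)⟩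
  · rw [hv]
    exact (hy.smul hr0).add (hτ.le (τ.smul_mem hk0'.le hk))
  · rintro m ⟨hmL, hm⟩
    obtain ⟨j, hj⟩ := hgen m hmL hm
    rw [AddSubgroup.mem_sup]
    refine ⟨m - j • (n + k • p), ⟨L.sub_mem hmL (L.zsmul_mem (L.add_mem hn (L.nsmul_mem hp k)) j), ?_⟩,
      j • (n + k • p), AddSubgroup.mem_zmultiples_iff.2 ⟨j, rfl⟩, by abel⟩
    have h1 : m - (j : ℝ) • n ∈ coneSpan τ := by
      rw [← hker _ (sub_mem hm (Submodule.smul_mem _ _ hnσ))]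
      simp [hj]
    have h2 := sub_mem h1 (Submodule.smul_mem _ ((j : ℝ) * k) hp')
    have h3 : m - j • (n + k • p) = m - (j : ℝ) • n - ((j : ℝ) * k) • p := by
      rw [smul_add, mul_smul, Int.cast_smul_eq_zsmul, Int.cast_smul_eq_zsmul,
        Nat.cast_smul_eq_nsmul]
      abel
    rw [h3]; exact h2
  · exact fun m hm => ⟨hm.1, hspan hm.2⟩
  · rw [AddSubgroup.zmultiples_le]
    exact ⟨add_mem hn (nsmul_mem hp k),
      (coneSpan σ).add_mem hnσ ((coneSpan σ).nsmul_mem (hspan hp') k)⟩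

lemma normalVector_spec (hL : IsLattice L) (hσ : IsRationalCone L σ) (hτr : IsRationalCone L τ)
    (hτ : τ.IsFaceOf σ) (hdim : coneDim τ + 1 = coneDim σ) :
    IsNormalVector L σ τ (normalVector L σ τ) := by
  have h := exists_isNormalVector hL hσ hτr hτ hdim
  rw [normalVector, dif_pos h]
  exact h.choose_spec

end Cones

namespace WeightedFan

/-! ### Fans and their supports; the fan of cells of an arrangement -/

section Fans

variable {E : Type*} [AddCommGroup E] [Module ℝ E] {L : AddSubgroup E} {S S' : WeightedFan L}
  {σ σ' τ : PointedCone ℝ E} {x : E}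

/-- Every cone of the fan is a face of a top-dimensional cone. -/
def IsPure (S : WeightedFan L) : Prop := ∀ σ ∈ S.cones, ∃ σ' ∈ S.topCones, σ.IsFaceOf σ'

/-- The intersection of the two cones is a face of `σ` that contains an interior point, so it is all
of `σ`. -/
lemma IsFan.isFaceOf_of_relInterior (hS : S.IsFan) (hσ : σ ∈ S.cones) (hσ' : σ' ∈ S.cones)
    (hx : InRelInterior σ x) (hx' : x ∈ σ') : σ.IsFaceOf σ' := by
  have h1 := hx.2 _ (hS.inter_face σ hσ σ' hσ') ⟨hx.1, hx'⟩
  have h2 := hS.inter_face σ' hσ' σ hσ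
  rwa [inf_comm, h1] at h2

lemma IsFan.isFaceOf_of_le (hS : S.IsFan) (hσ : σ ∈ S.cones) (hσ' : σ' ∈ S.cones)
    (h : σ ≤ σ') : σ.IsFaceOf σ' := by
  have h2 := hS.inter_face σ' hσ' σ hσ
  rwa [inf_eq_right.2 h] at h2

lemma IsFan.eq_of_isFaceOf (hL : IsLattice L) (hS : S.IsFan) (hσ : σ ∈ S.topCones)
    (hσ' : σ' ∈ S.topCones) (h : σ.IsFaceOf σ') : σ = σ' :=
  (hS.rational σ' hσ'.1).eq_of_isFaceOf hL h (hσ.2.trans hσ'.2.symm)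

lemma IsFan.exists_carrier (hL : IsLattice L) (hS : S.IsFan) (hx : x ∈ S.support) :
    ∃ σ ∈ S.cones, InRelInterior σ x := by
  obtain ⟨σ, hσ, hxσ⟩ := hx
  obtain ⟨A, hA, y, rfl⟩ := (hS.rational σ hσ).exists_cell hL
  exact ⟨_, hS.face_mem _ hσ _ (isFaceOf_cell hxσ),
    (inRelInterior_cell_iff hA.finite).2 ⟨InCell.refl A x, InCell.refl A x⟩⟩

/-- The cones of `S` are cells of subarrangements of `A`. -/
def Adapted (A : Set (E →ₗ[ℝ] ℝ)) (S : WeightedFan L) : Prop :=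
  ∀ σ ∈ S.cones, ∃ A' ⊆ A, ∃ y, σ = cell A' y

lemma IsFan.exists_adapted (hL : IsLattice L) (hS : S.IsFan) : ∃ A, Arr L A ∧ Adapted A S := by
  choose! A hA y hy using fun σ hσ => (hS.rational σ hσ).exists_cell hL
  refine ⟨⋃ σ ∈ S.cones, A σ, ⟨hS.finite.biUnion fun σ hσ => (hA σ hσ).finite, ?_⟩, ?_⟩
  · simp only [Set.mem_iUnion]
    rintro a ⟨σ, hσ, ha⟩
    exact (hA σ hσ).integral a ha
  · exact fun σ hσ => ⟨A σ, Set.subset_biUnion_of_mem hσ, y σ, hy σ hσ⟩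

variable {A : Set (E →ₗ[ℝ] ℝ)}

lemma Adapted.mono {A' : Set (E →ₗ[ℝ] ℝ)} (h : Adapted A S) (hA : A ⊆ A') : Adapted A' S :=
  fun σ hσ => let ⟨B, hB, H⟩ := h σ hσ; ⟨B, hB.trans hA, H⟩

lemma Adapted.cellular_cone (h : Adapted A S) (hσ : σ ∈ S.cones) : Cellular A (σ : Set E) := by
  obtain ⟨B, hB, y, rfl⟩ := h σ hσ
  exact fun x hx z hz => InCell.trans hx (hz.mono hB)

lemma Adapted.cellular (h : Adapted A S) : Cellular A S.support :=
  fun x ⟨σ, hσ, hx⟩ z hz => ⟨σ, hσ, h.cellular_cone hσ x hx z hz⟩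

lemma Adapted.exists_generic (h : Adapted A S) (hA : A.Finite) (hσ : σ ∈ S.cones) :
    ∃ x, InRelInterior σ x ∧ Lin A x = coneSpan σ := by
  obtain ⟨B, hB, y, rfl⟩ := h σ hσ
  obtain ⟨z, hyz, hzy, hlin⟩ := exists_generic_in_cell hA hB y
  exact ⟨z, (inRelInterior_cell_iff (hA.subset hB)).2 ⟨hyz, hzy.mono hB⟩,
    by rw [hlin, coneSpan_cell (hA.subset hB)]⟩

lemma Adapted.lin_le (h : Adapted A S) (hA : A.Finite) (hσ : σ ∈ S.cones) (hx : x ∈ σ) :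
    Lin A x ≤ coneSpan σ := by
  obtain ⟨B, hB, y, rfl⟩ := h σ hσ
  rw [coneSpan_cell (hA.subset hB)]
  exact (lin_mono hB x).trans (InCell.lin_le hx)

/-- A near point in the direction `v` lies in some cone. Cells being closed, this cone contains `x`
too, hence has `τ` as a face, and it can be enlarged to a top-dimensional one. -/
lemma IsFan.exists_topCone_of_loc (hL : IsLattice L) (hS : S.IsFan) (hpure : S.IsPure)
    (hτ : τ ∈ S.cones) (hx : InRelInterior τ x) {v : E} (hv : v ∈ Loc S.support x) :
    ∃ σ ∈ S.topConesAbove τ, ∃ t : ℝ, 0 < t ∧ x + t • v ∈ σ := by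
  obtain ⟨A, hA, hAS⟩ := hS.exists_adapted hL
  obtain ⟨t, ⟨σ₀, hσ₀, hm⟩, ht⟩ := ((mem_loc.1 hv).and (ev_near hA.finite x v)).exists
  have hx₀ : x ∈ σ₀ := hAS.cellular_cone hσ₀ _ hm _ ht.inCell
  obtain ⟨σ, hσ, hface⟩ := hpure σ₀ hσ₀
  exact ⟨σ, ⟨hσ, hS.isFaceOf_of_relInterior hτ hσ.1 hx (hface.le hx₀)⟩, t, ht.1, hface.le hm⟩

lemma IsFan.loc_eq_coneSpan (hL : IsLattice L) (hS : S.IsFan) (hpure : S.IsPure)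
    (hσ : σ ∈ S.topCones) (hx : InRelInterior σ x) : Loc S.support x = coneSpan σ := by
  refine subset_antisymm (fun v hv => ?_) fun v hv => ?_
  · obtain ⟨σ', hσ', t, ht, hm⟩ := hS.exists_topCone_of_loc hL hpure hσ.1 hx hv
    obtain rfl := hS.eq_of_isFaceOf hL hσ hσ'.1 hσ'.2
    have := sub_mem (mem_coneSpan hm) (mem_coneSpan hx.1)
    rw [add_sub_cancel_left] at this
    exact (Submodule.smul_mem_iff _ ht.ne').1 this
  · exact ((hS.rational σ hσ.1).ev_mem hL hx hv).mono fun t ht => ⟨σ, hσ.1, ht⟩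

/-- The normal vectors of the top-dimensional cones around a wall. -/
lemma IsFan.normalSystem (hL : IsLattice L) (hS : S.IsFan) (hpure : S.IsPure) (hτ : τ ∈ S.walls)
    (hx : InRelInterior τ x) {N : Finset E}
    (hN : ∀ n, n ∈ N ↔ ∃ σ ∈ S.topConesAbove τ, normalVector L σ τ = n) :
    NormalSystem L (coneSpan τ) (Loc S.support x) N ∧
      Set.InjOn (fun σ => normalVector L σ τ) (S.topConesAbove τ) := by
  have hdim : ∀ σ ∈ S.topConesAbove τ, coneDim τ + 1 = coneDim σ := fun σ hσ =>
    hτ.2.trans hσ.1.2.symm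
  have hrat : ∀ σ ∈ S.topConesAbove τ, IsRationalCone L σ := fun σ hσ => hS.rational σ hσ.1.1
  have hτr := hS.rational τ hτ.1
  have hspec : ∀ σ ∈ S.topConesAbove τ, IsNormalVector L σ τ (normalVector L σ τ) := fun σ hσ =>
    normalVector_spec hL (hrat σ hσ) hτr hσ.2 (hdim σ hσ)
  have hle : ∀ σ ∈ S.topConesAbove τ, coneSpan τ ≤ coneSpan σ := fun σ hσ =>
    Submodule.span_mono hσ.2.le
  have hnot : ∀ σ ∈ S.topConesAbove τ, normalVector L σ τ ∉ coneSpan τ := by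
    have := hL.finiteDimensional
    intro σ hσ hn
    have h1 : coneSpan σ ≤ coneSpan τ := by
      refine (hrat σ hσ).isRational.trans (Submodule.span_le.2 fun m hm => ?_)
      have h2 : m ∈ coneLattice L σ := hm
      rw [(hspec σ hσ).2.2, AddSubgroup.mem_sup] at h2
      obtain ⟨u, hu, w, hw, rfl⟩ := h2
      obtain ⟨k, rfl⟩ := AddSubgroup.mem_zmultiples_iff.1 hw
      exact add_mem hu.2 (zsmul_mem hn k)
    have h2 := Submodule.finrank_mono h1
    have h3 := hdim σ hσ
    rw [coneDim, coneDim] at h3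
    omega
  -- Split the point as `(x + t w) + t s n`, where the first summand stays in `τ` for small `t`
  -- because `x` is interior to `τ`.
  have hmemσ : ∀ σ ∈ S.topConesAbove τ, ∀ w ∈ coneSpan τ, ∀ s : ℝ, 0 ≤ s →
      ∀ᶠ t in 𝓝[>] (0 : ℝ), x + t • (w + s • normalVector L σ τ) ∈ σ := by
    intro σ hσ w hw s hs
    filter_upwards [hτr.ev_mem hL hx hw, ev_pos] with t ht ht0
    have := add_mem (hσ.2.le ht) (σ.smul_mem (mul_nonneg ht0.le hs) (hspec σ hσ).2.1.1)
    convert this using 1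
    module
  have hinj : ∀ σ ∈ S.topConesAbove τ, ∀ σ' ∈ S.topConesAbove τ, ∀ s : ℝ, 0 ≤ s →
      normalVector L σ τ - s • normalVector L σ' τ ∈ coneSpan τ → σ = σ' := by
    intro σ hσ σ' hσ' s hs hV
    obtain ⟨t, ht, ht0⟩ := ((hmemσ σ' hσ' _ hV s hs).and ev_pos).exists
    rw [sub_add_cancel] at ht
    have h1 : InRelInterior σ (x + t • normalVector L σ τ) := by
      rw [add_comm]
      exact ((hspec σ hσ).2.1.smul ht0).add (hσ.2.le hx.1)
    exact hS.eq_of_isFaceOf hL hσ.1 hσ'.1 (hS.isFaceOf_of_relInterior hσ.1.1 hσ'.1.1 h1 ht)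
  refine ⟨⟨fun v => ⟨fun hv => ?_, ?_⟩, ?_, ?_, ?_, ?_⟩, fun σ hσ σ' hσ' h => ?_⟩
  · obtain ⟨σ, hσ, t, ht, hm⟩ := hS.exists_topCone_of_loc hL hpure hτ.1 hx hv
    obtain ⟨a, -, hpos, -, hker⟩ := (hrat σ hσ).exists_facet_functional hL hσ.2 (hdim σ hσ)
    set n := normalVector L σ τ with hn
    have hnσ : n ∈ coneSpan σ := mem_coneSpan (hspec σ hσ).2.1.1
    have han : 0 < a n := (hpos n (hspec σ hσ).2.1.1).lt_of_ne fun h =>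
      hnot σ hσ ((hker n hnσ).1 h.symm)
    have hax : a x = 0 := (hker x (hle σ hσ (mem_coneSpan hx.1))).2 (mem_coneSpan hx.1)
    have hv' : v ∈ coneSpan σ := by
      have := sub_mem (mem_coneSpan hm) (hle σ hσ (mem_coneSpan hx.1))
      rw [add_sub_cancel_left] at this
      exact (Submodule.smul_mem_iff _ ht.ne').1 this
    have hav : 0 ≤ a v := by
      have := hpos _ hm
      rw [map_add, hax, zero_add, map_smul, smul_eq_mul] at this
      exact nonneg_of_mul_nonneg_right this ht
    refine ⟨n, (hN n).2 ⟨σ, hσ, rfl⟩, a v / a n, div_nonneg hav han.le, ?_⟩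
    rw [← hker _ (sub_mem hv' (Submodule.smul_mem _ _ hnσ))]
    simp [han.ne']
  · rintro ⟨n, hn, s, hs, hV⟩
    obtain ⟨σ, hσ, rfl⟩ := (hN n).1 hn
    refine (hmemσ σ hσ _ hV s hs).mono fun t ht => ?_
    rw [sub_add_cancel] at ht
    exact ⟨σ, hσ.1.1, ht⟩
  · intro n hn
    obtain ⟨σ, hσ, rfl⟩ := (hN n).1 hn
    exact (hspec σ hσ).1
  · intro n hn
    obtain ⟨σ, hσ, rfl⟩ := (hN n).1 hn
    exact hnot σ hσ
  · intro n hn m hm s hV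
    obtain ⟨σ, hσ, rfl⟩ := (hN n).1 hn
    have hmσ : m ∈ coneLattice L σ := by
      refine ⟨hm, ?_⟩
      have := add_mem (hle σ hσ hV)
        (Submodule.smul_mem _ s (mem_coneSpan (hspec σ hσ).2.1.1))
      rwa [sub_add_cancel] at this
    rw [(hspec σ hσ).2.2, AddSubgroup.mem_sup] at hmσ
    obtain ⟨u, hu, w, hw, rfl⟩ := hmσ
    obtain ⟨k, rfl⟩ := AddSubgroup.mem_zmultiples_iff.1 hw
    refine ⟨k, ?_⟩
    by_contra hne
    apply hnot σ hσ
    have h1 := sub_mem hV (show u ∈ coneSpan τ from hu.2)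
    have h2 : u + k • normalVector L σ τ - s • normalVector L σ τ - u =
        ((k : ℝ) - s) • normalVector L σ τ := by
      rw [sub_smul, Int.cast_smul_eq_zsmul]; abel
    rw [h2] at h1
    exact (Submodule.smul_mem_iff _ (sub_ne_zero.2 (Ne.symm hne))).1 h1
  · intro n hn n' hn' s hs hV
    obtain ⟨σ, hσ, rfl⟩ := (hN n).1 hn
    obtain ⟨σ', hσ', rfl⟩ := (hN n').1 hn'
    rw [hinj σ hσ σ' hσ' s hs hV]
  · refine hinj σ hσ σ' hσ' 1 zero_le_one ?_
    dsimp only at h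
    simp [h]

lemma IsFan.finite_topConesAbove (hS : S.IsFan) (τ : PointedCone ℝ E) :
    (S.topConesAbove τ).Finite := hS.finite.subset fun _ hσ => hσ.1.1

/-- Distinct cones around a wall have distinct normal vectors, so sums over cones become sums over a
normal system. Vector-valued sums serve for balancing, real-valued ones for orders. -/
lemma IsFan.exists_normals (hL : IsLattice L) (hS : S.IsFan) (hpure : S.IsPure) (hτ : τ ∈ S.walls)
    (hx : InRelInterior τ x) : ∃ N, NormalSystem L (coneSpan τ) (Loc S.support x) N ∧
      (∀ (f : PointedCone ℝ E → E) (g : E → E),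
        (∀ σ ∈ S.topConesAbove τ, f σ = g (normalVector L σ τ)) →
          ∑ᶠ σ ∈ S.topConesAbove τ, f σ = ∑ n ∈ N, g n) ∧
      ∀ (f : PointedCone ℝ E → ℝ) (g : E → ℝ),
        (∀ σ ∈ S.topConesAbove τ, f σ = g (normalVector L σ τ)) →
          ∑ᶠ σ ∈ S.topConesAbove τ, f σ = ∑ n ∈ N, g n := by
  classical
  have hfin := hS.finite_topConesAbove τ
  have hN : ∀ n, n ∈ hfin.toFinset.image (fun σ => normalVector L σ τ) ↔
      ∃ σ ∈ S.topConesAbove τ, normalVector L σ τ = n := by simp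
  obtain ⟨h1, h2⟩ := hS.normalSystem hL hpure hτ hx hN
  refine ⟨_, h1, fun f g hfg => ?_, fun f g hfg => ?_⟩
  all_goals
    rw [Finset.sum_image (by simpa using h2), finsum_mem_eq_finite_toFinset_sum _ hfin]
    exact Finset.sum_congr rfl fun σ hσ => hfg σ (by simpa using hσ)

/-- A reduced fan whose support is a tropical set is tropical. -/
theorem IsFan.isTropical (hL : IsLattice L) (hS : S.IsFan) (hpure : S.IsPure)
    (hred : S.IsReduced) (h : TropSet L S.dim S.support) : S.IsTropical := by
  refine ⟨hL, hS, hpure, fun σ hσ => by rw [hred σ hσ]; exact one_pos, fun τ hτ => ?_⟩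
  obtain ⟨A, hA, hAS⟩ := hS.exists_adapted hL
  have hT := h.of_cellular hL hA hAS.cellular
  obtain ⟨x, hx, hlin⟩ := hAS.exists_generic hA.finite hτ.1
  obtain ⟨N, hN, hsum⟩ := hT.balanced x ⟨τ, hτ.1, hx.1⟩ (by rw [hlin]; exact hτ.2)
  rw [hlin] at hN hsum
  obtain ⟨N', hN', hsum', -⟩ := hS.exists_normals hL hpure hτ hx
  rw [hsum' _ id fun σ hσ => by rw [hred σ hσ.1, one_smul, id]]
  exact ⟨sum_mem hN'.mem_lattice, hN.sum_mem hN' hsum⟩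

/-- The support of a reduced tropical fan is a tropical set. -/
theorem IsTropical.tropA (hS : S.IsTropical) (hred : S.IsReduced) (hA : Arr L A)
    (hAS : Adapted A S) : TropA L S.dim A S.support := by
  have hL := hS.lattice
  have := hL.finiteDimensional
  refine ⟨hA, hAS.cellular, ?_, fun x hx hd => ?_⟩
  · rintro x ⟨σ₀, hσ₀, hx₀⟩
    obtain ⟨σ, hσ, hface⟩ := hS.pure σ₀ hσ₀
    have hx := hface.le hx₀
    obtain ⟨w, hw, hlin⟩ := hAS.exists_generic hA.finite hσ.1
    obtain ⟨t, ht⟩ := exists_near hA.finite x w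
    refine ⟨x + t • w, ⟨σ, hσ.1, add_mem hx (σ.smul_mem ht.1.le hw.1)⟩, ht.inCell, ?_⟩
    have : Lin A (x + t • w) = coneSpan σ := by
      rw [← hlin]
      refine le_antisymm (fun v hv a ha haw => hv a ha ((ht.eq_zero_iff ha).2 ⟨?_, haw⟩))
        fun v hv a ha h0 => hv a ha ((ht.eq_zero_iff ha).1 h0).2
      have : x ∈ Lin A w := by rw [hlin]; exact mem_coneSpan hx
      exact this a ha haw
    rw [this]
    exact hσ.2
  · obtain ⟨ρ, hρ, hxρ⟩ := hS.isFan.exists_carrier hL hx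
    have hle := hAS.lin_le hA.finite hρ hxρ.1
    have h1 := Submodule.finrank_mono hle
    obtain ⟨σ, hσ, hface⟩ := hS.pure ρ hρ
    have h2 : coneDim ρ ≤ S.dim := by
      rw [← hσ.2]; exact Submodule.finrank_mono (Submodule.span_mono hface.le)
    -- The carrier of `x` is a wall of the fan, where the fan's own balancing applies, or a
    -- top-dimensional cone that the arrangement subdivides, where the local cone is a vector space.
    rcases (show coneDim ρ + 1 = S.dim ∨ coneDim ρ = S.dim by rw [coneDim] at h2 ⊢; omega)
      with h3 | h3
    · have h4 : Lin A x = coneSpan ρ :=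
        Submodule.eq_of_le_of_finrank_le hle (by rw [coneDim] at h3; omega)
      obtain ⟨N, hN, hsum, -⟩ := hS.isFan.exists_normals hL hS.pure ⟨hρ, h3⟩ hxρ
      have h5 := hS.balanced ρ ⟨hρ, h3⟩
      rw [hsum _ id fun σ hσ => by rw [hred σ hσ.1, one_smul, id]] at h5
      exact ⟨N, by rwa [h4], by rw [h4]; exact h5.2⟩
    · have hloc := hS.isFan.loc_eq_coneSpan hL hS.pure ⟨hρ, h3⟩ hxρ
      classical
      obtain ⟨n, hne, -, hn⟩ := exists_balanced_of_loc_eq hL hA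
        (hS.isFan.rational ρ hρ).isRational hle (by rw [coneDim] at h3; omega)
      refine ⟨{n, -n}, by rwa [hloc], ?_⟩
      rw [Finset.sum_pair hne, add_neg_cancel]
      exact zero_mem _

theorem IsTropical.tropSet (hS : S.IsTropical) (hred : S.IsReduced) :
    TropSet L S.dim S.support :=
  let ⟨A, hA, hAS⟩ := hS.isFan.exists_adapted hS.lattice; ⟨A, hS.tropA hred hA hAS⟩

lemma IsTropical.support_nonempty (hS : S.IsTropical) : S.support.Nonempty :=
  let ⟨σ, hσ⟩ := hS.isFan.nonempty; ⟨0, σ, hσ, zero_mem σ⟩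

/-- The fan of the cells of `A` in `X`. -/
noncomputable def arrFan (L : AddSubgroup E) (d : ℕ) (A : Set (E →ₗ[ℝ] ℝ)) (X : Set E) :
    WeightedFan L where
  cones := {c | ∃ x ∈ X, c = cell A x}
  dim := d
  weight _ := 1

variable {d : ℕ} {X : Set E}

lemma arrFan_support (hX : Cellular A X) : (arrFan L d A X).support = X := by
  ext y
  constructor
  · rintro ⟨_, ⟨x, hx, rfl⟩, hy⟩
    exact hX x hx y hy
  · exact fun hy => ⟨_, ⟨y, hy, rfl⟩, InCell.refl A y⟩

lemma arrFan_isFan (hL : IsLattice L) (hA : Arr L A) (hsep : ∀ v, (∀ a ∈ A, a v = 0) → v = 0)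
    (hX : Cellular A X) (hne : X.Nonempty) : (arrFan L d A X).IsFan := by
  refine ⟨?_, (let ⟨x, hx⟩ := hne; ⟨cell A x, x, hx, rfl⟩), ?_, ?_, ?_⟩
  · let F : Set (E →ₗ[ℝ] ℝ) × Set (E →ₗ[ℝ] ℝ) → Set E := fun p =>
      {y | (∀ a ∈ p.1, 0 ≤ a y) ∧ ∀ a ∈ p.2, a y ≤ 0}
    have h1 : ((A.powerset ×ˢ A.powerset).image F).Finite :=
      (hA.finite.finite_subsets.prod hA.finite.finite_subsets).image F
    refine Set.Finite.of_finite_image (f := fun c : PointedCone ℝ E => (c : Set E))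
      (h1.subset ?_) SetLike.coe_injective.injOn
    rintro _ ⟨_, ⟨x, hx, rfl⟩, rfl⟩
    refine ⟨({a ∈ A | 0 ≤ a x}, {a ∈ A | a x ≤ 0}), ⟨Set.sep_subset _ _, Set.sep_subset _ _⟩, ?_⟩
    ext y
    exact ⟨fun h a ha => ⟨fun h0 => h.1 a ⟨ha, h0⟩, fun h0 => h.2 a ⟨ha, h0⟩⟩,
      fun h => ⟨fun a ha => (h a ha.1).1 ha.2, fun a ha => (h a ha.1).2 ha.2⟩⟩
  · rintro _ ⟨x, hx, rfl⟩
    refine ⟨hL.cell_generators hA x, fun y hy hy' => hsep y fun a ha => ?_⟩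
    have h1 := hy a ha
    have h2 := hy' a ha
    rw [map_neg] at h2
    rcases le_total 0 (a x) with h0 | h0
    · linarith [h1.1 h0, h2.1 h0]
    · linarith [h1.2 h0, h2.2 h0]
  · rintro _ ⟨x, hx, rfl⟩ τ hτ
    obtain ⟨y, hy, rfl⟩ := (isFaceOf_cell_iff hA.finite).1 hτ
    exact ⟨y, hX x hx y hy, rfl⟩
  · rintro _ ⟨x, hx, rfl⟩ _ ⟨x', hx', rfl⟩
    refine .of_mem_of_add_mem_left inf_le_left fun {u v} hu hv huv => ⟨hu, fun a ha => ?_⟩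
    have h1 := hu a ha
    have h2 := hv a ha
    have h3 := huv.2 a ha
    rw [map_add] at h3
    rcases le_total 0 (a x) with h0 | h0
    · exact ⟨fun _ => h1.1 h0, fun h5 => by linarith [h3.2 h5, h2.1 h0]⟩
    · exact ⟨fun h5 => by linarith [h3.1 h5, h2.2 h0], fun _ => h1.2 h0⟩

lemma arrFan_isReduced : (arrFan L d A X).IsReduced := fun _ _ => rfl

lemma arrFan_isPure (h : TropA L d A X) : (arrFan L d A X).IsPure := by
  rintro _ ⟨x, hx, rfl⟩
  obtain ⟨y, hy, hyx, hd⟩ := h.pure x hx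
  exact ⟨_, ⟨⟨y, hy, rfl⟩, by rw [coneDim_cell h.arr.finite]; exact hd⟩, isFaceOf_cell hyx⟩

lemma arrFan_isTropical (hL : IsLattice L) (h : TropA L d A X)
    (hsep : ∀ v, (∀ a ∈ A, a v = 0) → v = 0) (hne : X.Nonempty) : (arrFan L d A X).IsTropical :=
  (arrFan_isFan hL h.arr hsep h.cellular hne).isTropical hL (arrFan_isPure h) arrFan_isReduced
    (by rw [arrFan_support h.cellular]; exact ⟨A, h⟩)

lemma arrFan_isRefinement (hS : S.IsTropical) (hred : S.IsReduced) (hA : Arr L A)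
    (hAS : Adapted A S) (hsep : ∀ v, (∀ a ∈ A, a v = 0) → v = 0) :
    (arrFan L S.dim A S.support).IsRefinement S := by
  refine ⟨arrFan_isTropical hS.lattice (hS.tropA hred hA hAS) hsep hS.support_nonempty, hS,
    arrFan_support hAS.cellular, ?_, fun ρ _ σ hσ _ => (hred σ hσ).symm⟩
  rintro _ ⟨x, ⟨σ, hσ, hx⟩, rfl⟩
  exact ⟨σ, hσ, fun y hy => hAS.cellular_cone hσ x hx y hy⟩

lemma IsTropical.dim_eq (hS : S.IsTropical) (hred : S.IsReduced) (hS' : S'.IsTropical)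
    (hred' : S'.IsReduced) (h : S.support = S'.support) : S.dim = S'.dim := by
  have hL := hS.lattice
  have := hL.finiteDimensional
  obtain ⟨A, hA⟩ := hS.tropSet hred
  obtain ⟨A', hA'⟩ := hS'.tropSet hred'
  have h1 := hA.mono hL (hA.arr.union hA'.arr) Set.subset_union_left
  have h2 := hA'.mono hL (hA.arr.union hA'.arr) Set.subset_union_right
  obtain ⟨x, hx⟩ := hS.support_nonempty
  obtain ⟨y, hy, -, hd⟩ := h1.pure x hx
  obtain ⟨z, hz, -, hd'⟩ := h2.pure x (h ▸ hx)
  have h3 := h1.finrank_le (h ▸ hz)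
  have h4 := h2.finrank_le (h ▸ hy)
  omega

/-- Reduced tropical fans with the same support are tropically equivalent. -/
theorem tropEquiv_of_support_eq (hS : S.IsTropical) (hred : S.IsReduced) (hS' : S'.IsTropical)
    (hred' : S'.IsReduced) (h : S.support = S'.support) : S.TropEquiv S' := by
  obtain ⟨A, hA, hAS⟩ := hS.isFan.exists_adapted hS.lattice
  obtain ⟨A', hA', hAS'⟩ := hS'.isFan.exists_adapted hS.lattice
  obtain ⟨C, hC, hsep⟩ := hS.lattice.exists_separating
  have hU := (hA.union hA').union hC
  have hsep' : ∀ v, (∀ a ∈ A ∪ A' ∪ C, a v = 0) → v = 0 := fun v hv =>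
    hsep v fun a ha => hv a (.inr ha)
  have h1 := arrFan_isRefinement hS hred hU
    (hAS.mono (Set.subset_union_left.trans Set.subset_union_left)) hsep'
  have h2 := arrFan_isRefinement hS' hred' hU
    (hAS'.mono (Set.subset_union_right.trans Set.subset_union_left)) hsep'
  refine ⟨_, h1, ?_⟩
  rwa [h, hS.dim_eq hred hS' hred' h]

end Fans

end WeightedFan

end Trop

namespace Trop

open Filter Topology

namespace WeightedFan

/-! ### Cycles, their isomorphisms and isomorphisms of supports -/

section Cycles

variable {E E' : Type*} [AddCommGroup E] [Module ℝ E] [AddCommGroup E'] [Module ℝ E']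
  {L : AddSubgroup E} {L' : AddSubgroup E'} {S S' R : WeightedFan L} {T T' : WeightedFan L'}
  {f : E →ₗ[ℝ] E'} {g : E' →ₗ[ℝ] E}

lemma IsRefinement.isReduced_left (h : R.IsRefinement S) (hS : S.IsReduced) : R.IsReduced := by
  intro ρ hρ
  obtain ⟨σ, hσ, hle⟩ := h.subdivides ρ hρ.1
  obtain ⟨σ', hσ', hface⟩ := h.tropical_right.pure σ hσ
  rw [h.weight_eq ρ hρ σ' hσ' (hle.trans hface.le), hS σ' hσ']

/-- An interior point of `σ` lies in a top-dimensional cone of the refinement, and the only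
top-dimensional cone of `S` that can contain the latter is `σ`. -/
lemma IsRefinement.isReduced_right (h : R.IsRefinement S) (hR : R.IsReduced) : S.IsReduced := by
  intro σ hσ
  have hL := h.tropical_right.lattice
  have hS := h.tropical_right.isFan
  obtain ⟨y, hy⟩ := (hS.rational σ hσ.1).exists_relInterior hL
  obtain ⟨ρ, hρ, hyρ⟩ : y ∈ R.support := h.support_eq ▸ ⟨σ, hσ.1, hy.1⟩
  obtain ⟨ρ', hρ', hface⟩ := h.tropical_left.pure ρ hρ
  obtain ⟨σ', hσ', hle⟩ := h.subdivides ρ' hρ'.1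
  obtain ⟨σ'', hσ'', hface'⟩ := h.tropical_right.pure σ' hσ'
  have hle' := hle.trans hface'.le
  obtain rfl := hS.eq_of_isFaceOf hL hσ hσ''
    (hS.isFaceOf_of_relInterior hσ.1 hσ''.1 hy (hle' (hface.le hyρ)))
  rw [← h.weight_eq ρ' hρ' σ hσ hle', hR ρ' hρ']

lemma TropEquiv.symm (h : S.TropEquiv S') : S'.TropEquiv S := let ⟨R, h1, h2⟩ := h; ⟨R, h2, h1⟩

lemma TropEquiv.isReduced (h : S.TropEquiv S') (hS : S.IsReduced) : S'.IsReduced :=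
  let ⟨_, h1, h2⟩ := h; h2.isReduced_right (h1.isReduced_left hS)

lemma TropEquiv.support_eq (h : S.TropEquiv S') : S.support = S'.support :=
  let ⟨_, h1, h2⟩ := h; h1.support_eq.symm.trans h2.support_eq

lemma TropEquiv.isTropical_left (h : S.TropEquiv S') : S.IsTropical :=
  let ⟨_, h1, _⟩ := h; h1.tropical_right

lemma IsFan.isRational_span (hS : S.IsFan) : IsRational L (Submodule.span ℝ S.support) := by
  refine Submodule.span_le.2 ?_
  rintro x ⟨σ, hσ, hx⟩
  have hle : coneSpan σ ≤ Submodule.span ℝ S.support :=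
    Submodule.span_mono fun y hy => ⟨σ, hσ, hy⟩
  have h2 : {y | y ∈ L ∧ y ∈ coneSpan σ} ⊆ {y | y ∈ L ∧ y ∈ Submodule.span ℝ S.support} :=
    fun y hy => ⟨hy.1, hle hy.2⟩
  exact Submodule.span_mono h2 ((hS.rational σ hσ).isRational (mem_coneSpan hx))

lemma IsFan.eqOn_span (hS : S.IsFan) (h : ∀ x ∈ S.fanLattice, g (f x) = x) :
    ∀ x ∈ Submodule.span ℝ S.support, g (f x) = x := fun _ hx =>
  LinearMap.eqOn_span (f := g ∘ₗ f) (g := LinearMap.id) (fun z hz => h z hz)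
    (hS.isRational_span hx)

lemma IsFanIso.symm (h : IsFanIso S T f g) : IsFanIso T S g f :=
  ⟨h.inv_lattice, h.map_lattice, h.right_inv, h.left_inv, h.inv_cone, h.map_cone, h.weight_inv,
    h.weight_map⟩

lemma IsFanIso.coneDim_map (h : IsFanIso S T f g) (hS : S.IsFan) {σ : PointedCone ℝ E}
    (hσ : σ ∈ S.cones) : coneDim (σ.map f) = coneDim σ := by
  have hle : coneSpan σ ≤ Submodule.span ℝ S.support :=
    Submodule.span_mono fun y hy => ⟨σ, hσ, hy⟩
  have hinj : Set.InjOn f (coneSpan σ) := fun x hx y hy hxy => by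
    rw [← hS.eqOn_span h.left_inv x (hle hx), ← hS.eqOn_span h.left_inv y (hle hy), hxy]
  have hmap : coneSpan (σ.map f) = (coneSpan σ).map f := by
    rw [coneSpan, coneSpan, Submodule.map_span]; rfl
  rw [coneDim, hmap, coneDim]
  exact (LinearEquiv.finrank_eq (LinearEquiv.ofInjective (f.domRestrict (coneSpan σ))
    (fun x y hxy => Subtype.ext (hinj x.2 y.2 hxy)) ≪≫ₗ
      LinearEquiv.ofEq _ _ (by rw [LinearMap.range_domRestrict]))).symm

lemma IsFan.coneDim_le (hL : IsLattice L) (hpure : S.IsPure) {σ : PointedCone ℝ E}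
    (hσ : σ ∈ S.cones) : coneDim σ ≤ S.dim := by
  have := hL.finiteDimensional
  obtain ⟨σ', hσ', hface⟩ := hpure σ hσ
  rw [← hσ'.2]
  exact Submodule.finrank_mono (Submodule.span_mono hface.le)

lemma IsFanIso.dim_le (h : IsFanIso S T f g) (hS : S.IsTropical) (hT : T.IsTropical) :
    S.dim ≤ T.dim := by
  obtain ⟨σ₀, hσ₀⟩ := hS.isFan.nonempty
  obtain ⟨σ, hσ, -⟩ := hS.pure σ₀ hσ₀
  rw [← hσ.2, ← h.coneDim_map hS.isFan hσ.1]
  exact IsFan.coneDim_le hT.lattice hT.pure (h.map_cone σ hσ.1)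

lemma IsFanIso.isReduced (h : IsFanIso S T f g) (hS : S.IsTropical) (hT : T.IsTropical)
    (hred : S.IsReduced) : T.IsReduced := fun σ hσ => by
  rw [← h.weight_inv σ hσ]
  refine hred _ ⟨h.inv_cone σ hσ.1, ?_⟩
  rw [h.symm.coneDim_map hT.isFan hσ.1, hσ.2]
  exact le_antisymm (h.symm.dim_le hT hS) (h.dim_le hS hT)

/-- The given maps respect lattice points only in the spans of the supports. These spans are
rational, so precomposing with integral projections onto them gives maps that are integral
everywhere. -/
lemma IsFanIso.exists_setIso (h : IsFanIso S T f g) (hS : S.IsTropical) (hT : T.IsTropical) :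
    ∃ f' g', SetIso L S.support L' T.support f' g' := by
  obtain ⟨P, hP, hP', hPL⟩ := hS.lattice.exists_projection hS.isFan.isRational_span
  obtain ⟨Q, hQ, hQ', hQL⟩ := hT.lattice.exists_projection hT.isFan.isRational_span
  have hmap : ∀ x ∈ S.support, f x ∈ T.support := fun x ⟨σ, hσ, hx⟩ =>
    ⟨_, h.map_cone σ hσ, x, hx, rfl⟩
  have hinv : ∀ x ∈ T.support, g x ∈ S.support := fun x ⟨σ, hσ, hx⟩ =>
    ⟨_, h.inv_cone σ hσ, x, hx, rfl⟩
  have h1 : ∀ x ∈ S.support, P x = x := fun x hx => hP' x (Submodule.subset_span hx)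
  have h2 : ∀ x ∈ T.support, Q x = x := fun x hx => hQ' x (Submodule.subset_span hx)
  refine ⟨f ∘ₗ P, g ∘ₗ Q, fun x hx => (h.map_lattice _ ⟨hPL x hx, hP x⟩).1,
    fun x hx => (h.inv_lattice _ ⟨hQL x hx, hQ x⟩).1, fun x hx => ?_, fun x hx => ?_,
    fun x hx => ?_, fun x hx => ?_⟩
  · simpa [h1 x hx] using hmap x hx
  · simpa [h2 x hx] using hinv x hx
  · simpa [h1 x hx, h2 _ (hmap x hx)] using
      hS.isFan.eqOn_span h.left_inv x (Submodule.subset_span hx)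
  · simpa [h2 x hx, h1 _ (hinv x hx)] using
      hT.isFan.eqOn_span h.right_inv x (Submodule.subset_span hx)

/-- Isomorphic cycles have isomorphic supports. -/
theorem CycleIso.exists_setIso (h : S.CycleIso T) (hred : S.IsReduced) :
    T.IsTropical ∧ T.IsReduced ∧ ∃ f g, SetIso L S.support L' T.support f g := by
  obtain ⟨R, R', f, g, h1, h2, h3⟩ := h
  have hR := h1.symm.isTropical_left
  have hR' := h2.symm.isTropical_left
  refine ⟨h2.isTropical_left, h2.symm.isReduced (h3.isReduced hR hR' (h1.isReduced hred)), ?_⟩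
  rw [h1.support_eq, h2.support_eq]
  exact h3.exists_setIso hR hR'

/-- Reduced tropical fans with isomorphic supports represent isomorphic cycles. -/
theorem cycleIso_of_setIso (hS : S.IsTropical) (hred : S.IsReduced) (hT : T.IsTropical)
    (hred' : T.IsReduced) (h : SetIso L S.support L' T.support f g) : S.CycleIso T := by
  obtain ⟨A₀, hA₀⟩ := hS.tropSet hred
  obtain ⟨A, A', -, hA, hA', hsep, hsep', hcell⟩ := h.exists_tropA hS.lattice hT.lattice hA₀
  have hR := arrFan_isTropical hS.lattice hA hsep hS.support_nonempty
  have hR' := arrFan_isTropical hT.lattice hA' hsep' hT.support_nonempty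
  have hsupp := arrFan_support (L := L) (d := S.dim) hA.cellular
  have hsupp' := arrFan_support (L := L') (d := S.dim) hA'.cellular
  have hmap : ∀ x ∈ S.support, (cell A x).map f = cell A' (f x) := fun x hx => by
    ext y
    rw [PointedCone.mem_map, mem_cell, hcell x hx]
    constructor
    · rintro ⟨z, hz, rfl⟩
      have := h.left_inv z (hA.cellular x hx z hz)
      exact ⟨by rw [this], by rw [this]; exact hz⟩
    · exact fun hy => ⟨g y, hy.2, hy.1⟩
  have hinv : ∀ y ∈ T.support, (cell A' y).map g = cell A (g y) := fun y hy => by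
    have := hmap (g y) (h.inv_map y hy)
    rw [h.right_inv y hy] at this
    rw [← this, PointedCone.map_map]
    refine SetLike.coe_injective ?_
    rw [PointedCone.coe_map]
    refine (Set.image_congr fun z hz => ?_).trans (Set.image_id' _)
    exact h.left_inv z (hA.cellular _ (h.inv_map y hy) z hz)
  refine ⟨_, _, f, g, tropEquiv_of_support_eq hS hred hR arrFan_isReduced hsupp.symm,
    tropEquiv_of_support_eq hT hred' hR' arrFan_isReduced hsupp'.symm, ?_⟩
  have hf : ∀ x ∈ Submodule.span ℝ S.support, f x ∈ Submodule.span ℝ T.support := fun x hx =>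
    (Submodule.span_le (p := (Submodule.span ℝ T.support).comap f)).2
      (fun z hz => Submodule.subset_span (h.map z hz)) hx
  have hg : ∀ x ∈ Submodule.span ℝ T.support, g x ∈ Submodule.span ℝ S.support := fun x hx =>
    (Submodule.span_le (p := (Submodule.span ℝ S.support).comap g)).2
      (fun z hz => Submodule.subset_span (h.inv_map z hz)) hx
  have hgf : ∀ x ∈ Submodule.span ℝ S.support, g (f x) = x := fun x hx =>
    LinearMap.eqOn_span (f := g ∘ₗ f) (g := LinearMap.id) (fun z hz => h.left_inv z hz) hx
  have hfg : ∀ x ∈ Submodule.span ℝ T.support, f (g x) = x := fun x hx =>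
    LinearMap.eqOn_span (f := f ∘ₗ g) (g := LinearMap.id) (fun z hz => h.right_inv z hz) hx
  refine ⟨fun x hx => ?_, fun x hx => ?_, fun x hx => ?_, fun x hx => ?_, ?_, ?_,
    fun _ _ => rfl, fun _ _ => rfl⟩
  · rw [fanLattice, hsupp] at hx; rw [fanLattice, hsupp']
    exact ⟨h.lattice x hx.1, hf x hx.2⟩
  · rw [fanLattice, hsupp'] at hx; rw [fanLattice, hsupp]
    exact ⟨h.inv_lattice x hx.1, hg x hx.2⟩
  · rw [fanLattice, hsupp] at hx
    exact hgf x hx.2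
  · rw [fanLattice, hsupp'] at hx
    exact hfg x hx.2
  · rintro _ ⟨x, hx, rfl⟩
    exact ⟨f x, h.map x hx, hmap x hx⟩
  · rintro _ ⟨y, hy, rfl⟩
    exact ⟨g y, h.inv_map y hy, hinv y hy⟩

/-- Adjoining separating functionals makes the cells strongly convex, so that they form a fan. -/
lemma exists_fan_of_tropA (hL : IsLattice L) {d : ℕ} {X : Set E} {A : Set (E →ₗ[ℝ] ℝ)}
    (h : TropA L d A X) (hX : X.Nonempty) :
    ∃ B, A ⊆ B ∧ TropA L d B X ∧ (arrFan L d B X).IsTropical ∧ (arrFan L d B X).IsFan ∧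
      (arrFan L d B X).support = X := by
  obtain ⟨C, hC, hsep⟩ := hL.exists_separating
  have h' := h.mono hL (h.arr.union hC) Set.subset_union_left
  have hsep' : ∀ v, (∀ a ∈ A ∪ C, a v = 0) → v = 0 := fun v hv => hsep v fun a ha => hv a (.inr ha)
  have := arrFan_isTropical hL h' hsep' hX
  exact ⟨A ∪ C, Set.subset_union_left, h', this, this.isFan, arrFan_support h'.cellular⟩

end Cycles

/-! ### Invariance of quasilinearity under isomorphisms of supports -/

section Quasilinear

variable {E E' : Type u} [AddCommGroup E] [Module ℝ E] [AddCommGroup E'] [Module ℝ E']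
  {L : AddSubgroup E} {L' : AddSubgroup E'} {S S' : WeightedFan L} {T : WeightedFan L'}
  {f : E →ₗ[ℝ] E'} {g : E' →ₗ[ℝ] E}

lemma IsQuasilinear.isTropical (h : S.IsQuasilinear) : S.IsTropical := by
  cases h <;> assumption

lemma IsQuasilinear.isReduced (h : S.IsQuasilinear) : S.IsReduced := by
  cases h <;> assumption

/-- Quasilinearity is invariant under isomorphisms of the supports. -/
theorem IsQuasilinear.of_setIso (hS : S.IsTropical) (hred : S.IsReduced) (hT : T.IsQuasilinear)
    (h : SetIso L S.support L' T.support f g) : S.IsQuasilinear := by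
  have hTred := hT.isReduced
  -- No induction is needed: both constructors end in an isomorphism of cycles, which absorbs the
  -- given one.
  cases hT with
  | complete _ T' h1 h2 h3 h4 h5 =>
    obtain ⟨-, h6, f', g', h7⟩ := h5.exists_setIso hTred
    exact .complete S T' hS hred h3 h4 (cycleIso_of_setIso hS hred h3 h6 (h.trans h7))
  | modification _ T' φ h1 h2 h3 h4 h5 h6 =>
    obtain ⟨h8, h9, f', g', h7⟩ := h6.exists_setIso hTred
    exact .modification S T' φ hS hred h3 h4 h5 (cycleIso_of_setIso hS hred h8 h9 (h.trans h7))

theorem IsQuasilinear.of_support_eq (hS : S.IsTropical) (hred : S.IsReduced)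
    (hS' : S'.IsQuasilinear) (h : S.support = S'.support) : S.IsQuasilinear :=
  .of_setIso hS hred hS' (by rw [h]; exact SetIso.refl L _)

end Quasilinear

end WeightedFan

open WeightedFan

/-! ### Quasilinear sets -/

section QuasilinearSets

variable {E E' : Type u} [AddCommGroup E] [Module ℝ E] [AddCommGroup E'] [Module ℝ E']
  {L : AddSubgroup E} {L' : AddSubgroup E'} {X : Set E} {X' : Set E'}
  {f : E →ₗ[ℝ] E'} {g : E' →ₗ[ℝ] E}

/-- `X` is the support of a quasilinear tropical fan. -/
def QLs (L : AddSubgroup E) (X : Set E) : Prop :=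
  ∃ S : WeightedFan L, S.IsQuasilinear ∧ S.support = X

lemma QLs.isLattice (h : QLs L X) : IsLattice L := let ⟨_, h, _⟩ := h; h.isTropical.lattice

lemma QLs.nonempty (h : QLs L X) : X.Nonempty :=
  let ⟨_, h, h'⟩ := h; h' ▸ h.isTropical.support_nonempty

lemma QLs.tropSet (h : QLs L X) : ∃ d, TropSet L d X :=
  let ⟨_, h, h'⟩ := h; ⟨_, h' ▸ h.isTropical.tropSet h.isReduced⟩

lemma QLs.zero_mem (h : QLs L X) : (0 : E) ∈ X := let ⟨_, hd⟩ := h.tropSet; hd.zero_mem h.nonempty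

theorem QLs.of_setIso (hL : IsLattice L) (hX' : QLs L' X') (h : SetIso L X L' X' f g) :
    QLs L X := by
  obtain ⟨d, hd⟩ := hX'.tropSet
  obtain ⟨A, hA⟩ := h.symm.tropSet hX'.isLattice hL hd
  obtain ⟨y, hy⟩ := hX'.nonempty
  obtain ⟨B, -, hB, hR, -, hsupp⟩ := exists_fan_of_tropA hL hA ⟨g y, h.inv_map y hy⟩
  obtain ⟨T, hT, rfl⟩ := hX'
  exact ⟨_, .of_setIso hR arrFan_isReduced hT (by rw [hsupp]; exact h), hsupp⟩

lemma qls_univ (hL : IsLattice L) : QLs L (Set.univ : Set E) := by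
  obtain ⟨B, -, hB, hR, -, hsupp⟩ := exists_fan_of_tropA hL (tropA_univ L) ⟨0, trivial⟩
  exact ⟨_, .complete _ _ hR arrFan_isReduced hR hsupp
    (cycleIso_of_setIso hR arrFan_isReduced hR arrFan_isReduced (SetIso.refl L _)), hsupp⟩

lemma QLs.isQuasilinear {S : WeightedFan L} (h : QLs L S.support) (hS : S.IsTropical)
    (hred : S.IsReduced) : S.IsQuasilinear :=
  let ⟨_, hT, hT'⟩ := h; .of_support_eq hS hred hT hT'.symm

end QuasilinearSets

end Trop

namespace Trop

open Filter Topology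

namespace WeightedFan

/-! ### Orders of vanishing and divisors on fans -/

section PiecewiseLinear

variable {E : Type*} [AddCommGroup E] [Module ℝ E] {L : AddSubgroup E} {S : WeightedFan L}
  {φ : E → ℝ} {σ τ : PointedCone ℝ E} {x v : E}

lemma IsPiecewiseLinear.linearPart_apply (hφ : S.IsPiecewiseLinear φ) (hσ : σ ∈ S.cones)
    (hx : x ∈ σ) : linearPart φ σ x = φ x := by
  obtain ⟨ℓ, -, h⟩ := hφ σ hσ
  have h' : ∃ ℓ : E →ₗ[ℝ] ℝ, ∀ x ∈ σ, φ x = ℓ x := ⟨ℓ, h⟩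
  rw [linearPart, dif_pos h', h'.choose_spec x hx]

lemma IsPiecewiseLinear.linearPart_integral (hφ : S.IsPiecewiseLinear φ) (hσ : σ ∈ S.cones)
    (hx : x ∈ coneLattice L σ) : ∃ k : ℤ, linearPart φ σ x = k := by
  obtain ⟨ℓ, h1, h2⟩ := hφ σ hσ
  have : linearPart φ σ x = ℓ x := LinearMap.eqOn_span
    (fun z hz => (hφ.linearPart_apply hσ hz).trans (h2 z hz)) hx.2
  rw [this]
  exact h1 x hx

lemma IsPiecewiseLinear.dir_eq_linearPart (hφ : S.IsPiecewiseLinear φ) (hσ : σ ∈ S.cones)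
    (hx : x ∈ σ) (hv : ∀ᶠ t in 𝓝[>] (0 : ℝ), x + t • v ∈ σ) : dir φ x v = linearPart φ σ v := by
  refine dir_eq (hv.mono fun t ht => ?_)
  rw [← hφ.linearPart_apply hσ ht, ← hφ.linearPart_apply hσ hx]
  simp

lemma IsPiecewiseLinear.map_add (hφ : S.IsPiecewiseLinear φ) (hσ : σ ∈ S.cones)
    (hx : x ∈ σ) (hv : v ∈ σ) : φ (x + v) = φ x + φ v := by
  obtain ⟨ℓ, -, h⟩ := hφ σ hσ
  rw [h x hx, h v hv, h _ (add_mem hx hv), _root_.map_add]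

/-- At an interior point of the wall, the linear parts on the wall and on the cones around it all
compute directional derivatives. This brings the order into the form used for sets. -/
lemma IsTropical.ord_eq (hS : S.IsTropical) (hred : S.IsReduced) (hφ : S.IsPiecewiseLinear φ)
    (hτ : τ ∈ S.walls) (hx : InRelInterior τ x) :
    ∃ N, NormalSystem L (coneSpan τ) (Loc S.support x) N ∧ ∑ n ∈ N, n ∈ coneSpan τ ∧
      S.ord φ τ = dir φ x (∑ n ∈ N, n) - ∑ n ∈ N, dir φ x n := by
  have hL := hS.lattice
  obtain ⟨N, hN, hsum, hsum'⟩ := hS.isFan.exists_normals hL hS.pure hτ hx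
  have h1 : ∑ᶠ σ ∈ S.topConesAbove τ, S.weight σ • normalVector L σ τ = ∑ n ∈ N, n :=
    hsum _ id fun σ hσ => by rw [hred σ hσ.1, one_smul, id]
  have h2 := hS.balanced τ hτ
  rw [h1] at h2
  refine ⟨N, hN, h2.2, ?_⟩
  rw [ord, h1, hφ.dir_eq_linearPart hτ.1 hx.1 ((hS.isFan.rational τ hτ.1).ev_mem hL hx h2.2)]
  congr 1
  refine hsum' _ (dir φ x) fun σ hσ => ?_
  have hspec := normalVector_spec hL (hS.isFan.rational σ hσ.1.1) (hS.isFan.rational τ hτ.1)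
    hσ.2 (hτ.2.trans hσ.1.2.symm)
  rw [hred σ hσ.1, one_smul, hφ.dir_eq_linearPart hσ.1.1 (hσ.2.le hx.1)]
  filter_upwards [ev_pos] with t ht
  exact add_mem (hσ.2.le hx.1) (σ.smul_mem ht.le hspec.2.1.1)

/-- Guarantees that the floor in the weights of the divisor loses nothing. -/
lemma IsTropical.exists_int_ord (hS : S.IsTropical) (hφ : S.IsPiecewiseLinear φ)
    (hτ : τ ∈ S.walls) : ∃ k : ℤ, S.ord φ τ = k := by
  obtain ⟨a, ha⟩ := hφ.linearPart_integral hτ.1 (hS.balanced τ hτ)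
  have h : ∀ σ ∈ S.topConesAbove τ, ∃ k : ℤ,
      linearPart φ σ (S.weight σ • normalVector L σ τ) = k := fun σ hσ => by
    have hspec := normalVector_spec hS.lattice (hS.isFan.rational σ hσ.1.1)
      (hS.isFan.rational τ hτ.1) hσ.2 (hτ.2.trans hσ.1.2.symm)
    exact hφ.linearPart_integral hσ.1.1
      ((coneLattice L σ).zsmul_mem ⟨hspec.1, mem_coneSpan hspec.2.1.1⟩ _)
  choose! k hk using h
  have hfin := hS.isFan.finite_topConesAbove τ
  refine ⟨a - ∑ σ ∈ hfin.toFinset, k σ, ?_⟩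
  rw [ord, ha, finsum_mem_eq_finite_toFinset_sum _ hfin, Int.cast_sub, Int.cast_sum]
  congr 1
  exact Finset.sum_congr rfl fun σ hσ => hk σ (by simpa using hσ)

lemma IsFan.divisor_cones_subset (hS : S.IsFan) : (S.divisor φ).cones ⊆ S.cones :=
  fun _ ⟨τ, hτ, _, hρ⟩ => hS.face_mem τ hτ.1 _ hρ

lemma IsFan.divisor_support_subset (hS : S.IsFan) : (S.divisor φ).support ⊆ S.support :=
  fun _ ⟨ρ, hρ, hx⟩ => ⟨ρ, hS.divisor_cones_subset hρ, hx⟩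

lemma IsFan.mem_divisor_support (hL : IsLattice L) (hS : S.IsFan) (hτ : τ ∈ S.walls)
    (hx : InRelInterior τ x) : x ∈ (S.divisor φ).support ↔ S.ord φ τ ≠ 0 := by
  refine ⟨?_, fun h => ⟨τ, ⟨τ, hτ, h, .refl τ⟩, hx.1⟩⟩
  rintro ⟨ρ, ⟨τ', hτ', h, hρ⟩, hxρ⟩
  have := (hS.rational τ' hτ'.1).eq_of_isFaceOf hL
    (hS.isFaceOf_of_relInterior hτ.1 hτ'.1 hx (hρ.le hxρ)) (Nat.succ_injective
      (hτ.2.trans hτ'.2.symm))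
  rwa [this]

lemma IsFan.notMem_divisor_support (hL : IsLattice L) (hS : S.IsFan) (hσ : σ ∈ S.topCones)
    (hx : InRelInterior σ x) : x ∉ (S.divisor φ).support := by
  have := hL.finiteDimensional
  rintro ⟨ρ, ⟨τ, hτ, h, hρ⟩, hxρ⟩
  have h1 := hS.isFaceOf_of_relInterior hσ.1 hτ.1 hx (hρ.le hxρ)
  have h2 := Submodule.finrank_mono (Submodule.span_mono (R := ℝ) h1.le)
  have h3 := hσ.2
  have h4 := hτ.2
  rw [coneDim, coneSpan] at h3 h4
  omega

lemma IsFan.divisor_isFan (hS : S.IsFan) (h : (S.divisor φ).cones.Nonempty) :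
    (S.divisor φ).IsFan where
  finite := hS.finite.subset hS.divisor_cones_subset
  nonempty := h
  rational σ hσ := hS.rational σ (hS.divisor_cones_subset hσ)
  face_mem := fun _ ⟨τ, hτ, h, hρ⟩ _ hρ' => ⟨τ, hτ, h, hρ'.trans hρ⟩
  inter_face σ hσ σ' hσ' :=
    hS.inter_face σ (hS.divisor_cones_subset hσ) σ' (hS.divisor_cones_subset hσ')

lemma mem_divisor_topCones (hτ : τ ∈ S.walls) (h : S.ord φ τ ≠ 0) :
    τ ∈ (S.divisor φ).topCones :=
  ⟨⟨τ, hτ, h, .refl τ⟩, by have := hτ.2; change _ = S.dim - 1; omega⟩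

lemma divisor_isPure : (S.divisor φ).IsPure := fun _ ⟨τ, hτ, h, hρ⟩ =>
  ⟨τ, mem_divisor_topCones hτ h, hρ⟩

lemma IsFan.divisor_topCones (hL : IsLattice L) (hS : S.IsFan) (hτ : τ ∈ (S.divisor φ).topCones) :
    τ ∈ S.walls ∧ S.ord φ τ ≠ 0 := by
  obtain ⟨⟨τ', hτ', h, hρ⟩, hd⟩ := hτ
  change _ = S.dim - 1 at hd
  have h1 := hτ'.2
  rw [(hS.rational τ' hτ'.1).eq_of_isFaceOf hL hρ (by omega)]
  exact ⟨hτ', h⟩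

lemma IsTropical.ord_eq_one (hS : S.IsTropical) (hφ : S.IsPiecewiseLinear φ)
    (hred : (S.divisor φ).IsReduced) (hτ : τ ∈ S.walls) (h : S.ord φ τ ≠ 0) : S.ord φ τ = 1 := by
  obtain ⟨k, hk⟩ := hS.exists_int_ord hφ hτ
  have h1 : ⌊S.ord φ τ⌋ = 1 := hred τ (mem_divisor_topCones hτ h)
  rw [hk, Int.floor_intCast] at h1
  rw [hk, h1, Int.cast_one]

lemma IsTropical.exists_plw (hS : S.IsTropical) (hφ : S.IsPiecewiseLinear φ) :
    ∃ A B, Arr L A ∧ Adapted A S ∧ PLw L A B S.support φ := by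
  obtain ⟨A, hA, hAS⟩ := hS.isFan.exists_adapted hS.lattice
  have h : ∀ σ ∈ S.cones, ∃ ℓ : E →ₗ[ℝ] ℝ, IntegralOn L ℓ ∧ ∀ x ∈ σ, φ x = ℓ x := fun σ hσ => by
    obtain ⟨ℓ, h1, h2⟩ := hφ σ hσ
    -- The linear function is integral only on the lattice of the cone; an integral projection onto
    -- the span of the cone makes it integral on `L`.
    obtain ⟨P, hP, hP', hPL⟩ := hS.lattice.exists_projection (hS.isFan.rational σ hσ).isRational
    refine ⟨ℓ ∘ₗ P, fun x hx => h1 _ ⟨hPL x hx, hP x⟩, fun x hx => ?_⟩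
    rw [LinearMap.comp_apply, hP' x (mem_coneSpan hx), h2 x hx]
  choose! ℓ h1 h2 using h
  have hB : Arr L (ℓ '' S.cones) := by
    refine ⟨hS.isFan.finite.image ℓ, ?_⟩
    rintro _ ⟨σ, hσ, rfl⟩
    exact h1 σ hσ
  have hC : Arr L (Set.image2 (fun a b => a - b) (ℓ '' S.cones) (ℓ '' S.cones)) := by
    refine ⟨hB.finite.image2 _ hB.finite, ?_⟩
    rintro _ ⟨a, ha, b, hb, rfl⟩
    exact (hB.integral a ha).sub (hB.integral b hb)
  have hAS' := hAS.mono (Set.subset_union_left (t :=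
    Set.image2 (fun a b => a - b) (ℓ '' S.cones) (ℓ '' S.cones)))
  refine ⟨_, _, hA.union hC, hAS', hB, fun a ha b hb => .inr ⟨a, ha, b, hb, rfl⟩, ?_⟩
  rintro x ⟨σ, hσ, hx⟩
  exact ⟨ℓ σ, ⟨σ, hσ, rfl⟩, fun y hy => h2 σ hσ y (hAS'.cellular_cone hσ x hx y hy)⟩

lemma Adapted.divisor {A : Set (E →ₗ[ℝ] ℝ)} (h : Adapted A S) (hS : S.IsFan) :
    Adapted A (S.divisor φ) := fun σ hσ => h σ (hS.divisor_cones_subset hσ)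

/-- The balancing condition for a modification along a reduced divisor. -/
lemma IsTropical.balanced_modification (hS : S.IsTropical) (hred : S.IsReduced)
    (hφ : S.IsPiecewiseLinear φ) (hdiv : (S.divisor φ).IsReduced) {A : Set (E →ₗ[ℝ] ℝ)}
    (hA : Arr L A) (hAS : Adapted A S) (hx : x ∈ S.support)
    (hd : Module.finrank ℝ (Lin A x) + 1 = S.dim) :
    ∃ N, NormalSystem L (Lin A x) (Loc S.support x) N ∧ ∑ n ∈ N, n ∈ Lin A x ∧
      ∑ n ∈ N, dir φ x n + (open Classical in if x ∈ (S.divisor φ).support then 1 else 0) =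
        dir φ x (∑ n ∈ N, n) := by
  have hL := hS.lattice
  have := hL.finiteDimensional
  obtain ⟨ρ, hρ, hxρ⟩ := hS.isFan.exists_carrier hL hx
  have hle := hAS.lin_le hA.finite hρ hxρ.1
  have h1 := Submodule.finrank_mono hle
  have h2 := IsFan.coneDim_le hL hS.pure hρ
  rcases (show coneDim ρ + 1 = S.dim ∨ coneDim ρ = S.dim by rw [coneDim] at h2 ⊢; omega)
    with h3 | h3
  · have h4 : Lin A x = coneSpan ρ :=
      Submodule.eq_of_le_of_finrank_le hle (by rw [coneDim] at h3; omega)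
    obtain ⟨N, hN, hsum, hord⟩ := hS.ord_eq hred hφ ⟨hρ, h3⟩ hxρ
    refine ⟨N, by rwa [h4], by rwa [h4], ?_⟩
    simp only [hS.isFan.mem_divisor_support hL ⟨hρ, h3⟩ hxρ]
    split_ifs with h5
    · rw [hS.ord_eq_one hφ hdiv ⟨hρ, h3⟩ h5] at hord
      linarith
    · rw [not_not] at h5
      linarith
  -- Here `x` is interior to a top-dimensional cone: the derivative is linear on the local cone and
  -- `x` is not in the divisor, so the equality is additivity.
  · obtain ⟨N, hN, hsum⟩ := (hS.tropA hred hA hAS).balanced x hx hd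
    refine ⟨N, hN, hsum, ?_⟩
    have hloc := hS.isFan.loc_eq_coneSpan hL hS.pure ⟨hρ, h3⟩ hxρ
    have hdir : ∀ v ∈ coneSpan ρ, dir φ x v = linearPart φ ρ v := fun v hv =>
      hφ.dir_eq_linearPart hρ hxρ.1 ((hS.isFan.rational ρ hρ).ev_mem hL hxρ hv)
    have hNρ : ∀ n ∈ N, n ∈ coneSpan ρ := fun n hn => by
      rw [← SetLike.mem_coe, ← hloc]; exact (hN.mem_iff n).2 ⟨n, hn, 1, by simp⟩
    rw [if_neg (hS.isFan.notMem_divisor_support hL ⟨hρ, h3⟩ hxρ), hdir _ (hle hsum), map_sum,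
      add_zero]
    exact Finset.sum_congr rfl fun n hn => hdir n (hNρ n hn)

end PiecewiseLinear

end WeightedFan

end Trop

namespace Trop

open Filter Topology

/-! ### Graphs of linear functions over cones, and the cones above them -/

section GraphCones

variable {E : Type*} [AddCommGroup E] [Module ℝ E] {L : AddSubgroup E} {ℓ : E →ₗ[ℝ] ℝ}
  {σ : PointedCone ℝ E}

/-- The graph of a linear function over a cone. -/
noncomputable def graphCone (ℓ : E →ₗ[ℝ] ℝ) (σ : PointedCone ℝ E) : PointedCone ℝ (E × ℝ) :=
  σ.map (LinearMap.id.prod ℓ)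

/-- The points on or above the graph of a linear function over a cone. -/
noncomputable def upperCone (ℓ : E →ₗ[ℝ] ℝ) (σ : PointedCone ℝ E) : PointedCone ℝ (E × ℝ) :=
  graphCone ℓ σ ⊔ PointedCone.hull ℝ {((0 : E), (1 : ℝ))}

lemma mem_graphCone {p : E × ℝ} : p ∈ graphCone ℓ σ ↔ p.1 ∈ σ ∧ p.2 = ℓ p.1 := by
  rw [graphCone, PointedCone.mem_map]
  constructor
  · rintro ⟨x, hx, rfl⟩; exact ⟨hx, rfl⟩
  · exact fun h => ⟨p.1, h.1, Prod.ext rfl h.2.symm⟩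

lemma mem_upperCone {p : E × ℝ} : p ∈ upperCone ℓ σ ↔ p.1 ∈ σ ∧ ℓ p.1 ≤ p.2 := by
  rw [upperCone, Submodule.mem_sup]
  constructor
  · rintro ⟨y, hy, z, hz, rfl⟩
    obtain ⟨t, rfl⟩ := Submodule.mem_span_singleton.1 hz
    rw [mem_graphCone] at hy
    have h3 : (0 : ℝ) ≤ t • (1 : ℝ) := mul_nonneg t.2 zero_le_one
    exact ⟨by simpa using hy.1, by simpa [hy.2] using h3⟩
  · rintro ⟨h1, h2⟩
    refine ⟨(p.1, ℓ p.1), mem_graphCone.2 ⟨h1, rfl⟩, (0, p.2 - ℓ p.1),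
      Submodule.mem_span_singleton.2 ⟨⟨p.2 - ℓ p.1, sub_nonneg.2 h2⟩, ?_⟩, by simp⟩
    ext
    · simp
    · exact mul_one _

lemma graphCone_eq_hull {s : Set E} :
    graphCone ℓ (PointedCone.hull ℝ s) = PointedCone.hull ℝ ((fun x => (x, ℓ x)) '' s) :=
  Submodule.map_span _ s

lemma mem_prod_int {E : Type*} [AddCommGroup E] {L : AddSubgroup E} {x : E} (hx : x ∈ L) {c : ℝ} (hc : ∃ k : ℤ, c = k) :
    (x, c) ∈ L.prod (AddSubgroup.zmultiples (1 : ℝ)) := by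
  obtain ⟨k, rfl⟩ := hc
  exact ⟨hx, AddSubgroup.mem_zmultiples_iff.2 ⟨k, by simp⟩⟩

lemma IsRationalCone.graphCone (hσ : IsRationalCone L σ)
    (hℓ : ∀ x ∈ coneLattice L σ, ∃ k : ℤ, ℓ x = k) :
    IsRationalCone (L.prod (AddSubgroup.zmultiples (1 : ℝ))) (graphCone ℓ σ) := by
  obtain ⟨s, hs, hsL, rfl⟩ := hσ.generated
  refine ⟨⟨_, hs.image _, ?_, graphCone_eq_hull⟩, fun x hx hx' => ?_⟩
  · rintro _ ⟨x, hx, rfl⟩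
    exact mem_prod_int (hsL hx) (hℓ x ⟨hsL hx, mem_coneSpan (PointedCone.subset_hull hx)⟩)
  · rw [mem_graphCone] at hx hx'
    have := hσ.salient _ hx.1 hx'.1
    exact Prod.ext this (by rw [hx.2, this, map_zero]; rfl)

lemma IsRationalCone.upperCone (hσ : IsRationalCone L σ)
    (hℓ : ∀ x ∈ coneLattice L σ, ∃ k : ℤ, ℓ x = k) :
    IsRationalCone (L.prod (AddSubgroup.zmultiples (1 : ℝ))) (upperCone ℓ σ) := by
  obtain ⟨s, hs, hsL, h⟩ := (hσ.graphCone hℓ).generated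
  refine ⟨⟨s ∪ {(0, 1)}, hs.union (Set.finite_singleton _), Set.union_subset hsL ?_, ?_⟩,
    fun x hx hx' => ?_⟩
  · rintro _ rfl
    exact mem_prod_int L.zero_mem ⟨1, by simp⟩
  · rw [Trop.upperCone, h]
    exact (Submodule.span_union _ _).symm
  · rw [mem_upperCone] at hx hx'
    have := hσ.salient _ hx.1 hx'.1
    have h1 := hx.2
    have h2 := hx'.2
    simp only [this, Prod.fst_neg, neg_zero, map_zero, Prod.snd_neg] at h1 h2
    exact Prod.ext this (by simp; linarith)

lemma coneDim_graphCone : coneDim (graphCone ℓ σ) = coneDim σ := by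
  have hinj : Function.Injective (LinearMap.id.prod ℓ) := fun u v huv => (Prod.ext_iff.1 huv).1
  have : coneSpan (graphCone ℓ σ) = (coneSpan σ).map (LinearMap.id.prod ℓ) := by
    rw [coneSpan, coneSpan, Submodule.map_span]; rfl
  rw [coneDim, this, coneDim]
  exact (Submodule.equivMapOfInjective _ hinj _).finrank_eq.symm

lemma coneDim_upperCone [FiniteDimensional ℝ E] : coneDim (upperCone ℓ σ) = coneDim σ + 1 := by
  have h1 : ((0 : E), (1 : ℝ)) ∈ coneSpan (upperCone ℓ σ) :=
    mem_coneSpan (mem_upperCone.2 (by simp))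
  have : coneSpan (upperCone ℓ σ) = (coneSpan σ).prod ⊤ := by
    refine le_antisymm (Submodule.span_le.2 fun p hp =>
      ⟨mem_coneSpan (mem_upperCone.1 hp).1, trivial⟩) ?_
    rintro ⟨v, s⟩ ⟨hv, -⟩
    have h2 : ∀ v ∈ coneSpan σ, (v, (0 : ℝ)) ∈ coneSpan (upperCone ℓ σ) := fun v hv => by
      have h3 : coneSpan σ ≤ (coneSpan (upperCone ℓ σ)).comap (LinearMap.inl ℝ E ℝ) := by
        refine Submodule.span_le.2 fun y hy => ?_
        have h4 : (y, ℓ y) ∈ coneSpan (upperCone ℓ σ) :=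
          mem_coneSpan (mem_upperCone.2 ⟨hy, le_rfl⟩)
        have := sub_mem h4 (Submodule.smul_mem _ (ℓ y) h1)
        simpa using this
      exact h3 hv
    have := add_mem (h2 v hv) (Submodule.smul_mem _ s h1)
    simpa using this
  rw [coneDim, this, finrank_submodule_prod, finrank_top, Module.finrank_self, coneDim]

end GraphCones

namespace WeightedFan

/-! ### The modification of a fan is a fan -/

section Modification

variable {E : Type*} [AddCommGroup E] [Module ℝ E] {L : AddSubgroup E} {S : WeightedFan L}
  {φ : E → ℝ} {σ τ : PointedCone ℝ E} {x v : E}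

lemma IsPiecewiseLinear.eq_graphCone (hφ : S.IsPiecewiseLinear φ) (hσ : σ ∈ S.cones)
    {c : PointedCone ℝ (E × ℝ)} (hc : (c : Set (E × ℝ)) = {p | p.1 ∈ σ ∧ p.2 = φ p.1}) :
    c = graphCone (linearPart φ σ) σ := by
  ext p
  rw [← SetLike.mem_coe, hc, mem_graphCone]
  exact and_congr_right fun h => by rw [hφ.linearPart_apply hσ h]

lemma IsPiecewiseLinear.eq_upperCone (hφ : S.IsPiecewiseLinear φ) (hσ : σ ∈ S.cones)
    {c : PointedCone ℝ (E × ℝ)} (hc : (c : Set (E × ℝ)) = {p | p.1 ∈ σ ∧ φ p.1 ≤ p.2}) :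
    c = upperCone (linearPart φ σ) σ := by
  ext p
  rw [← SetLike.mem_coe, hc, mem_upperCone]
  exact and_congr_right fun h => by rw [hφ.linearPart_apply hσ h]

lemma IsPiecewiseLinear.coe_graphCone (hφ : S.IsPiecewiseLinear φ) (hσ : σ ∈ S.cones) :
    (graphCone (linearPart φ σ) σ : Set (E × ℝ)) = {p | p.1 ∈ σ ∧ p.2 = φ p.1} := by
  ext p
  rw [SetLike.mem_coe, mem_graphCone]
  exact and_congr_right fun h => by rw [hφ.linearPart_apply hσ h]

lemma IsPiecewiseLinear.coe_upperCone (hφ : S.IsPiecewiseLinear φ) (hσ : σ ∈ S.cones) :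
    (upperCone (linearPart φ σ) σ : Set (E × ℝ)) = {p | p.1 ∈ σ ∧ φ p.1 ≤ p.2} := by
  ext p
  rw [SetLike.mem_coe, mem_upperCone]
  exact and_congr_right fun h => by rw [hφ.linearPart_apply hσ h]

lemma IsFan.mem_modification_cones (hS : S.IsFan) (hφ : S.IsPiecewiseLinear φ)
    {c : PointedCone ℝ (E × ℝ)} : c ∈ (S.modification φ).cones ↔
      (∃ σ ∈ S.cones, c = graphCone (linearPart φ σ) σ) ∨
        ∃ τ ∈ (S.divisor φ).cones, c = upperCone (linearPart φ τ) τ := by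
  refine or_congr (exists_congr fun σ => and_congr_right fun hσ => ⟨hφ.eq_graphCone hσ, ?_⟩)
    (exists_congr fun σ => and_congr_right fun hσ =>
      ⟨hφ.eq_upperCone (hS.divisor_cones_subset hσ), ?_⟩)
  · rintro rfl; exact hφ.coe_graphCone hσ
  · rintro rfl; exact hφ.coe_upperCone (hS.divisor_cones_subset hσ)

lemma IsFan.modification_support (hS : S.IsFan) (hφ : S.IsPiecewiseLinear φ) :
    (S.modification φ).support = modSet S.support φ (S.divisor φ).support := by
  ext p
  constructor
  · rintro ⟨c, ⟨σ, hσ, hc⟩ | ⟨σ, hσ, hc⟩, hp⟩ <;> rw [← SetLike.mem_coe, hc] at hp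
    · exact .inl ⟨⟨σ, hσ, hp.1⟩, hp.2⟩
    · exact .inr ⟨⟨σ, hσ, hp.1⟩, hp.2⟩
  · rintro (⟨⟨σ, hσ, h1⟩, h2⟩ | ⟨⟨σ, hσ, h1⟩, h2⟩)
    · refine ⟨_, .inl ⟨σ, hσ, hφ.coe_graphCone hσ⟩, ?_⟩
      rw [← SetLike.mem_coe, hφ.coe_graphCone hσ]; exact ⟨h1, h2⟩
    · have hσ' := hS.divisor_cones_subset hσ
      refine ⟨_, .inr ⟨σ, hσ, hφ.coe_upperCone hσ'⟩, ?_⟩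
      rw [← SetLike.mem_coe, hφ.coe_upperCone hσ']; exact ⟨h1, h2⟩

lemma IsFan.modification_isFan (hS : S.IsFan) (hφ : S.IsPiecewiseLinear φ) :
    (S.modification φ).IsFan := by
  have hsub := hS.divisor_cones_subset (φ := φ)
  have hmem : ∀ c ∈ (S.modification φ).cones, ∃ σ ∈ S.cones,
      (∀ p ∈ c, p.1 ∈ σ ∧ φ p.1 ≤ p.2) ∧ ∀ x ∈ σ, (x, φ x) ∈ c := by
    rintro c (⟨σ, hσ, hc⟩ | ⟨σ, hσ, hc⟩) <;> simp only [← SetLike.mem_coe, hc]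
    · exact ⟨σ, hσ, fun p hp => ⟨hp.1, hp.2.ge⟩, fun x hx => ⟨hx, rfl⟩⟩
    · exact ⟨σ, hsub hσ, fun p hp => hp, fun x hx => ⟨hx, le_rfl⟩⟩
  have hint : ∀ σ ∈ S.cones, ∀ x ∈ coneLattice L σ, ∃ k : ℤ, linearPart φ σ x = k :=
    fun σ hσ x hx => hφ.linearPart_integral hσ hx
  refine ⟨?_, ?_, ?_, ?_, ?_⟩
  · refine ((hS.finite.image fun σ => graphCone (linearPart φ σ) σ).union
      ((hS.finite.subset hsub).image fun σ => upperCone (linearPart φ σ) σ)).subset ?_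
    intro c hc
    rcases (hS.mem_modification_cones hφ).1 hc with ⟨σ, hσ, rfl⟩ | ⟨σ, hσ, rfl⟩
    · exact .inl ⟨σ, hσ, rfl⟩
    · exact .inr ⟨σ, hσ, rfl⟩
  · obtain ⟨σ, hσ⟩ := hS.nonempty
    exact ⟨_, .inl ⟨σ, hσ, hφ.coe_graphCone hσ⟩⟩
  · intro c hc
    rcases (hS.mem_modification_cones hφ).1 hc with ⟨σ, hσ, rfl⟩ | ⟨σ, hσ, rfl⟩
    · exact (hS.rational σ hσ).graphCone (hint σ hσ)
    · exact (hS.rational σ (hsub hσ)).upperCone (hint σ (hsub hσ))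
  · rintro c hc F hF
    -- The part of a face `F` that lies on the graph projects to a face of `σ`.
    have key : ∀ σ ∈ S.cones, (∀ x ∈ σ, (x, φ x) ∈ c) →
        ∃ ρ : PointedCone ℝ E, ρ.IsFaceOf σ ∧ ∀ x ∈ σ, x ∈ ρ ↔ (x, φ x) ∈ F := by
      intro σ hσ h
      have h0 : ∀ x ∈ σ, (LinearMap.id.prod (linearPart φ σ)) x = (x, φ x) := fun x hx => by
        simp [hφ.linearPart_apply hσ hx]
      refine ⟨σ ⊓ F.comap (LinearMap.id.prod (linearPart φ σ)), .of_mem_of_add_mem_left inf_le_left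
        fun {u v} hu hv huv => ⟨hu, ?_⟩, fun x hx => ⟨fun h => ?_, fun h => ⟨hx, ?_⟩⟩⟩
      · have : LinearMap.id.prod (linearPart φ σ) (u + v) ∈ F := huv.2
        rw [map_add, h0 u hu, h0 v hv] at this
        change LinearMap.id.prod (linearPart φ σ) u ∈ F
        rw [h0 u hu]
        exact hF.mem_of_add_mem_left (h u hu) (h v hv) this
      · rw [← h0 x hx]
        exact h.2
      · change LinearMap.id.prod (linearPart φ σ) x ∈ F
        rwa [h0 x hx]
    rcases hc with ⟨σ, hσ, hc⟩ | ⟨σ, hσ, hc⟩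
    · have hmem : ∀ p, p ∈ c ↔ p.1 ∈ σ ∧ p.2 = φ p.1 := fun p => by
        rw [← SetLike.mem_coe, hc]; rfl
      obtain ⟨ρ, hρ, H⟩ := key σ hσ fun x hx => (hmem _).2 ⟨hx, rfl⟩
      refine .inl ⟨ρ, hS.face_mem σ hσ ρ hρ, ?_⟩
      ext ⟨y, s⟩
      refine ⟨fun h => ?_, ?_⟩
      · obtain ⟨h1, h2⟩ := (hmem _).1 (hF.le h)
        obtain rfl : s = φ y := h2
        exact ⟨(H y h1).2 h, rfl⟩
      · rintro ⟨h1, h2⟩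
        obtain rfl : s = φ y := h2
        exact (H y (hρ.le h1)).1 h1
    · have hmem : ∀ p, p ∈ c ↔ p.1 ∈ σ ∧ φ p.1 ≤ p.2 := fun p => by
        rw [← SetLike.mem_coe, hc]; rfl
      have hφ0 : φ 0 = 0 := by rw [← hφ.linearPart_apply (hsub hσ) (zero_mem σ), map_zero]
      have hvert : ∀ s : ℝ, 0 ≤ s → ((0 : E), s) ∈ c := fun s hs =>
        (hmem _).2 ⟨zero_mem σ, by simpa [hφ0] using hs⟩
      obtain ⟨ρ, hρ, H⟩ := key σ (hsub hσ) fun x hx => (hmem _).2 ⟨hx, le_rfl⟩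
      -- A point splits into its shadow on the graph and a vertical vector. Both lie in the cone, so
      -- both lie in the face `F`.
      have hdecomp : ∀ y s, (y, s) ∈ F → (y, φ y) ∈ F ∧ ((0 : E), s - φ y) ∈ F := fun y s h => by
        have h1 := (hmem _).1 (hF.le h)
        have h2 : (y, s) = (y, φ y) + (0, s - φ y) := by simp
        rw [h2] at h
        have h3 := (hmem (y, φ y)).2 ⟨h1.1, le_rfl⟩
        have h4 := hvert (s - φ y) (sub_nonneg.2 h1.2)
        exact ⟨hF.mem_of_add_mem_left h3 h4 h, hF.mem_of_add_mem_right h3 h4 h⟩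
      have hρ' : ∀ y s, (y, s) ∈ F → y ∈ ρ := fun y s h =>
        (H y ((hmem _).1 (hF.le h)).1).2 (hdecomp y s h).1
      -- A face that contains the vertical ray is everything above the graph over its projection;
      -- otherwise its points have no vertical part and it is a graph.
      by_cases h01 : ((0 : E), (1 : ℝ)) ∈ F
      · refine .inr ⟨ρ, ?_, ?_⟩
        · obtain ⟨τ, hτ, h, hface⟩ := hσ
          exact ⟨τ, hτ, h, hρ.trans hface⟩
        · ext ⟨y, s⟩
          refine ⟨fun h => ⟨hρ' y s h, ((hmem _).1 (hF.le h)).2⟩, fun ⟨h1, h2⟩ => ?_⟩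
          have := add_mem ((H y (hρ.le h1)).1 h1) (F.smul_mem (sub_nonneg.2 h2) h01)
          simpa using this
      · refine .inl ⟨ρ, hS.face_mem σ (hsub hσ) ρ hρ, ?_⟩
        ext ⟨y, s⟩
        refine ⟨fun h => ⟨hρ' y s h, ?_⟩, ?_⟩
        · by_contra hne
          have h1 := ((hmem _).1 (hF.le h)).2
          have h2 : 0 < s - φ y := sub_pos.2 (lt_of_le_of_ne h1 (Ne.symm hne))
          have h3 := F.smul_mem (inv_nonneg.2 h2.le) (hdecomp y s h).2
          rw [Prod.smul_mk, smul_zero, smul_eq_mul, inv_mul_cancel₀ h2.ne'] at h3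
          exact h01 h3
        · rintro ⟨h1, h2⟩
          obtain rfl : s = φ y := h2
          exact (H y (hρ.le h1)).1 h1
  · intro c hc c' hc'
    refine .of_mem_of_add_mem_left inf_le_left fun {u v} hu hv huv => ⟨hu, ?_⟩
    obtain ⟨σ, hσ, h1, -⟩ := hmem c hc
    have hadd := hφ.map_add hσ (h1 u hu).1 (h1 v hv).1
    have hface : ∀ σ' ∈ S.cones, (u + v).1 ∈ σ' → u.1 ∈ σ' := fun σ' hσ' h =>
      ((hS.inter_face σ hσ σ' hσ').mem_of_add_mem_left (h1 u hu).1 (h1 v hv).1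
        ⟨add_mem (h1 u hu).1 (h1 v hv).1, h⟩).2
    have huv' : u + v ∈ c' := huv.2
    change u ∈ c'
    rcases hc' with ⟨σ', hσ', h⟩ | ⟨σ', hσ', h⟩ <;> rw [← SetLike.mem_coe, h] at huv' ⊢
    · refine ⟨hface σ' hσ' huv'.1, ?_⟩
      have h2 := huv'.2
      rw [Prod.fst_add, Prod.snd_add, hadd] at h2
      linarith [(h1 u hu).2, (h1 v hv).2]
    · exact ⟨hface σ' (hsub hσ') huv'.1, (h1 u hu).2⟩

lemma IsPure.modification (hL : IsLattice L) (hpure : S.IsPure)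
    (hφ : S.IsPiecewiseLinear φ) : (S.modification φ).IsPure := by
  have := hL.finiteDimensional
  rintro c (⟨σ, hσ, hc⟩ | ⟨σ, ⟨τ, hτ, hord, hface⟩, hc⟩)
  · obtain ⟨σ', hσ', hface⟩ := hpure σ hσ
    have hc' := hφ.coe_graphCone hσ'.1
    refine ⟨_, ⟨.inl ⟨σ', hσ'.1, hc'⟩, by rw [coneDim_graphCone]; exact hσ'.2⟩, ?_⟩
    refine .of_mem_of_add_mem_left (SetLike.coe_subset_coe.1 ?_) fun {u v} hu hv huv => ?_
    · rw [hc, hc']; exact fun p hp => ⟨hface.le hp.1, hp.2⟩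
    · rw [← SetLike.mem_coe, hc'] at hu hv
      rw [← SetLike.mem_coe, hc] at huv ⊢
      exact ⟨hface.mem_of_add_mem_left hu.1 hv.1 huv.1, hu.2⟩
  · have hc' := hφ.coe_upperCone hτ.1
    refine ⟨_, ⟨.inr ⟨τ, ⟨τ, hτ, hord, .refl τ⟩, hc'⟩, by rw [coneDim_upperCone]; exact hτ.2⟩, ?_⟩
    refine .of_mem_of_add_mem_left (SetLike.coe_subset_coe.1 ?_) fun {u v} hu hv huv => ?_
    · rw [hc, hc']; exact fun p hp => ⟨hface.le hp.1, hp.2⟩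
    · rw [← SetLike.mem_coe, hc'] at hu hv
      rw [← SetLike.mem_coe, hc] at huv ⊢
      exact ⟨hface.mem_of_add_mem_left hu.1 hv.1 huv.1, hu.2⟩

lemma IsFan.modification_isReduced (hL : IsLattice L) (hS : S.IsFan) (hred : S.IsReduced)
    (hφ : S.IsPiecewiseLinear φ) (hdiv : (S.divisor φ).IsReduced) :
    (S.modification φ).IsReduced := by
  have := hL.finiteDimensional
  rintro c ⟨hc, hd⟩
  change coneDim c = S.dim at hd
  simp only [modification]
  rcases (hS.mem_modification_cones hφ).1 hc with ⟨σ, hσ, rfl⟩ | ⟨σ, hσ, rfl⟩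
  · rw [coneDim_graphCone] at hd
    rw [if_neg (by simp [mem_graphCone])]
    have : (graphCone (linearPart φ σ) σ).map (LinearMap.fst ℝ E ℝ) = σ := by
      rw [graphCone, PointedCone.map_map, LinearMap.fst_prod, PointedCone.map_id]
    rw [this]
    exact hred σ ⟨hσ, hd⟩
  · rw [coneDim_upperCone] at hd
    rw [if_pos (mem_upperCone.2 (by simp))]
    have : (upperCone (linearPart φ σ) σ).map (LinearMap.fst ℝ E ℝ) = σ := by
      ext y
      rw [PointedCone.mem_map]
      constructor
      · rintro ⟨p, hp, rfl⟩; exact (mem_upperCone.1 hp).1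
      · exact fun h => ⟨(y, linearPart φ σ y), mem_upperCone.2 ⟨h, le_rfl⟩, rfl⟩
    rw [this]
    exact hdiv σ ⟨hσ, by change _ = S.dim - 1; omega⟩

lemma IsFan.modification_isTropical (hL : IsLattice L) (hS : S.IsFan) (hpure : S.IsPure)
    (hred : S.IsReduced) (hφ : S.IsPiecewiseLinear φ) (hdiv : (S.divisor φ).IsReduced)
    (h : TropSet (L.prod (AddSubgroup.zmultiples (1 : ℝ))) S.dim
      (modSet S.support φ (S.divisor φ).support)) : (S.modification φ).IsTropical :=
  (hS.modification_isFan hφ).isTropical (hL.prod isLattice_int)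
    (hpure.modification hL hφ) (hS.modification_isReduced hL hred hφ hdiv)
    (by rw [hS.modification_support hφ]; exact h)

end Modification

end WeightedFan

end Trop

namespace Trop

open Filter Topology WeightedFan

/-! ### From modified sets back to modified fans, and the induction principle -/

section Construction

variable {E : Type u} [AddCommGroup E] [Module ℝ E] {L : AddSubgroup E}
  {A B : Set (E →ₗ[ℝ] ℝ)} {X D : Set E} {φ : E → ℝ} {d d' : ℕ}

/-- A tropical modification of a quasilinear set along a quasilinear divisor is quasilinear. -/
theorem QLs.modSet (hX : QLs L X) (hD : QLs L D) (hXA : TropA L d A X) (hDA : TropA L d' A D)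
    (hDX : D ⊆ X) (hd : d' + 1 = d) (h : PLw L A B X φ)
    (hM : TropSet (L.prod (AddSubgroup.zmultiples (1 : ℝ))) d (modSet X φ D)) :
    QLs (L.prod (AddSubgroup.zmultiples (1 : ℝ))) (modSet X φ D) := by
  have hL := hX.isLattice
  obtain ⟨C, hAC, hXC, hT, hTF, hTs⟩ := exists_fan_of_tropA hL hXA hX.nonempty
  have hDC := hDA.mono hL hXC.arr hAC
  have h' := h.mono hAC
  have hfin := hXC.arr.finite
  set T := arrFan L d C X with hTdef
  have hφ : T.IsPiecewiseLinear φ := by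
    rintro _ ⟨x, hx, rfl⟩
    obtain ⟨ℓ, hℓ, H⟩ := h'.linear x hx
    exact ⟨ℓ, fun y hy => h.arr.integral ℓ hℓ y hy.1, fun y hy => H y hy⟩
  -- Since the modified set is balanced, the order is one on walls contained in `D` and zero on all
  -- other walls. So the divisor of `φ` on the fan of cells is reduced with support `D`.
  have hord : ∀ x ∈ X, cell C x ∈ T.walls → T.ord φ (cell C x) =
      open Classical in if x ∈ D then 1 else 0 := by
    intro x hx hw
    obtain ⟨N, hN, -, hN'⟩ := hT.ord_eq arrFan_isReduced hφ hw
      ((inRelInterior_cell_iff hfin).2 ⟨InCell.refl C x, InCell.refl C x⟩)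
    rw [coneSpan_cell hfin, hTs] at hN
    have hd' := hw.2
    rw [coneDim_cell hfin] at hd'
    rw [hN', ← h'.sum_dir_eq hL hXC hDC hDX (fun _ => hd) hM hx hd' hN]
    ring
  have hwall : ∀ x ∈ D, Module.finrank ℝ (Lin C x) = d' →
      cell C x ∈ T.walls ∧ T.ord φ (cell C x) = 1 := fun x hx hdim => by
    have hw : cell C x ∈ T.walls := ⟨⟨x, hDX hx, rfl⟩, by rw [coneDim_cell hfin, hdim]; exact hd⟩
    exact ⟨hw, by rw [hord x (hDX hx) hw, if_pos hx]⟩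
  have hdivs : (T.divisor φ).support = D := by
    ext y
    constructor
    · rintro ⟨ρ, ⟨τ, hτ, hne, hρ⟩, hy⟩
      obtain ⟨x, hx, rfl⟩ := hτ.1
      rw [hord x hx hτ] at hne
      exact hDC.cellular x (by by_contra h; simp [h] at hne) y (hρ.le hy)
    · intro hy
      obtain ⟨x, hx, hxy, hdim⟩ := hDC.pure y hy
      obtain ⟨h1, h2⟩ := hwall x hx hdim
      exact ⟨cell C x, ⟨_, h1, by rw [h2]; exact one_ne_zero, .refl _⟩, hxy⟩
  have hdivred : (T.divisor φ).IsReduced := fun τ hτ => by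
    obtain ⟨h1, h2⟩ := hTF.divisor_topCones hL hτ
    obtain ⟨x, hx, rfl⟩ := h1.1
    change ⌊T.ord φ _⌋ = 1
    rw [hord x hx h1] at h2 ⊢
    have : x ∈ D := by by_contra h; simp [h] at h2
    simp [this]
  have hdivdim : (T.divisor φ).dim = d' := by change d - 1 = d'; omega
  have hdivF : (T.divisor φ).IsFan := hTF.divisor_isFan <| by
    obtain ⟨y, hy⟩ := hD.nonempty
    rw [← hdivs] at hy
    obtain ⟨ρ, hρ, -⟩ := hy
    exact ⟨ρ, hρ⟩
  have hdivT : (T.divisor φ).IsTropical := hdivF.isTropical hL divisor_isPure hdivred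
    (by rw [hdivs, hdivdim]; exact ⟨C, hDC⟩)
  have hmod := hTF.modification_isTropical hL hT.pure arrFan_isReduced hφ hdivred
    (by rw [hTs, hdivs]; exact hM)
  have hmodred := hTF.modification_isReduced hL arrFan_isReduced hφ hdivred
  have hmods : (T.modification φ).support = Trop.modSet X φ D := by
    rw [hTF.modification_support hφ, hTs, hdivs]
  refine ⟨T.modification φ, .modification _ T φ hmod hmodred
    (QLs.isQuasilinear (by rwa [hTs]) hT arrFan_isReduced) hφ
    (QLs.isQuasilinear (by rwa [hdivs]) hdivT hdivred)
    (cycleIso_of_setIso hmod hmodred hmod hmodred (SetIso.refl _ _)), hmods⟩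

end Construction

/-- Induction on quasilinear sets. -/
theorem QLs.induction
    {P : ∀ {E : Type u} [AddCommGroup E] [Module ℝ E], AddSubgroup E → Set E → Prop}
    (univ : ∀ {E : Type u} [AddCommGroup E] [Module ℝ E] {L : AddSubgroup E}, IsLattice L →
      P L (Set.univ : Set E))
    (iso : ∀ {E E' : Type u} [AddCommGroup E] [Module ℝ E] [AddCommGroup E'] [Module ℝ E']
      {L : AddSubgroup E} {L' : AddSubgroup E'} {X : Set E} {X' : Set E'} {f : E →ₗ[ℝ] E'}
      {g : E' →ₗ[ℝ] E}, IsLattice L → QLs L' X' → SetIso L X L' X' f g → P L' X' → P L X)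
    (mod : ∀ {E : Type u} [AddCommGroup E] [Module ℝ E] {L : AddSubgroup E}
      {A B : Set (E →ₗ[ℝ] ℝ)} {X D : Set E} {φ : E → ℝ} {d d' : ℕ}, QLs L X → QLs L D →
      TropA L d A X → TropA L d' A D → D ⊆ X → d' + 1 = d → PLw L A B X φ →
      TropSet (L.prod (AddSubgroup.zmultiples (1 : ℝ))) d (Trop.modSet X φ D) → P L X → P L D →
      P (L.prod (AddSubgroup.zmultiples (1 : ℝ))) (Trop.modSet X φ D))
    {E : Type u} [AddCommGroup E] [Module ℝ E] {L : AddSubgroup E} {X : Set E} (h : QLs L X) :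
    P L X := by
  obtain ⟨S, hS, rfl⟩ := h
  induction hS with
  | complete S T hS hred hT hc hiso =>
    obtain ⟨-, -, f, g, h⟩ := hiso.exists_setIso hred
    rw [show T.support = Set.univ from hc] at h
    exact iso hS.lattice (qls_univ hT.lattice) h (univ hT.lattice)
  | modification S T φ hS hred hT hφ hdiv hiso ih ih' =>
    obtain ⟨h1, h2, f, g, h⟩ := hiso.exists_setIso hred
    have hTt := hT.isTropical
    have hDt := hdiv.isTropical
    obtain ⟨A, B, hA, hAT, hB⟩ := hTt.exists_plw hφ
    have hs := hTt.isFan.modification_support hφ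
    have hM := h1.tropSet h2
    have hd : (T.divisor φ).dim + 1 = T.dim := by
      obtain ⟨ρ, τ, hτ, -⟩ := hDt.isFan.nonempty
      have := hτ.2
      change T.dim - 1 + 1 = T.dim
      omega
    have hTA := hTt.tropA hT.isReduced hA hAT
    have hDA := hDt.tropA hdiv.isReduced hA (hAT.divisor hTt.isFan)
    rw [hs] at h hM
    have hqT : QLs _ T.support := ⟨T, hT, rfl⟩
    have hqD : QLs _ (T.divisor φ).support := ⟨_, hdiv, rfl⟩
    have hsub := hTt.isFan.divisor_support_subset (φ := φ)
    exact iso hS.lattice (hqT.modSet hqD hTA hDA hsub hd hB hM) h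
      (mod hqT hqD hTA hDA hsub hd hB hM ih ih')

end Trop

namespace Trop

open Filter Topology

/-! ### Standard isomorphisms, and pullback of piecewise linear functions -/

section Isos

variable {E E' F : Type*} [AddCommGroup E] [Module ℝ E] [AddCommGroup E'] [Module ℝ E']
  [AddCommGroup F] [Module ℝ F] {L : AddSubgroup E} {L' : AddSubgroup E'} {Λ : AddSubgroup F}
  {X D : Set E} {X' : Set E'} {f : E →ₗ[ℝ] E'} {g : E' →ₗ[ℝ] E} {φ : E → ℝ}

lemma SetIso.prod_univ (h : SetIso L X L' X' f g) (Λ : AddSubgroup F) :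
    SetIso (L.prod Λ) (X ×ˢ Set.univ) (L'.prod Λ) (X' ×ˢ Set.univ) (f.prodMap LinearMap.id)
      (g.prodMap LinearMap.id) where
  lattice _ hx := ⟨h.lattice _ hx.1, hx.2⟩
  inv_lattice _ hx := ⟨h.inv_lattice _ hx.1, hx.2⟩
  map _ hx := ⟨h.map _ hx.1, trivial⟩
  inv_map _ hx := ⟨h.inv_map _ hx.1, trivial⟩
  left_inv _ hx := Prod.ext (h.left_inv _ hx.1) rfl
  right_inv _ hx := Prod.ext (h.right_inv _ hx.1) rfl

/-- Modifications commute with products. -/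
lemma setIso_modSet_prod (L : AddSubgroup E) (Λ : AddSubgroup F) (M : AddSubgroup ℝ) (X D : Set E)
    (φ : E → ℝ) :
    SetIso ((L.prod M).prod Λ) (modSet X φ D ×ˢ (Set.univ : Set F)) ((L.prod Λ).prod M)
      (modSet (X ×ˢ Set.univ) (fun p => φ p.1) (D ×ˢ Set.univ))
      (((LinearMap.fst ℝ E ℝ ∘ₗ LinearMap.fst ℝ (E × ℝ) F).prod (LinearMap.snd ℝ (E × ℝ) F)).prod
        (LinearMap.snd ℝ E ℝ ∘ₗ LinearMap.fst ℝ (E × ℝ) F))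
      (((LinearMap.fst ℝ E F ∘ₗ LinearMap.fst ℝ (E × F) ℝ).prod (LinearMap.snd ℝ (E × F) ℝ)).prod
        (LinearMap.snd ℝ E F ∘ₗ LinearMap.fst ℝ (E × F) ℝ)) where
  lattice _ hx := ⟨⟨hx.1.1, hx.2⟩, hx.1.2⟩
  inv_lattice _ hx := ⟨⟨hx.1.1, hx.2⟩, hx.1.2⟩
  map _ hx := hx.1.imp (fun h => ⟨⟨h.1, trivial⟩, h.2⟩) fun h => ⟨⟨h.1, trivial⟩, h.2⟩
  inv_map _ hx := ⟨hx.imp (fun h => ⟨h.1.1, h.2⟩) fun h => ⟨h.1.1, h.2⟩, trivial⟩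
  left_inv _ _ := rfl
  right_inv _ _ := rfl

lemma setIso_prod_assoc {G : Type*} [AddCommGroup G] [Module ℝ G] (L : AddSubgroup E)
    (Λ : AddSubgroup F) (M : AddSubgroup G) (X : Set E) :
    SetIso ((L.prod Λ).prod M) ((X ×ˢ (Set.univ : Set F)) ×ˢ (Set.univ : Set G))
      (L.prod (Λ.prod M)) (X ×ˢ Set.univ) (LinearEquiv.prodAssoc ℝ E F G).toLinearMap
      (LinearEquiv.prodAssoc ℝ E F G).symm.toLinearMap where
  lattice _ hx := ⟨hx.1.1, hx.1.2, hx.2⟩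
  inv_lattice _ hx := ⟨⟨hx.1, hx.2.1⟩, hx.2.2⟩
  map _ hx := ⟨hx.1.1, trivial⟩
  inv_map _ hx := ⟨⟨hx.1, trivial⟩, trivial⟩
  left_inv _ _ := rfl
  right_inv _ _ := rfl

/-- Graphs of linear functions. -/
lemma setIso_graph {ℓ : E →ₗ[ℝ] ℝ} (hℓ : IntegralOn L ℓ) (h : ∀ x ∈ X, φ x = ℓ x) :
    SetIso (L.prod (AddSubgroup.zmultiples (1 : ℝ))) (modSet X φ ∅) L X (LinearMap.fst ℝ E ℝ)
      (LinearMap.id.prod ℓ) where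
  lattice _ hx := hx.1
  inv_lattice _ hx := mem_prod_int hx (hℓ _ hx)
  map _ hx := hx.elim And.left fun h => h.1.elim
  inv_map _ hx := .inl ⟨hx, (h _ hx).symm⟩
  left_inv := by
    rintro ⟨x, t⟩ (⟨h1, h2⟩ | h1)
    · exact Prod.ext rfl ((h x h1).symm.trans h2.symm)
    · exact h1.1.elim
  right_inv _ _ := rfl

lemma SetIso.graph (h : SetIso L X L' X' f g) (φ : E → ℝ) (M : AddSubgroup ℝ) :
    SetIso (L'.prod M) (modSet X' (φ ∘ g) ∅) (L.prod M) (modSet X φ ∅) (g.prodMap LinearMap.id)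
      (f.prodMap LinearMap.id) where
  lattice x hx := ⟨h.inv_lattice _ hx.1, hx.2⟩
  inv_lattice x hx := ⟨h.lattice _ hx.1, hx.2⟩
  map := by
    rintro ⟨x, t⟩ (⟨h1, h2⟩ | h1)
    exacts [.inl ⟨h.inv_map x h1, h2⟩, h1.1.elim]
  inv_map := by
    rintro ⟨x, t⟩ (⟨h1, h2⟩ | h1)
    · refine .inl ⟨h.map x h1, ?_⟩
      change t = φ (g (f x))
      rw [h.left_inv x h1]; exact h2
    · exact h1.1.elim
  left_inv := by
    rintro ⟨x, t⟩ (⟨h1, h2⟩ | h1)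
    exacts [Prod.ext (h.right_inv x h1) rfl, h1.1.elim]
  right_inv := by
    rintro ⟨x, t⟩ (⟨h1, h2⟩ | h1)
    exacts [Prod.ext (h.left_inv x h1) rfl, h1.1.elim]

variable {A B : Set (E →ₗ[ℝ] ℝ)}

lemma Arr.comp (hA : Arr L A) (hg : ∀ y ∈ L', g y ∈ L) : Arr L' ((fun a => a ∘ₗ g) '' A) := by
  refine ⟨hA.finite.image _, ?_⟩
  rintro _ ⟨a, ha, rfl⟩
  exact (hA.integral a ha).comp hg

lemma PLw.comp (h : PLw L A B X φ) (hg : ∀ y ∈ L', g y ∈ L) (hmap : ∀ y ∈ X', g y ∈ X) :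
    PLw L' ((fun a => a ∘ₗ g) '' A) ((fun a => a ∘ₗ g) '' B) X' (φ ∘ g) := by
  refine ⟨h.arr.comp hg, ?_, fun y hy => ?_⟩
  · rintro _ ⟨a, ha, rfl⟩ _ ⟨b, hb, rfl⟩
    exact ⟨a - b, h.diff a ha b hb, rfl⟩
  · obtain ⟨ℓ, hℓ, H⟩ := h.linear (g y) (hmap y hy)
    exact ⟨_, ⟨ℓ, hℓ, rfl⟩, fun z hz => H _ fun a ha => hz _ ⟨a, ha, rfl⟩⟩

/-- Refining an arrangement so that a function is piecewise linear. -/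
lemma exists_plw_of_linear (hA : Arr L A) (hB : Arr L B)
    (h : ∀ x ∈ X, ∃ ℓ ∈ B, ∀ y, InCell A x y → φ y = ℓ y) :
    ∃ A', A ⊆ A' ∧ Arr L A' ∧ PLw L A' B X φ := by
  refine ⟨A ∪ Set.image2 (fun a b => a - b) B B, Set.subset_union_left,
    hA.union ⟨hB.finite.image2 _ hB.finite, ?_⟩, hB, fun a ha b hb => .inr ⟨a, ha, b, hb, rfl⟩,
    fun x hx => ?_⟩
  · rintro _ ⟨a, ha, b, hb, rfl⟩
    exact (hB.integral a ha).sub (hB.integral b hb)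
  · obtain ⟨ℓ, hℓ, H⟩ := h x hx
    exact ⟨ℓ, hℓ, fun y hy => H y (hy.mono Set.subset_union_left)⟩

lemma PLw.ev_eq (h : PLw L A B X φ) (hA : A.Finite) (hX : Cellular A X) {x v : E}
    (hv : v ∈ Loc X x) : ∀ᶠ t in 𝓝[>] (0 : ℝ), φ (x + t • v) = φ x + t * dir φ x v := by
  obtain ⟨ℓ, -, h1, h2, h3⟩ := h.exists_germ hA hX hv
  filter_upwards [ev_near hA x v] with t ht
  rw [h2 t ht _ (InCell.refl _ _), h3 v (InCell.refl _ _), h1]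
  simp

lemma PLw.map_smul (h : PLw L A B X φ) {x : E} (hx : x ∈ X) {t : ℝ} (ht : 0 ≤ t) :
    φ (t • x) = t * φ x := by
  obtain ⟨ℓ, -, H⟩ := h.linear x hx
  rw [H _ ((cell A x).smul_mem ht (InCell.refl A x)), H x (InCell.refl A x), _root_.map_smul,
    smul_eq_mul]

lemma TropSet.dim_eq (hL : IsLattice L) {d d' : ℕ} (h : TropSet L d X) (h' : TropSet L d' X)
    (hX : X.Nonempty) : d = d' := by
  have := hL.finiteDimensional
  obtain ⟨A, hA⟩ := h
  obtain ⟨A', hA'⟩ := h'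
  have h1 := hA.mono hL (hA.arr.union hA'.arr) Set.subset_union_left
  have h2 := hA'.mono hL (hA.arr.union hA'.arr) Set.subset_union_right
  obtain ⟨x, hx⟩ := hX
  obtain ⟨y, hy, -, hd⟩ := h1.pure x hx
  obtain ⟨z, hz, -, hd'⟩ := h2.pure x hx
  have h3 := h1.finrank_le hz
  have h4 := h2.finrank_le hy
  omega

end Isos

/-! ### Locally affine functions of one variable -/

section OneDim

lemma eq_zero_of_ev {a b : ℝ} (h : ∀ᶠ t in 𝓝[>] (0 : ℝ), a + t * b = 0) : a = 0 := by
  rcases lt_trichotomy a 0 with ha | ha | ha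
  · obtain ⟨t, h1, h2⟩ := (h.and (ev_pos_add (neg_pos.2 ha) (-b))).exists
    linarith
  · exact ha
  · obtain ⟨t, h1, h2⟩ := (h.and (ev_pos_add ha b)).exists
    linarith

/-- The function is differentiable with locally constant derivative, which is therefore constant on
the connected set; subtracting the linear term leaves a function with derivative zero. -/
lemma affine_of_locally_affine {h : ℝ → ℝ} {I : Set ℝ} (hI : IsOpen I) (hI' : IsPreconnected I)
    (H : ∀ t ∈ I, ∃ m, ∀ᶠ s in 𝓝[>] (0 : ℝ), h (t + s) = h t + s * m ∧ h (t - s) = h t - s * m) :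
    ∃ m b, ∀ t ∈ I, h t = b + t * m := by
  have H' : ∀ t ∈ I, ∃ m, h =ᶠ[𝓝 t] fun s => h t + (s - t) * m := fun t ht => by
    obtain ⟨m, hm⟩ := H t ht
    obtain ⟨ε, hε, hm⟩ := (mem_nhdsGT_iff_exists_Ioo_subset).1 hm
    refine ⟨m, Metric.eventually_nhds_iff.2 ⟨ε, hε, fun s hs => ?_⟩⟩
    rw [Real.dist_eq, abs_lt] at hs
    rcases lt_trichotomy s t with h1 | h1 | h1
    · have := (hm ⟨sub_pos.2 h1, by linarith [hs.1]⟩).2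
      rw [sub_sub_cancel] at this
      rw [this]; ring
    · simp [h1]
    · have := (hm ⟨sub_pos.2 h1, by linarith [hs.2]⟩).1
      rwa [add_sub_cancel] at this
  choose! m hm using H'
  have hder : ∀ t ∈ I, ∀ c d : ℝ, HasDerivAt (fun s => c + (s - t) * d) d t := fun t _ c d => by
    simpa using (((hasDerivAt_id t).sub_const t).mul_const d).const_add c
  have hd : ∀ t ∈ I, HasDerivAt h (m t) t := fun t ht =>
    (hder t ht _ _).congr_of_eventuallyEq (hm t ht)
  have hloc : ∀ t ∈ I, m =ᶠ[𝓝 t] fun _ => m t := fun t ht => by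
    filter_upwards [(hm t ht).eventually_nhds, hI.mem_nhds ht] with s hs hsI
    have h1 : HasDerivAt h (m t) s := by
      have : HasDerivAt (fun s => h t + (s - t) * m t) (m t) s := by
        simpa using (((hasDerivAt_id s).sub_const t).mul_const (m t)).const_add (h t)
      exact this.congr_of_eventuallyEq hs
    exact (hd s hsI).unique h1
  have hm0 : ∀ t ∈ I, HasDerivAt m 0 t := fun t ht =>
    (hasDerivAt_const t (m t)).congr_of_eventuallyEq (hloc t ht)
  obtain ⟨a, ha⟩ := hI.exists_is_const_of_deriv_eq_zero hI'
    (fun t ht => (hm0 t ht).differentiableAt.differentiableWithinAt) fun t ht => (hm0 t ht).deriv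
  have hG : ∀ t ∈ I, HasDerivAt (fun s => h s - s * a) 0 t := fun t ht => by
    have := (hd t ht).sub ((hasDerivAt_id t).mul_const a)
    rw [ha t ht, one_mul, sub_self] at this
    exact this
  obtain ⟨b, hb⟩ := hI.exists_is_const_of_deriv_eq_zero hI'
    (fun t ht => (hG t ht).differentiableAt.differentiableWithinAt) fun t ht => (hG t ht).deriv
  exact ⟨a, b, fun t ht => by linarith [hb t ht]⟩

end OneDim

/-! ### Functions with trivial divisor on vector spaces -/

section HL

variable {E E' F : Type*} [AddCommGroup E] [Module ℝ E] [AddCommGroup E'] [Module ℝ E']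
  [AddCommGroup F] [Module ℝ F] {L : AddSubgroup E} {L' : AddSubgroup E'} {Λ : AddSubgroup F}
  {X D : Set E} {X' : Set E'} {f : E →ₗ[ℝ] E'} {g : E' →ₗ[ℝ] E} {φ : E → ℝ}

/-- Every piecewise integral linear function with trivial divisor on `X` is linear. -/
def HL (L : AddSubgroup E) (X : Set E) : Prop :=
  ∀ (d : ℕ) (A B : Set (E →ₗ[ℝ] ℝ)) (φ : E → ℝ), Arr L A → TropSet L d X → PLw L A B X φ →
    TropSet (L.prod (AddSubgroup.zmultiples (1 : ℝ))) d (modSet X φ ∅) →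
      ∃ ℓ, IntegralOn L ℓ ∧ ∀ x ∈ X, φ x = ℓ x

theorem HL.of_setIso (hL : IsLattice L) (hL' : IsLattice L') (h : SetIso L X L' X' f g)
    (hX' : HL L' X') : HL L X := by
  intro d A B φ hA hX hφ hG
  obtain ⟨ℓ, hℓ, H⟩ := hX' d _ _ (φ ∘ g) (hA.comp h.inv_lattice) (h.tropSet hL hL' hX)
    (hφ.comp h.inv_lattice h.inv_map)
    ((h.graph φ _).symm.tropSet (hL.prod isLattice_int) (hL'.prod isLattice_int) hG)
  refine ⟨ℓ ∘ₗ f, hℓ.comp h.lattice, fun x hx => ?_⟩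
  rw [LinearMap.comp_apply, ← H _ (h.map x hx), Function.comp_apply, h.left_inv x hx]

/-- Across a wall with normal vectors `n` and `-n`, vanishing of the order says that the two
derivatives cancel. Together with linearity along the wall this excludes a bend in any direction. -/
lemma PLw.dir_linear_of_wall {A B : Set (E →ₗ[ℝ] ℝ)} (hL : IsLattice L) (hA : Arr L A)
    (h : PLw L A B Set.univ φ)
    (hG : TropSet (L.prod (AddSubgroup.zmultiples (1 : ℝ))) (Module.finrank ℝ E)
      (modSet Set.univ φ ∅)) {x : E}
    (hx : Module.finrank ℝ E ≤ Module.finrank ℝ (Lin A x) + 1) (v : E) :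
    dir φ x (-v) = - dir φ x v := by
  have := hL.finiteDimensional
  have hT := (tropA_univ L).mono hL hA (Set.empty_subset A)
  have hcell := hT.cellular
  have hloc : ∀ v, v ∈ Loc (Set.univ : Set E) x := fun v => by rw [loc_univ]; trivial
  obtain ⟨ℓ, hℓ, h1, h2⟩ := h.exists_germ_lin hA.finite hcell (x := x) trivial
  have hle := (Lin A x).finrank_le
  rcases (show Module.finrank ℝ (Lin A x) = Module.finrank ℝ E ∨
    Module.finrank ℝ (Lin A x) + 1 = Module.finrank ℝ E by omega) with h3 | h3
  · have := Submodule.eq_top_of_finrank_eq h3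
    rw [h2 v (this ▸ trivial), h2 (-v) (this ▸ trivial), map_neg]
  · classical
    obtain ⟨n, hne, -, hN⟩ := exists_balanced_of_loc_eq hL hA (W := ⊤)
      (by rw [IsRational, ← hL.span_eq_top]; exact Submodule.span_mono fun x hx =>
        ⟨hx, by rw [hL.span_eq_top]; trivial⟩) (x := x) le_top (by rw [finrank_top]; exact h3)
    have hN' : NormalSystem L (Lin A x) (Loc Set.univ x) {n, -n} := by rwa [loc_univ]
    have hsum := h.sum_dir_eq hL hT (tropA_empty hA 0) (Set.empty_subset _)
      (fun h => absurd h Set.not_nonempty_empty) hG trivial h3 hN'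
    rw [Finset.sum_pair hne, Finset.sum_pair hne, add_neg_cancel, if_neg (Set.notMem_empty x),
      h2 0 (zero_mem _), map_zero, add_zero] at hsum
    have key : ∀ m, dir φ x m + dir φ x (-m) = 0 → ∀ s : ℝ, 0 ≤ s → v - s • m ∈ Lin A x →
        dir φ x (-v) = - dir φ x v := fun m hm s hs hv => by
      have e1 : v = s • m + (v - s • m) := by abel
      have e2 : -v = s • -m + -(v - s • m) := by rw [smul_neg]; abel
      rw [e2, h.dir_add hA.finite hcell (hloc _) (neg_mem hv)]
      conv_rhs => rw [e1, h.dir_add hA.finite hcell (hloc _) hv]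
      rw [h.dir_smul hA.finite hcell (hloc _) hs, h.dir_smul hA.finite hcell (hloc _) hs,
        h2 _ hv, h2 _ (neg_mem hv), map_neg]
      linear_combination s * hm
    obtain ⟨m, hm, s, hs, hv⟩ := (hN'.mem_iff v).1 (hloc v)
    rw [Finset.mem_insert, Finset.mem_singleton] at hm
    rcases hm with rfl | rfl
    · exact key _ hsum s hs hv
    · exact key _ (by rw [neg_neg, add_comm]; exact hsum) s hs hv

/-- Join a point `p` in an open chamber to a generic point `q`. The line meets only cells of
codimension at most one, where `φ` does not bend, so `φ` is affine on it and equals at `q` the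
linear function that represents it near `p`. General points are limits of generic ones. -/
theorem hl_univ (hL : IsLattice L) : HL L (Set.univ : Set E) := by
  intro d A B φ hA hd hφ hG
  have := hL.finiteDimensional
  obtain rfl := hd.dim_eq hL ⟨_, tropA_univ L⟩ ⟨0, trivial⟩
  have hcell : Cellular A (Set.univ : Set E) := fun _ _ _ _ => trivial
  have hloc : ∀ x v, v ∈ Loc (Set.univ : Set E) x := fun x v => by rw [loc_univ]; trivial
  obtain ⟨p, -, -, hp⟩ := exists_generic hA.finite (⊤ : Submodule ℝ E) (w₀ := 0) trivial
  have hptop : Lin A p = ⊤ := eq_top_iff.2 fun v _ a ha h0 => hp a ha h0 v trivial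
  obtain ⟨ℓ, hℓ, hℓp, hℓd⟩ := hφ.exists_germ_lin hA.finite hcell (x := p) trivial
  refine ⟨ℓ, hφ.arr.integral ℓ hℓ, fun q₀ _ => ?_⟩
  have hfin : (Set.range (Lin A)).Finite := by
    refine (hA.finite.finite_subsets.image fun C : Set (E →ₗ[ℝ] ℝ) =>
      ⨅ a ∈ C, LinearMap.ker a).subset ?_
    rintro _ ⟨x, rfl⟩
    refine ⟨{a ∈ A | a x = 0}, Set.sep_subset _ _, ?_⟩
    ext v
    simp [mem_lin]
  -- The span of `p` and a cell of codimension at least two is a proper subspace, hence lies in a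
  -- hyperplane `b = 0`. If the line through `p` and `q` meets that cell, then `b q = 0`, because
  -- the point `p` itself lies in no such cell. There are only finitely many spans to avoid.
  have hbad : ∀ V : Submodule ℝ E, Module.finrank ℝ V + 1 < Module.finrank ℝ E →
      ∃ b : E →ₗ[ℝ] ℝ, b ≠ 0 ∧ b p = 0 ∧ ∀ v ∈ V, b v = 0 := fun V hV => by
    have h1 : V ⊔ Submodule.span ℝ {p} < ⊤ := by
      refine lt_top_iff_ne_top.2 fun h => ?_
      have h2 := Submodule.finrank_add_le_finrank_add_finrank V (Submodule.span ℝ {p})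
      rw [h, finrank_top] at h2
      have h3 := finrank_span_le_card (R := ℝ) ({p} : Set E)
      simp at h3
      omega
    obtain ⟨b, hb, hle⟩ := Submodule.exists_le_ker_of_lt_top _ h1
    exact ⟨b, hb, hle (le_sup_right (a := V) (Submodule.mem_span_singleton_self p)),
      fun v hv => hle (le_sup_left (b := Submodule.span ℝ {p}) hv)⟩
  choose! b hb0 hbp hbV using hbad
  set A' := A ∪ b '' {V ∈ Set.range (Lin A) | Module.finrank ℝ V + 1 < Module.finrank ℝ E}
  have hA' : A'.Finite := hA.finite.union ((hfin.subset (Set.sep_subset _ _)).image b)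
  obtain ⟨w, -, -, hw⟩ := exists_generic hA' (⊤ : Submodule ℝ E) (w₀ := 0) trivial
  have key : ∀ᶠ ε in 𝓝[>] (0 : ℝ), φ (q₀ + ε • w) = ℓ (q₀ + ε • w) := by
    filter_upwards [ev_near hA' q₀ w] with ε hε
    set q := q₀ + ε • w
    have hrank : ∀ s : ℝ, Module.finrank ℝ E ≤ Module.finrank ℝ (Lin A (p + s • (q - p))) + 1 := by
      intro s
      by_contra! hlt
      have hbA : b (Lin A (p + s • (q - p))) ∈ A' := .inr ⟨_, ⟨⟨_, rfl⟩, hlt⟩, rfl⟩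
      have h1 := hbV _ hlt _ (self_mem_lin A (p + s • (q - p)))
      rw [map_add, map_smul, map_sub, hbp _ hlt, zero_add, sub_zero, smul_eq_mul,
        mul_eq_zero] at h1
      rcases h1 with rfl | h1
      · rw [zero_smul, add_zero, hptop, finrank_top] at hlt
        omega
      · exact hb0 _ hlt (LinearMap.ext fun v => hw _ hbA ((hε.eq_zero_iff hbA).1 h1).2 v trivial)
    obtain ⟨m, c, hmc⟩ := affine_of_locally_affine (h := fun s => φ (p + s • (q - p))) isOpen_univ
      isPreconnected_univ fun s _ => by
        refine ⟨dir φ (p + s • (q - p)) (q - p), ?_⟩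
        filter_upwards [hφ.ev_eq hA.finite hcell (hloc (p + s • (q - p)) (q - p)),
          hφ.ev_eq hA.finite hcell (hloc (p + s • (q - p)) (-(q - p)))] with t h1 h2
        rw [hφ.dir_linear_of_wall hL hA hG (hrank s), mul_neg, ← sub_eq_add_neg] at h2
        refine ⟨?_, ?_⟩
        · rw [← h1, add_smul, add_assoc]
        · rw [← h2, smul_neg, sub_smul, add_assoc, sub_eq_add_neg]
    have h0 := hmc 0 trivial
    simp only [zero_smul, add_zero, zero_mul] at h0
    obtain ⟨t, ht, ht0⟩ := ((hφ.ev_eq hA.finite hcell (hloc p (q - p))).and ev_pos).exists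
    have h1 : φ (p + t • (q - p)) = c + t * m := hmc t trivial
    rw [ht, h0, hℓd _ (hptop ▸ trivial), add_right_inj, mul_right_inj' ht0.ne'] at h1
    have h2 := hmc 1 trivial
    simp only [one_smul, add_sub_cancel, one_mul] at h2
    rw [h2, ← h0, ← h1, hℓp, map_sub]
    ring
  have := eq_zero_of_ev (a := φ q₀ - ℓ q₀) (b := dir φ q₀ w - ℓ w) <| by
    filter_upwards [key, hφ.ev_eq hA.finite hcell (hloc q₀ w)] with ε h1 h2
    rw [h2, map_add, map_smul, smul_eq_mul] at h1
    linarith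
  linarith

end HL

end Trop

namespace Trop

open Filter Topology

/-! ### Functions with trivial divisor on modifications -/

section HLmod

variable {E : Type*} [AddCommGroup E] [Module ℝ E] {L : AddSubgroup E}
  {X D : Set E} {φ : E → ℝ} {A B : Set (E →ₗ[ℝ] ℝ)} {d d' : ℕ}

lemma loc_empty (x : E) : Loc (∅ : Set E) x = ∅ :=
  Set.eq_empty_of_forall_notMem fun _ hv => (mem_loc.1 hv).exists.elim fun _ h => h

/-- The local cone of the graph is the graph of the derivative, so the derivative again has trivial
divisor. -/
lemma HL.dir_linear (hA : TropA L d A X) (h : PLw L A B X φ)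
    (hG : TropSet (L.prod (AddSubgroup.zmultiples (1 : ℝ))) d (modSet X φ ∅)) {x : E}
    (hx : HL L (Loc X x)) : ∃ ℓ, IntegralOn L ℓ ∧ ∀ v ∈ Loc X x, dir φ x v = ℓ v := by
  have h1 := hG.loc (x, φ x)
  rw [h.loc_modSet hA.arr.finite hA.cellular (fun _ h => h.elim) (Set.empty_subset _),
    loc_empty] at h1
  exact hx d _ _ _ (hA.arr.mono (Set.sep_subset _ _)) ⟨_, hA.loc x⟩
    (h.loc hA.arr.finite hA.cellular x) h1

variable {A₁ B₁ : Set (E × ℝ →ₗ[ℝ] ℝ)} {θ : E × ℝ → ℝ}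

/-- A function with trivial divisor on a modification is linear on vertical rays, with constant
slope. -/
lemma HL.exists_vertical (hXA : TropA L d A X) (hDA : TropA L d' A D) (hDX : D ⊆ X)
    (h : PLw L A B X φ)
    (hD : ∀ x ∈ D, HL (L.prod (AddSubgroup.zmultiples (1 : ℝ))) (Loc D x ×ˢ (Set.univ : Set ℝ)))
    (hMA : TropA (L.prod (AddSubgroup.zmultiples (1 : ℝ))) d A₁ (modSet X φ D))
    (hθ : PLw (L.prod (AddSubgroup.zmultiples (1 : ℝ))) A₁ B₁ (modSet X φ D) θ)
    (hG : TropSet ((L.prod (AddSubgroup.zmultiples (1 : ℝ))).prod (AddSubgroup.zmultiples (1 : ℝ)))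
      d (modSet (modSet X φ D) θ ∅)) {x : E} (hx : x ∈ D) :
    ∃ b, ∀ t, φ x ≤ t → θ (x, t) = b + t * θ (0, 1) := by
  have hfin := hMA.arr.finite
  have hcell := hMA.cellular
  have hM : ∀ y ∈ D, ∀ t, φ y ≤ t → (y, t) ∈ modSet X φ D := fun y hy t ht => .inr ⟨hy, ht⟩
  -- At a point strictly above the graph the local cone is `Loc D x` times a line, where the
  -- derivative is linear; hence `θ` does not bend along the open vertical ray.
  obtain ⟨m, b, hmb⟩ := affine_of_locally_affine (h := fun t => θ (x, t)) isOpen_Ioi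
    (isPreconnected_Ioi (a := φ x)) fun t ht => by
      have hloc := h.loc_modSet_above hXA.arr.finite hXA.cellular hDX (Set.mem_Ioi.1 ht)
      obtain ⟨ℓ, -, hℓ⟩ := HL.dir_linear hMA hθ hG (x := (x, t)) (by rw [hloc]; exact hD x hx)
      have hv : ∀ s : ℝ, ((0 : E), s) ∈ Loc (modSet X φ D) (x, t) := fun s => by
        rw [hloc]; exact ⟨zero_mem_loc hx, trivial⟩
      refine ⟨ℓ (0, 1), ?_⟩
      filter_upwards [hθ.ev_eq hfin hcell (hv 1), hθ.ev_eq hfin hcell (hv (-1))] with s h1 h2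
      have e : ((0 : E), (-1 : ℝ)) = -(0, 1) := by simp
      rw [hℓ _ (hv _)] at h1 h2
      rw [e, map_neg] at h2
      simp only [Prod.neg_mk, Prod.smul_mk, smul_zero, Prod.mk_add_mk, add_zero, smul_eq_mul,
        mul_neg, mul_one, neg_zero] at h1 h2
      exact ⟨h1, by rw [sub_eq_add_neg, h2]; ring⟩
  have h0 : θ (x, φ x) = b + φ x * m := by
    have hv : ((0 : E), (1 : ℝ)) ∈ Loc (modSet X φ D) (x, φ x) := by
      filter_upwards [ev_pos] with s hs
      exact .inr ⟨by simpa using hx, by simpa using hs.le⟩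
    have := eq_zero_of_ev (a := θ (x, φ x) - b - φ x * m) (b := dir θ (x, φ x) (0, 1) - m) <| by
      filter_upwards [hθ.ev_eq hfin hcell hv, ev_pos] with s h1 hs
      have h2 : θ (x, φ x + s) = b + (φ x + s) * m := hmb (φ x + s) (Set.mem_Ioi.2 (by linarith))
      simp only [Prod.smul_mk, smul_zero, Prod.mk_add_mk, add_zero, smul_eq_mul, mul_one] at h1
      linear_combination h2 - h1
    linarith
  have hall : ∀ t, φ x ≤ t → θ (x, t) = b + t * m := fun t ht => by
    rcases ht.eq_or_lt with rfl | ht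
    exacts [h0, hmb t ht]
  refine ⟨b, fun t ht => ?_⟩
  have h00 := hDA.cellular.zero_mem ⟨x, hx⟩
  have hφ0 : φ 0 = 0 := by simpa using h.map_smul (hDX h00) le_rfl
  have hev : ∀ᶠ r in 𝓝[>] (0 : ℝ), 0 < 1 + r * -φ x := ev_pos_add one_pos _
  have hv : (x, (0 : ℝ)) ∈ Loc (modSet X φ D) (0, 1) := by
    filter_upwards [hev, ev_pos] with r hr hr0
    have : ((0 : E), (1 : ℝ)) + r • (x, (0 : ℝ)) = (r • x, 1) := by simp
    rw [this]
    exact hM _ (hDA.cellular.smul_mem hx hr0.le) _ (by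
      rw [h.map_smul (hDX hx) hr0.le]; linarith)
  -- By homogeneity `θ (r x, 1)` is `r θ (x, r⁻¹) = r b + m` for small positive `r`, while near `(0,
  -- 1)` it is `θ (0, 1)` plus `r` times a derivative. Comparing constant terms, the slope `m` is
  -- the same for every `x`.
  have hm := eq_zero_of_ev (a := m - θ (0, 1)) (b := b - dir θ (0, 1) (x, 0)) <| by
    filter_upwards [hθ.ev_eq hfin hcell hv, hev, ev_pos] with r h1 hr hr0
    have e1 : ((0 : E), (1 : ℝ)) + r • (x, (0 : ℝ)) = r • (x, r⁻¹) := by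
      simp [hr0.ne']
    have h2 : φ x ≤ r⁻¹ := by
      by_contra! hlt
      have := mul_lt_mul_of_pos_left hlt hr0
      rw [mul_inv_cancel₀ hr0.ne'] at this
      linarith
    rw [e1, hθ.map_smul (hM x hx _ h2) hr0.le, hall _ h2] at h1
    rw [mul_add, ← mul_assoc, mul_inv_cancel₀ hr0.ne', one_mul] at h1
    linarith
  rw [hall t ht, sub_eq_zero.1 hm]

/-- Functions with trivial divisor on a modification. -/
theorem HL.modSet (hL : IsLattice L) (hXA : TropA L d A X) (hDA : TropA L d' A D) (hDX : D ⊆ X)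
    (hDne : D.Nonempty) (hd : d' + 1 = d) (h : PLw L A B X φ)
    (hM : TropSet (L.prod (AddSubgroup.zmultiples (1 : ℝ))) d (Trop.modSet X φ D)) (hX : HL L X)
    (hD : ∀ x ∈ D, HL (L.prod (AddSubgroup.zmultiples (1 : ℝ)))
      (Loc D x ×ˢ (Set.univ : Set ℝ))) :
    HL (L.prod (AddSubgroup.zmultiples (1 : ℝ))) (Trop.modSet X φ D) := by
  intro d₁ A₁ B₁ θ hA₁ hM₁ hθ hG
  have := hL.finiteDimensional
  have hLZ := hL.prod isLattice_int
  obtain ⟨x₀, hx₀⟩ := hDne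
  obtain rfl := hM₁.dim_eq hLZ hM ⟨(x₀, φ x₀), .inr ⟨hx₀, le_rfl⟩⟩
  have hcM := h.cellular_modSet hXA.cellular hDA.cellular hDX
  have hMA := (hM.of_cellular hLZ (hXA.arr.modArr h.arr) hcM).mono hLZ
    ((hXA.arr.modArr h.arr).union hA₁) Set.subset_union_left
  have hθ' := hθ.mono (Set.subset_union_right (s := modArr A B))
  have hvert := fun x hx => HL.exists_vertical hXA hDA hDX h hD hMA hθ' hG (x := x) hx
  have h00 := hDA.cellular.zero_mem ⟨x₀, hx₀⟩
  have hφ0 : φ 0 = 0 := by simpa using h.map_smul (hDX h00) le_rfl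
  obtain ⟨c, hc⟩ : ∃ c : ℤ, θ (0, 1) = c := by
    obtain ⟨ℓ, hℓ, H⟩ := hθ.linear (0, 1) (.inr ⟨h00, by simp [hφ0]⟩)
    rw [H _ (InCell.refl _ _)]
    exact hθ.arr.integral ℓ hℓ _ (mem_prod_int L.zero_mem ⟨1, by simp⟩)
  rw [hc] at hvert
  -- Because of the common vertical slope, `θ - c t` depends only on the first coordinate.
  set η : E → ℝ := fun x => θ (x, φ x) - c * φ x with hη
  have hθη : ∀ p ∈ Trop.modSet X φ D, θ p = η p.1 + c * p.2 := by
    rintro ⟨x, t⟩ (⟨hx, ht⟩ | ⟨hx, ht⟩)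
    · obtain rfl : t = φ x := ht
      simp [hη]
    · obtain ⟨b, hb⟩ := hvert x hx
      simp only [hη, hb _ le_rfl, hb t ht]
      ring
  -- `η` is piecewise integral linear
  obtain ⟨A', hAA', hA', hηA⟩ : ∃ A', A ⊆ A' ∧ Arr L A' ∧ PLw L A' (Set.image2
      (fun m ℓ => m ∘ₗ LinearMap.id.prod ℓ - (c : ℝ) • ℓ) B₁ B) X η := by
    have hgr : ∀ ℓ ∈ B, ∀ x ∈ L, LinearMap.id.prod ℓ x ∈
        L.prod (AddSubgroup.zmultiples (1 : ℝ)) := fun ℓ hℓ x hx =>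
      mem_prod_int hx (h.arr.integral ℓ hℓ x hx)
    -- Pulling back along the graphs of all functions of `B` ensures that the lift of an adapted
    -- cell of `X` to the graph of `φ` stays in one `A₁`-cell.
    have hC : Arr L (Set.image2 (fun a ℓ => a ∘ₗ LinearMap.id.prod ℓ) A₁ B) := by
      refine ⟨hA₁.finite.image2 _ h.arr.finite, ?_⟩
      rintro _ ⟨a, ha, ℓ, hℓ, rfl⟩
      exact (hA₁.integral a ha).comp (hgr ℓ hℓ)
    have hB' : Arr L (Set.image2 (fun m ℓ => m ∘ₗ LinearMap.id.prod ℓ - (c : ℝ) • ℓ) B₁ B) := by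
      refine ⟨hθ.arr.finite.image2 _ h.arr.finite, ?_⟩
      rintro _ ⟨m, hm, ℓ, hℓ, rfl⟩
      refine ((hθ.arr.integral m hm).comp (hgr ℓ hℓ)).sub fun x hx => ?_
      obtain ⟨k, hk⟩ := h.arr.integral ℓ hℓ x hx
      exact ⟨c * k, by simp [hk]⟩
    obtain ⟨A', h1, h2, h3⟩ := exists_plw_of_linear (φ := η) (X := X) (hXA.arr.union hC) hB'
      fun x hx => by
        obtain ⟨ℓ, hℓ, H⟩ := h.linear x hx
        obtain ⟨m, hm, H'⟩ := hθ.linear (x, φ x) (.inl ⟨hx, rfl⟩)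
        refine ⟨_, ⟨m, hm, ℓ, hℓ, rfl⟩, fun y hy => ?_⟩
        have hy1 := H y (hy.mono Set.subset_union_left)
        have hx1 := H x (InCell.refl A x)
        have hy2 := H' (y, φ y) fun a ha => by
          have := hy (a ∘ₗ LinearMap.id.prod ℓ) (.inr ⟨a, ha, ℓ, hℓ, rfl⟩)
          rw [hx1, hy1]
          exact this
        simp only [hη, hy2]
        rw [hy1]
        rfl
    exact ⟨A', Set.subset_union_left.trans h1, h2, h3⟩
  set B' := Set.image2 (fun m ℓ => m ∘ₗ LinearMap.id.prod ℓ - (c : ℝ) • ℓ) B₁ B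
  have hXA' := hXA.mono hL hA' hAA'
  have hDA' := hDA.mono hL hA' hAA'
  have hfin := hA'.finite
  have h' := h.mono hAA'
  have hcM' := h'.cellular_modSet hXA'.cellular hDA'.cellular hDX
  have hMA' := hM.of_cellular hLZ (hA'.modArr h.arr) hcM'
  -- It equals `θ` on the modification, and its derivatives are explicit.
  set θ' : E × ℝ → ℝ := fun p => η p.1 + c * p.2 with hθ'def
  have hPL : PLw (L.prod (AddSubgroup.zmultiples (1 : ℝ))) (modArr A' B)
      ((fun b => b ∘ₗ LinearMap.fst ℝ E ℝ + (c : ℝ) • LinearMap.snd ℝ E ℝ) '' B')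
      (Trop.modSet X φ D) θ' := by
    refine ⟨⟨hηA.arr.finite.image _, ?_⟩, ?_, ?_⟩
    · rintro _ ⟨b, hb, rfl⟩
      refine ((hηA.arr.integral b hb).comp (L' := L.prod (AddSubgroup.zmultiples (1 : ℝ)))
        fun x hx => hx.1).add fun x hx => ?_
      obtain ⟨k, hk⟩ := AddSubgroup.mem_zmultiples_iff.1 hx.2
      exact ⟨c * k, by simp [← hk]⟩
    · rintro _ ⟨b, hb, rfl⟩ _ ⟨b', hb', rfl⟩
      refine .inl ⟨b - b', hηA.diff b hb b' hb', ?_⟩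
      dsimp only
      rw [add_sub_add_right_eq_sub, LinearMap.sub_comp]
    · intro p hp
      have hpX : p.1 ∈ X := hp.elim (fun h => h.1) fun h => hDX h.1
      obtain ⟨b, hb, H⟩ := hηA.linear p.1 hpX
      refine ⟨_, ⟨b, hb, rfl⟩, fun q hq => ?_⟩
      have := H q.1 (inCell_modArr.1 hq).1
      simp [hθ'def, this]
  have hgraph : Trop.modSet (Trop.modSet X φ D) θ ∅ = Trop.modSet (Trop.modSet X φ D) θ' ∅ := by
    ext ⟨p, s⟩
    simp only [mem_modSet, Set.mem_empty_iff_false, false_and, or_false]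
    exact and_congr_right fun hp => by rw [hθη p hp]
  rw [hgraph] at hG
  have hdir : ∀ x v s, v ∈ Loc X x → dir θ' (x, φ x) (v, s) = dir η x v + c * s := by
    intro x v s hv
    refine dir_eq ?_
    filter_upwards [hηA.ev_eq hfin hXA'.cellular hv] with r hr
    simp only [hθ'def, Prod.fst_add, Prod.smul_fst, hr, Prod.snd_add, Prod.smul_snd, smul_eq_mul]
    ring
  -- Vanishing of the order of `θ'` along a wall of the graph is a relation between derivatives
  -- along the lifted normals and, over `D`, the vertical vector. The linear term `c t` contributes
  -- equally to both sides, leaving the relation for `η` on `X`.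
  have hGη : TropSet (L.prod (AddSubgroup.zmultiples (1 : ℝ))) d₁ (Trop.modSet X η ∅) := by
    refine ⟨_, hηA.tropA_modSet hL hXA' (tropA_empty (d := 0) hA') (Set.empty_subset _)
      (fun h => absurd h Set.not_nonempty_empty) fun x hx hrank => ?_⟩
    obtain ⟨N, hN, hsum⟩ := hXA'.balanced x hx hrank
    refine ⟨N, hN, hsum, ?_⟩
    rw [if_neg (Set.notMem_empty x), add_zero]
    have hNloc : ∀ n ∈ N, n ∈ Loc X x := fun n hn => (hN.mem_iff n).2 ⟨n, hn, 1, by simp⟩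
    have h0N : (0 : E) ∉ N := fun h0 => hN.notMem 0 h0 (zero_mem _)
    have h0loc := zero_mem_loc hx
    have hsloc := hXA'.cellular.lin_subset_loc hfin hx hsum
    have e1 := h'.sum_dir_eq hL hXA' hDA' hDX (fun _ => hd) hM hx hrank hN
    have hNM := h'.normalSystem_modSet hfin hXA'.cellular hDA'.cellular hDX hx
      (fun hxD => hDA'.loc_eq_lin hxD (by omega)) hN
    have e2 := hPL.sum_dir_eq hLZ hMA' (tropA_empty (d := 0) (hA'.modArr h.arr))
      (Set.empty_subset _) (fun h => absurd h Set.not_nonempty_empty) hG (.inl ⟨hx, rfl⟩)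
      (by rw [h'.finrank_lin_graph hfin hXA'.cellular hx]; exact hrank) hNM
    rw [if_neg (Set.notMem_empty _), add_zero, sum_modNormals_apply _ h0N, sum_modNormals h0N,
      hdir _ _ _ hsloc, hdir _ _ _ h0loc, Finset.sum_congr rfl fun n hn => hdir x n _ (hNloc n hn),
      Finset.sum_add_distrib, ← Finset.mul_sum] at e2
    have e3 : dir η x 0 = 0 := by
      obtain ⟨ℓ, -, -, H⟩ := hηA.exists_germ_lin hfin hXA'.cellular hx
      rw [H 0 (zero_mem _), map_zero]
    split_ifs at e1 e2 <;> linarith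
  obtain ⟨ℓ, hℓ, H⟩ := hX d₁ _ _ η hA' ⟨_, hXA'⟩ hηA hGη
  refine ⟨ℓ ∘ₗ LinearMap.fst ℝ E ℝ + (c : ℝ) • LinearMap.snd ℝ E ℝ,
    (hℓ.comp (L' := L.prod (AddSubgroup.zmultiples (1 : ℝ))) fun x hx => hx.1).add
      fun x hx => ?_, fun p hp => ?_⟩
  · obtain ⟨k, hk⟩ := AddSubgroup.mem_zmultiples_iff.1 hx.2
    exact ⟨c * k, by simp [← hk]⟩
  · have hpX : p.1 ∈ X := hp.elim (fun h => h.1) fun h => hDX h.1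
    rw [hθη p hp, H _ hpX]
    simp

end HLmod

end Trop

/-! ### Products and local cones of quasilinear sets -/

namespace Trop

open Filter Topology

/-- The zero lattice serves to specialise statements about products to the set itself. -/
lemma isLattice_punit : IsLattice (⊤ : AddSubgroup PUnit.{u + 1}) :=
  isLattice_of_separating (C := ∅) (Subsingleton.elim _ _) ⟨Set.finite_empty, fun _ h => h.elim⟩
    fun _ _ => rfl

lemma setIso_prod_punit {E : Type*} [AddCommGroup E] [Module ℝ E] (L : AddSubgroup E) (X : Set E) :
    SetIso L X (L.prod (⊤ : AddSubgroup PUnit.{u + 1})) (X ×ˢ Set.univ)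
      (LinearMap.inl ℝ E PUnit.{u + 1}) (LinearMap.fst ℝ E PUnit.{u + 1}) where
  lattice _ hx := ⟨hx, trivial⟩
  inv_lattice _ hx := hx.1
  map _ hx := ⟨hx, trivial⟩
  inv_map _ hx := hx.1
  left_inv _ _ := rfl
  right_inv _ _ := rfl

/-- Products of quasilinear sets with vector spaces are quasilinear. -/
theorem QLs.prod_univ {E : Type u} [AddCommGroup E] [Module ℝ E] {L : AddSubgroup E} {X : Set E}
    {F : Type v} [AddCommGroup F] [Module ℝ F] {Λ : AddSubgroup F} (hX : QLs L X)
    (hΛ : IsLattice Λ) : QLs (L.prod Λ) (X ×ˢ (Set.univ : Set F)) := by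
  have := hΛ.finiteDimensional
  refine QLs.induction (P := fun L X => QLs (L.prod Λ) (X ×ˢ (Set.univ : Set F))) ?_ ?_ ?_ hX
  · intro E _ _ L hL
    rw [Set.univ_prod_univ]
    exact qls_univ (hL.prod hΛ)
  · intro E E' _ _ _ _ L L' X X' f g hL _ h ih
    exact QLs.of_setIso (hL.prod hΛ) ih (h.prod_univ Λ)
  · intro E _ _ L A B X D φ d d' hX _ hXA hDA hDX hd h hM ih ih'
    have hL := hX.isLattice
    have := hL.finiteDimensional
    have hiso := setIso_modSet_prod L Λ (AddSubgroup.zmultiples (1 : ℝ)) X D φ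
    refine QLs.of_setIso ((hL.prod isLattice_int).prod hΛ) ?_ hiso
    exact ih.modSet ih' (hXA.prod_univ Λ) (hDA.prod_univ Λ) (Set.prod_mono_left hDX) (by omega)
      (h.comp (g := LinearMap.fst ℝ E F) (fun _ hy => hy.1) fun _ hy => hy.1)
      (hiso.tropSet ((hL.prod isLattice_int).prod hΛ) ((hL.prod hΛ).prod isLattice_int)
        (hM.prod_univ Λ))

/-- The local cones of quasilinear sets are quasilinear, and piecewise linear functions with
trivial divisor on them are linear. -/
theorem QLs.loc_and_hl {E : Type u} [AddCommGroup E] [Module ℝ E] {L : AddSubgroup E} {X : Set E}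
    (hX : QLs L X) : ∀ x ∈ X, QLs L (Loc X x) ∧
      ∀ {F : Type u} [AddCommGroup F] [Module ℝ F] (Λ : AddSubgroup F), IsLattice Λ →
        HL (L.prod Λ) (Loc X x ×ˢ (Set.univ : Set F)) := by
  refine QLs.induction (P := fun {E} _ _ L X => ∀ x ∈ X, QLs L (Loc X x) ∧
      ∀ {F : Type u} [AddCommGroup F] [Module ℝ F] (Λ : AddSubgroup F), IsLattice Λ →
        HL (L.prod Λ) (Loc X x ×ˢ (Set.univ : Set F))) ?_ ?_ ?_ hX
  · intro E _ _ L hL x _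
    rw [loc_univ]
    refine ⟨qls_univ hL, fun Λ hΛ => ?_⟩
    rw [Set.univ_prod_univ]
    exact hl_univ (hL.prod hΛ)
  · intro E E' _ _ _ _ L L' X X' f g hL hX' h ih x hx
    have h1 := h.loc x hx
    obtain ⟨h2, h3⟩ := ih (f x) (h.map x hx)
    exact ⟨h2.of_setIso hL h1, fun Λ hΛ => HL.of_setIso (hL.prod hΛ) (hX'.isLattice.prod hΛ)
      (h1.prod_univ Λ) (h3 Λ hΛ)⟩
  · rintro E _ _ L A B X D φ d d' hX hD hXA hDA hDX hd h hM ih ih' ⟨x, t⟩ hxt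
    have hL := hX.isLattice
    have hLZ := hL.prod isLattice_int
    have := hL.finiteDimensional
    have hfin := hXA.arr.finite
    rcases (show t = φ x ∨ x ∈ D ∧ φ x < t from
      hxt.elim (fun h => .inl h.2) fun h => h.2.eq_or_lt.imp Eq.symm fun h' => ⟨h.1, h'⟩)
      with rfl | ⟨hx, ht⟩
    · have hx : x ∈ X := hxt.elim (fun h => h.1) fun h => hDX h.1
      obtain ⟨hq, hhl⟩ := ih x hx
      have hMx := hM.loc (x, φ x)
      have hPL := h.loc hfin hXA.cellular x
      rw [h.loc_modSet hfin hXA.cellular hDA.cellular hDX] at hMx ⊢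
      -- Over the divisor, the local cone is the modification of the local cone of `X` along that of
      -- `D`.
      by_cases hxD : x ∈ D
      · have hsub : Loc D x ⊆ Loc X x := fun v hv => (mem_loc.1 hv).mono fun t ht => hDX ht
        refine ⟨hq.modSet (ih' x hxD).1 (hXA.loc x) (hDA.loc x) hsub hd hPL hMx,
          fun {F} _ _ Λ hΛ => ?_⟩
        have := hΛ.finiteDimensional
        have hiso := setIso_modSet_prod L Λ (AddSubgroup.zmultiples (1 : ℝ)) (Loc X x) (Loc D x)
          (dir φ x)
        refine HL.of_setIso (hLZ.prod hΛ) ((hL.prod hΛ).prod isLattice_int) hiso ?_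
        refine HL.modSet (hL.prod hΛ) ((hXA.loc x).prod_univ Λ) ((hDA.loc x).prod_univ Λ)
          (Set.prod_mono_left hsub) ⟨(0, 0), zero_mem_loc hxD, trivial⟩ (by omega)
          (hPL.comp (g := LinearMap.fst ℝ E F) (fun _ hy => hy.1) fun _ hy => hy.1)
          (hiso.tropSet (hLZ.prod hΛ) ((hL.prod hΛ).prod isLattice_int) (hMx.prod_univ Λ))
          (hhl Λ hΛ) ?_
        rintro ⟨v, y⟩ ⟨hv, -⟩
        obtain ⟨r, hr⟩ := exists_near hfin x v
        rw [loc_prod_univ, hDA.cellular.loc_loc hfin hr]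
        -- A local cone of `Loc D x` is a local cone of `D` at a nearby point, and the induction
        -- hypothesis for `D` is used with the factor enlarged by a line. For this step the factor
        -- has to be arbitrary.
        exact HL.of_setIso ((hL.prod hΛ).prod isLattice_int) (hL.prod (hΛ.prod isLattice_int))
          (setIso_prod_assoc L Λ (AddSubgroup.zmultiples (1 : ℝ)) _)
          ((ih' _ ((hDA.cellular.near_mem_iff hfin hr).2 hv)).2 _ (hΛ.prod isLattice_int))
      -- Outside the divisor, the derivative of `φ` has trivial divisor on `Loc X x`, so it is
      -- linear there and its graph is isomorphic to `Loc X x`.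
      · have hDx : Loc D x = ∅ :=
          Set.eq_empty_of_forall_notMem fun v hv => hxD (hDA.cellular.mem_of_loc hfin hv)
        rw [hDx] at hMx ⊢
        obtain ⟨ℓ, hℓ, H⟩ := HL.of_setIso hL (hL.prod isLattice_punit)
          (setIso_prod_punit L (Loc X x)) (hhl ⊤ isLattice_punit) d _ _ _
          (hXA.loc x).arr ⟨_, hXA.loc x⟩ hPL hMx
        have hiso := setIso_graph hℓ H
        exact ⟨hq.of_setIso hLZ hiso, fun Λ hΛ => HL.of_setIso (hLZ.prod hΛ) (hL.prod hΛ)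
          (hiso.prod_univ Λ) (hhl Λ hΛ)⟩
    -- Strictly above the graph, the local cone is that of `D` times a line; the line joins the
    -- vector space factor.
    · rw [h.loc_modSet_above hfin hXA.cellular hDX ht]
      obtain ⟨hq, hhl⟩ := ih' x hx
      exact ⟨hq.prod_univ isLattice_int, fun Λ hΛ => HL.of_setIso (hLZ.prod hΛ)
        (hL.prod (isLattice_int.prod hΛ)) (setIso_prod_assoc L _ Λ _)
        (hhl _ (isLattice_int.prod hΛ))⟩

/-- A tropical set is its own local cone at the origin. -/
lemma QLs.hl {E : Type u} [AddCommGroup E] [Module ℝ E] {L : AddSubgroup E} {X : Set E}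
    (hX : QLs L X) : HL L X := by
  obtain ⟨d, A, hA⟩ := hX.tropSet
  have := (hX.loc_and_hl 0 hX.zero_mem).2 ⊤ isLattice_punit.{u}
  rw [hA.cellular.loc_zero] at this
  exact HL.of_setIso hX.isLattice (hX.isLattice.prod isLattice_punit) (setIso_prod_punit L X) this

end Trop

namespace Trop

open Filter Topology

/-! ### Cancelling vector space factors -/

section Slices

variable {E E' F : Type*} [AddCommGroup E] [Module ℝ E] [AddCommGroup E'] [Module ℝ E']
  [AddCommGroup F] [Module ℝ F] {L : AddSubgroup E} {L' : AddSubgroup E'} {Λ : AddSubgroup F}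
  {X : Set E} {d : ℕ}

lemma IsLattice.isRational_range (hL : IsLattice L) {g : E →ₗ[ℝ] E'} (hg : ∀ x ∈ L, g x ∈ L') :
    IsRational L' (LinearMap.range g) := by
  rw [IsRational, LinearMap.range_eq_map, ← hL.span_eq_top, Submodule.map_span]
  refine Submodule.span_mono ?_
  rintro _ ⟨x, hx, rfl⟩
  exact ⟨hg x hx, Submodule.subset_span ⟨x, hx, rfl⟩⟩

/-- The lattice of a rational subspace. -/
lemma IsRational.isLattice (hL : IsLattice L) {W : Submodule ℝ E} (hW : IsRational L W) :
    IsLattice (L.comap W.subtype.toAddMonoidHom) := by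
  obtain ⟨C, hC, hsep⟩ := hL.exists_separating
  refine isLattice_of_separating (C := (fun c => c ∘ₗ W.subtype) '' C) ?_
    (hC.comp fun y hy => hy) fun v hv => Subtype.ext (hsep v fun c hc => hv _ ⟨c, hc, rfl⟩)
  refine Submodule.map_injective_of_injective W.injective_subtype (le_antisymm ?_ ?_)
  · exact Submodule.map_mono le_top
  · rw [Submodule.map_span, Submodule.map_top, Submodule.range_subtype]
    refine hW.trans (Submodule.span_mono ?_)
    rintro x ⟨h1, h2⟩
    exact ⟨⟨x, h2⟩, h1, rfl⟩

/-- The tangent space at a point of a top-dimensional cell contains `F`. -/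
lemma TropSet.finrank_le_of_prod_univ (hL : IsLattice L) (hΛ : IsLattice Λ) (hX : X.Nonempty)
    (h : TropSet (L.prod Λ) d (X ×ˢ (Set.univ : Set F))) : Module.finrank ℝ F ≤ d := by
  have := hL.finiteDimensional
  have := hΛ.finiteDimensional
  obtain ⟨A, hA⟩ := h
  obtain ⟨x, hx⟩ := hX
  obtain ⟨⟨y, k⟩, hy, -, hd⟩ := hA.pure (x, 0) ⟨hx, trivial⟩
  have hloc := hA.loc_eq_lin hy hd
  rw [loc_prod_univ] at hloc
  have : LinearMap.range (LinearMap.inr ℝ E F) ≤ Lin A (y, k) := by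
    rintro _ ⟨w, rfl⟩
    rw [← SetLike.mem_coe, ← hloc]
    exact ⟨zero_mem_loc hy.1, trivial⟩
  have := Submodule.finrank_mono this
  rwa [LinearMap.finrank_range_of_inj LinearMap.inr_injective, hd] at this

variable {P : E →ₗ[ℝ] E}

lemma range_sub_eq_ker (hP : ∀ x, P (P x) = P x) :
    LinearMap.range (LinearMap.id - P) = LinearMap.ker P := by
  ext x
  constructor
  · rintro ⟨y, rfl⟩
    simp [hP]
  · exact fun hx => ⟨x, by simp [LinearMap.mem_ker.1 hx]⟩

lemma isRational_ker (hL : IsLattice L) (hP : ∀ x, P (P x) = P x) (hPL : ∀ x ∈ L, P x ∈ L) :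
    IsRational L (LinearMap.ker P) := by
  rw [← range_sub_eq_ker hP]
  exact hL.isRational_range fun x hx => sub_mem hx (hPL x hx)

/-- A set that is invariant under the fibres of a projection is a product. -/
lemma setIso_slice (hP : ∀ x, P (P x) = P x) (hPL : ∀ x ∈ L, P x ∈ L)
    (hX : ∀ x, x ∈ X ↔ P x ∈ X) :
    SetIso L X (L.prod (L.comap (LinearMap.ker P).subtype.toAddMonoidHom))
      ({x | x ∈ X ∧ P x = x} ×ˢ Set.univ)
      (P.prod ((LinearMap.id - P).codRestrict (LinearMap.ker P) fun x => by simp [hP]))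
      (LinearMap.id.coprod (LinearMap.ker P).subtype) where
  lattice x hx := ⟨hPL x hx, L.sub_mem hx (hPL x hx)⟩
  inv_lattice x hx := by
    rw [LinearMap.coprod_apply]
    exact L.add_mem hx.1 hx.2
  map x hx := ⟨⟨(hX x).1 hx, hP x⟩, trivial⟩
  inv_map := by
    rintro ⟨y, k⟩ ⟨⟨hy, hPy⟩, -⟩
    rw [LinearMap.coprod_apply, hX]
    have := LinearMap.mem_ker.1 k.2
    simpa [this, hPy] using hy
  left_inv x _ := by simp
  right_inv := by
    rintro ⟨y, k⟩ ⟨⟨-, hPy⟩, -⟩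
    have := LinearMap.mem_ker.1 k.2
    refine Prod.ext (by simp [this, hPy]) (Subtype.ext (by simp [this, hPy]))

lemma TropSet.slice (hL : IsLattice L) (hP : ∀ x, P (P x) = P x) (hPL : ∀ x ∈ L, P x ∈ L)
    (hX : ∀ x, x ∈ X ↔ P x ∈ X) (hne : X.Nonempty) (h : TropSet L d X) :
    Module.finrank ℝ (LinearMap.ker P) ≤ d ∧
      TropSet L (d - Module.finrank ℝ (LinearMap.ker P)) {x | x ∈ X ∧ P x = x} := by
  have hΛ := (isRational_ker hL hP hPL).isLattice hL
  have h1 := (setIso_slice hP hPL hX).tropSet hL (hL.prod hΛ) h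
  obtain ⟨x, hx⟩ := hne
  have hne' : {x | x ∈ X ∧ P x = x}.Nonempty := ⟨P x, (hX x).1 hx, hP x⟩
  have h2 := h1.finrank_le_of_prod_univ hL hΛ hne'
  exact ⟨h2, TropSet.of_prod_univ hL hΛ (by rwa [Nat.sub_add_cancel h2])⟩

end Slices

/-- Slices of quasilinear sets that are invariant under the fibres of a projection are
quasilinear. -/
theorem QLs.slice {E : Type u} [AddCommGroup E] [Module ℝ E] {L : AddSubgroup E} {X : Set E}
    (hX : QLs L X) {P : E →ₗ[ℝ] E} (hP : ∀ x, P (P x) = P x) (hPL : ∀ x ∈ L, P x ∈ L)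
    (hinv : ∀ x, x ∈ X ↔ P x ∈ X) : QLs L {x | x ∈ X ∧ P x = x} := by
  revert hP hPL hinv P
  refine QLs.induction (P := fun {E} _ _ L X => ∀ {P : E →ₗ[ℝ] E}, (∀ x, P (P x) = P x) →
    (∀ x ∈ L, P x ∈ L) → (∀ x, x ∈ X ↔ P x ∈ X) → QLs L {x | x ∈ X ∧ P x = x}) ?_ ?_ ?_ hX
  · intro E _ _ L hL P hP hPL hinv
    have hΛ := (hL.isRational_range hPL).isLattice hL
    refine QLs.of_setIso hL (qls_univ hΛ) (f := P.rangeRestrict)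
      (g := (LinearMap.range P).subtype) ⟨fun x hx => hPL x hx, fun x hx => hx,
        fun _ _ => trivial, ?_, fun x hx => hx.2, ?_⟩
    · rintro ⟨_, x, rfl⟩ -
      exact ⟨trivial, hP x⟩
    · rintro ⟨_, x, rfl⟩ -
      exact Subtype.ext (hP x)
  · intro E E' _ _ _ _ L L' X X' f g hL hX' h ih P hP hPL hinv
    have h0 : (0 : E) ∈ X := by simpa using h.inv_map 0 hX'.zero_mem
    have hker : ∀ k, P k = 0 → k ∈ X := fun k hk => (hinv k).2 (by rwa [hk])
    have hgf : ∀ x, g (f (x - P x)) = x - P x := fun x =>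
      h.left_inv _ (hker _ (by rw [map_sub, hP, sub_self]))
    have hadd : ∀ x ∈ X, ∀ k, P k = 0 → x + k ∈ X := fun x hx k hk => by
      rw [hinv, map_add, hk, add_zero]; exact (hinv x).1 hx
    -- The kernel of `P` lies in `X`, so `g ∘ f` is the identity on it and `f (id - P) g` is again a
    -- projection. Its complement corresponds to `P` on `X`.
    let Q : E' →ₗ[ℝ] E' := LinearMap.id - f ∘ₗ (LinearMap.id - P) ∘ₗ g
    have hQ : ∀ y, Q y = y - f (g y - P (g y)) := fun y => rfl
    have hker' : ∀ y, P (g y - P (g y)) = 0 := fun y => by rw [map_sub, hP, sub_self]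
    have hQmap : ∀ x ∈ X, Q (f x) = f (P x) := fun x hx => by
      rw [hQ, h.left_inv x hx, map_sub, sub_sub_cancel]
    have := ih (P := Q) ?_ ?_ ?_
    · refine this.of_setIso hL (f := f) (g := g) ⟨h.lattice, h.inv_lattice,
        fun x hx => ⟨h.map x hx.1, by rw [hQmap x hx.1, hx.2]⟩,
        fun y hy => ⟨h.inv_map y hy.1, ?_⟩, fun x hx => h.left_inv x hx.1,
        fun y hy => h.right_inv y hy.1⟩
      have h1 := hy.2
      rw [hQ, sub_eq_self] at h1
      have h2 := hgf (g y)
      rw [h1, map_zero] at h2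
      exact (sub_eq_zero.1 h2.symm).symm
    · intro y
      rw [hQ (Q y), hQ y, map_sub g, hgf, sub_sub_cancel, hP, sub_self, map_zero, sub_zero]
    · exact fun y hy => L'.sub_mem hy (h.lattice _ (L.sub_mem (h.inv_lattice y hy)
        (hPL _ (h.inv_lattice y hy))))
    · intro y
      constructor
      · intro hy
        have := hQmap _ (h.inv_map y hy)
        rw [h.right_inv y hy] at this
        rw [this]
        exact h.map _ ((hinv _).1 (h.inv_map y hy))
      · intro hy
        have h1 := h.map _ (hadd _ (h.inv_map _ hy) _ (hker' y))
        rw [map_add, h.right_inv _ hy, hQ, sub_add_cancel] at h1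
        exact h1
  · intro E _ _ L A B X D φ d d' hX hD hXA hDA hDX hd h hM ih ih' P hP hPL hinv
    have hL := hX.isLattice
    have hLZ := hL.prod isLattice_int
    have := hL.finiteDimensional
    have hφ0 : φ 0 = 0 := by simpa using h.map_smul hX.zero_mem le_rfl
    have h0 : (0 : E × ℝ) ∈ Trop.modSet X φ D := .inl ⟨hX.zero_mem, hφ0.symm⟩
    have hker : ∀ k, P k = 0 → k ∈ Trop.modSet X φ D := fun k hk => (hinv k).2 (by rwa [hk])
    have hadd : ∀ p ∈ Trop.modSet X φ D, ∀ k, P k = 0 → p + k ∈ Trop.modSet X φ D := fun x hx k hk => by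
      rw [hinv, map_add, hk, add_zero]; exact (hinv x).1 hx
    have hMX : ∀ p ∈ Trop.modSet X φ D, p.1 ∈ X ∧ φ p.1 ≤ p.2 := by
      rintro p (hp | hp)
      exacts [⟨hp.1, hp.2.ge⟩, ⟨hDX hp.1, hp.2⟩]
    -- the kernel is a graph
    have hgr : ∀ k, P k = 0 → k.1 = 0 → k = 0 := fun k hk hk1 => by
      have h1 := (hMX k (hker k hk)).2
      have h2 := (hMX (-k) (hker (-k) (by rw [map_neg, hk, neg_zero]))).2
      rw [Prod.fst_neg, Prod.snd_neg] at h2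
      rw [hk1] at h1 h2
      rw [neg_zero, hφ0] at h2
      rw [hφ0] at h1
      exact Prod.ext hk1 (by simp; linarith)
    let fK : LinearMap.ker P →ₗ[ℝ] E := (LinearMap.fst ℝ E ℝ).domRestrict (LinearMap.ker P)
    have hfK : Function.Injective fK := by
      rw [injective_iff_map_eq_zero]
      exact fun k hk => Subtype.ext (hgr k k.2 hk)
    have hfKr : IsRational L (LinearMap.range fK) := by
      have : LinearMap.range fK =
          LinearMap.range (LinearMap.fst ℝ E ℝ ∘ₗ (LinearMap.id - P)) := by
        rw [LinearMap.range_comp, range_sub_eq_ker hP, LinearMap.range_domRestrict]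
      rw [this]
      exact hLZ.isRational_range fun x hx => L.sub_mem hx.1 (hPL x hx).1
    obtain ⟨P', hP'1, hP'2, hP'L⟩ := hL.exists_projection hfKr
    -- The inverse of the injective projection from the kernel of `P` to `E`, extended to `E` by the
    -- integral projection `P'` onto its image.
    let σ : E →ₗ[ℝ] E × ℝ := (LinearMap.ker P).subtype ∘ₗ
      (LinearEquiv.ofInjective fK hfK).symm.toLinearMap ∘ₗ P'.codRestrict _ hP'1
    have hσP : ∀ x, P (σ x) = 0 := fun x => Subtype.prop
      ((LinearEquiv.ofInjective fK hfK).symm (P'.codRestrict _ hP'1 x))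
    have hσ1 : ∀ x, (σ x).1 = P' x := fun x => congr_arg Subtype.val
      ((LinearEquiv.ofInjective fK hfK).apply_symm_apply (P'.codRestrict _ hP'1 x))
    have hP'k : ∀ k, P k = 0 → P' k.1 = k.1 := fun k hk => hP'2 _ ⟨⟨k, hk⟩, rfl⟩
    have hσk : ∀ k, P k = 0 → σ k.1 = k := fun k hk => sub_eq_zero.1 <|
      hgr _ (by rw [map_sub, hσP, hk, sub_zero]) (by
        rw [Prod.fst_sub, hσ1, hP'k k hk, sub_self])
    -- invariance
    have hφk : ∀ x ∈ X, ∀ k, P k = 0 → x + k.1 ∈ X ∧ φ (x + k.1) = φ x + k.2 := by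
      intro x hx k hk
      obtain ⟨h1, h2⟩ := hMX _ (hadd (x, φ x) (.inl ⟨hx, rfl⟩) k hk)
      obtain ⟨-, h3⟩ := hMX _ (hadd (x + k.1, φ (x + k.1)) (.inl ⟨h1, rfl⟩) (-k)
        (by rw [map_neg, hk, neg_zero]))
      simp only [Prod.fst_add, Prod.snd_add, Prod.fst_neg, Prod.snd_neg,
        add_neg_cancel_right] at h1 h2 h3
      exact ⟨h1, by linarith⟩
    -- A point strictly above the graph remains strictly above it after translation, so its
    -- projection must lie in `D`.
    have hDk : ∀ x ∈ D, ∀ k, P k = 0 → x + k.1 ∈ D := by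
      intro x hx k hk
      have h1 := (hφk x (hDX hx) k hk).2
      rcases hadd (x, φ x + 1) (.inr ⟨hx, by simp⟩) k hk with h2 | h2
      · have := h2.2
        simp only [Prod.fst_add, Prod.snd_add] at this
        linarith
      · exact h2.1
    have hσφ : ∀ x, (σ x).2 = φ (P' x) := fun x => by
      have := (hφk 0 hX.zero_mem (σ x) (hσP x)).2
      rw [zero_add, hσ1, hφ0, zero_add] at this
      exact this.symm
    have hσL : ∀ x ∈ L, σ x ∈ L.prod (AddSubgroup.zmultiples (1 : ℝ)) := fun x hx => by
      have h1 : P' x ∈ X := by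
        have := (hφk 0 hX.zero_mem (σ x) (hσP x)).1
        rwa [zero_add, hσ1] at this
      obtain ⟨ℓ, hℓ, H⟩ := h.linear _ h1
      have h2 := hσφ x
      rw [H _ (InCell.refl A _)] at h2
      have h3 := mem_prod_int (hP'L x hx) (h.arr.integral ℓ hℓ _ (hP'L x hx))
      rwa [← h2, ← hσ1] at h3
    have hP'P' : ∀ x, P' (P' x) = P' x := fun x => hP'2 _ (hP'1 x)
    let Q : E →ₗ[ℝ] E := LinearMap.id - P'
    have hQ : ∀ x, Q x = x - P' x := fun x => rfl
    have hQσ : ∀ x, Q x = x + (-σ x).1 := fun x => by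
      rw [hQ, Prod.fst_neg, hσ1, sub_eq_add_neg]
    have hnσ : ∀ x, P (-σ x) = 0 := fun x => by rw [map_neg, hσP, neg_zero]
    have hQQ : ∀ x, Q (Q x) = Q x := fun x => by
      rw [hQ (Q x), hQ x, map_sub, hP'P', sub_self, sub_zero]
    have hQL : ∀ x ∈ L, Q x ∈ L := fun x hx => L.sub_mem hx (hP'L x hx)
    have hQadd : ∀ x, Q x + (σ x).1 = x := fun x => by rw [hQ, hσ1, sub_add_cancel]
    have hQX : ∀ x, x ∈ X ↔ Q x ∈ X := fun x =>
      ⟨fun hx => by rw [hQσ]; exact (hφk x hx _ (hnσ x)).1,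
        fun hx => by have := (hφk _ hx _ (hσP x)).1; rwa [hQadd] at this⟩
    have hQD : ∀ x, x ∈ D ↔ Q x ∈ D := fun x =>
      ⟨fun hx => by rw [hQσ]; exact hDk x hx _ (hnσ x),
        fun hx => by have := hDk _ hx _ (hσP x); rwa [hQadd] at this⟩
    -- Both slices are transversal to the kernel of `P`. One passes from a point fixed by `P` to one
    -- over the `Q`-slice by moving along the kernel, and `P` itself moves back.
    have hiso : SetIso (L.prod (AddSubgroup.zmultiples (1 : ℝ)))
        {p | p ∈ Trop.modSet X φ D ∧ P p = p} (L.prod (AddSubgroup.zmultiples (1 : ℝ)))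
        (Trop.modSet {x | x ∈ X ∧ Q x = x} φ {x | x ∈ D ∧ Q x = x})
        (LinearMap.id - σ ∘ₗ LinearMap.fst ℝ E ℝ) P := by
      have hN : ∀ q, q ∈ Trop.modSet {x | x ∈ X ∧ Q x = x} φ {x | x ∈ D ∧ Q x = x} ↔
          q ∈ Trop.modSet X φ D ∧ Q q.1 = q.1 := fun q => by
        constructor
        · rintro (⟨⟨h1, h2⟩, h3⟩ | ⟨⟨h1, h2⟩, h3⟩)
          exacts [⟨.inl ⟨h1, h3⟩, h2⟩, ⟨.inr ⟨h1, h3⟩, h2⟩]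
        · rintro ⟨⟨h1, h3⟩ | ⟨h1, h3⟩, h2⟩
          exacts [.inl ⟨⟨h1, h2⟩, h3⟩, .inr ⟨⟨h1, h2⟩, h3⟩]
      have hf : ∀ p : E × ℝ, (LinearMap.id - σ ∘ₗ LinearMap.fst ℝ E ℝ : E × ℝ →ₗ[ℝ] E × ℝ) p = p + -σ p.1 :=
        fun p => sub_eq_add_neg _ _
      refine ⟨fun p hp => AddSubgroup.sub_mem _ hp (hσL _ hp.1), hPL, fun p hp => (hN _).2 ?_,
        fun q hq => ⟨(hinv q).1 ((hN q).1 hq).1, hP q⟩, fun p hp => ?_, fun q hq => ?_⟩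
      · rw [hf]
        refine ⟨hadd p hp.1 _ (hnσ _), ?_⟩
        rw [Prod.fst_add, ← hQσ, hQQ]
      · rw [hf, map_add, hnσ, add_zero, hp.2]
      · have h1 := ((hN q).1 hq).2
        rw [hQ, sub_eq_self] at h1
        have h2 : σ q.1 = 0 := hgr _ (hσP _) (by rw [hσ1, h1])
        have h3 : P (q - P q) = 0 := by rw [map_sub, hP, sub_self]
        have h4 := hσk _ h3
        rw [Prod.fst_sub, map_sub, h2, zero_sub] at h4
        rw [hf, h4, add_sub_cancel]
    refine QLs.of_setIso hLZ ?_ hiso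
    have hrank : Module.finrank ℝ (LinearMap.ker Q) = Module.finrank ℝ (LinearMap.ker P) := by
      have : LinearMap.ker Q = LinearMap.range fK := by
        ext x
        rw [LinearMap.mem_ker, hQ, sub_eq_zero]
        exact ⟨fun h => by rw [h]; exact hP'1 x, fun h => (hP'2 x h).symm⟩
      rw [this, LinearMap.finrank_range_of_inj hfK]
    obtain ⟨k1, A1, hA1⟩ := TropSet.slice hL hQQ hQL hQX hX.nonempty ⟨A, hXA⟩
    obtain ⟨k2, A2, hA2⟩ := TropSet.slice hL hQQ hQL hQD hD.nonempty ⟨A, hDA⟩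
    obtain ⟨-, hM1⟩ := TropSet.slice hLZ hP hPL hinv ⟨0, h0⟩ hM
    have hM2 := hiso.tropSet hLZ hLZ hM1
    rw [← hrank] at hM2
    have hA3 := (hA1.arr.union hA2.arr).union hXA.arr
    exact (ih hQQ hQL hQX).modSet (ih' hQQ hQL hQD)
      (hA1.mono hL hA3 (Set.subset_union_left.trans Set.subset_union_left))
      (hA2.mono hL hA3 (Set.subset_union_right.trans Set.subset_union_left))
      (fun x hx => ⟨hDX hx.1, hx.2⟩) (by omega)
      ((h.mono Set.subset_union_right).subset fun x hx => hx.1) hM2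

end Trop

namespace Trop

open Filter Topology

/-! ### Quotient lattices -/

section Quotients

variable {E : Type*} [AddCommGroup E] [Module ℝ E] {L : AddSubgroup E} {W : Submodule ℝ E}

/-- The section of the quotient by the image of a projection. -/
noncomputable def quotientSection (Q : E →ₗ[ℝ] E) (hQ : ∀ x ∈ W, Q x = x) : E ⧸ W →ₗ[ℝ] E :=
  W.liftQ (LinearMap.id - Q) fun x hx => by simp [hQ x hx]

lemma quotientSection_mkQ {Q : E →ₗ[ℝ] E} (hQ : ∀ x ∈ W, Q x = x) (x : E) :
    quotientSection Q hQ (W.mkQ x) = x - Q x := rfl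

/-- The quotient of a lattice by a rational subspace is a lattice. -/
lemma IsLattice.map_mkQ (hL : IsLattice L) (hW : IsRational L W) :
    IsLattice (L.map W.mkQ.toAddMonoidHom) := by
  obtain ⟨Q, hQW, hQ, hQL⟩ := hL.exists_projection hW
  obtain ⟨C, hC, hsep⟩ := hL.exists_separating
  refine isLattice_of_separating (C := (fun c => c ∘ₗ quotientSection Q hQ) '' C) ?_
    (hC.comp ?_) fun v hv => ?_
  · have := congr_arg (Submodule.map W.mkQ) hL.span_eq_top
    rwa [Submodule.map_span, Submodule.map_top, Submodule.range_mkQ] at this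
  · rintro _ ⟨x, hx, rfl⟩
    exact L.sub_mem hx (hQL x hx)
  · obtain ⟨x, rfl⟩ := W.mkQ_surjective v
    have h1 : x - Q x = 0 := hsep _ fun c hc => hv _ ⟨c, hc, rfl⟩
    rw [← LinearMap.mem_ker, Submodule.ker_mkQ, sub_eq_zero.1 h1]
    exact hQW x

end Quotients

/-! ### Images of cones in the quotient by the span of a face -/

section StarCones

variable {E : Type*} [AddCommGroup E] [Module ℝ E] {L : AddSubgroup E}
  {σ τ τ' : PointedCone ℝ E} {v : E}

lemma exists_sub_of_mem_coneSpan (hv : v ∈ coneSpan σ) : ∃ a ∈ σ, ∃ b ∈ σ, v = a - b := by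
  induction hv using Submodule.span_induction with
  | mem x hx => exact ⟨x, hx, 0, zero_mem _, (sub_zero x).symm⟩
  | zero => exact ⟨0, zero_mem _, 0, zero_mem _, (sub_zero 0).symm⟩
  | add x y _ _ hx hy =>
    obtain ⟨a, ha, b, hb, rfl⟩ := hx
    obtain ⟨a', ha', b', hb', rfl⟩ := hy
    exact ⟨a + a', add_mem ha ha', b + b', add_mem hb hb', by abel⟩
  | smul c x _ hx =>
    obtain ⟨a, ha, b, hb, rfl⟩ := hx
    rcases le_total 0 c with hc | hc
    · exact ⟨c • a, σ.smul_mem hc ha, c • b, σ.smul_mem hc hb, smul_sub _ _ _⟩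
    · exact ⟨-c • b, σ.smul_mem (neg_nonneg.2 hc) hb, -c • a, σ.smul_mem (neg_nonneg.2 hc) ha,
        by rw [smul_sub, neg_smul, neg_smul]; abel⟩

/-- Vectors of the span of `σ` are differences of vectors of `σ`, and the subtracted ones are
absorbed by `τ`. -/
lemma mkQ_mem_map_iff (h : σ ≤ τ) :
    (coneSpan σ).mkQ v ∈ τ.map (coneSpan σ).mkQ ↔ ∃ s ∈ σ, v + s ∈ τ := by
  rw [PointedCone.mem_map]
  constructor
  · rintro ⟨t, ht, htv⟩
    obtain ⟨a, ha, b, hb, hab⟩ := exists_sub_of_mem_coneSpan ((Submodule.Quotient.eq _).1 htv)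
    refine ⟨a, ha, ?_⟩
    have : v + a = t + b := by rw [sub_eq_iff_eq_add.1 hab]; abel
    rw [this]
    exact add_mem ht (h hb)
  · rintro ⟨s, hs, hvs⟩
    refine ⟨_, hvs, ?_⟩
    rw [map_add, add_eq_left]
    exact (Submodule.Quotient.mk_eq_zero _).2 (mem_coneSpan hs)

lemma map_mkQ_inf (h : σ ≤ τ) (h' : σ ≤ τ') : (τ ⊓ τ').map (coneSpan σ).mkQ =
    τ.map (coneSpan σ).mkQ ⊓ τ'.map (coneSpan σ).mkQ := by
  ext q
  obtain ⟨v, rfl⟩ := (coneSpan σ).mkQ_surjective q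
  rw [Submodule.mem_inf, mkQ_mem_map_iff h, mkQ_mem_map_iff h', mkQ_mem_map_iff (le_inf h h')]
  constructor
  · rintro ⟨s, hs, hv⟩
    exact ⟨⟨s, hs, hv.1⟩, s, hs, hv.2⟩
  · rintro ⟨⟨s, hs, hv⟩, s', hs', hv'⟩
    refine ⟨s + s', add_mem hs hs', ?_, ?_⟩
    · rw [← add_assoc]; exact add_mem hv (h hs')
    · rw [add_comm s, ← add_assoc]; exact add_mem hv' (h' hs)

lemma isFaceOf_map_mkQ (h : σ ≤ τ') (hτ : τ'.IsFaceOf τ) :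
    (τ'.map (coneSpan σ).mkQ).IsFaceOf (τ.map (coneSpan σ).mkQ) := by
  refine ⟨Submodule.map_mono hτ.le, ?_⟩
  rintro _ _ a ⟨x, hx, rfl⟩ ⟨y, hy, rfl⟩ ha hxy
  have hxy' : (coneSpan σ).mkQ (a • x + y) ∈ τ'.map (coneSpan σ).mkQ := hxy
  rw [mkQ_mem_map_iff h] at hxy'
  obtain ⟨s, hs, hm⟩ := hxy'
  rw [add_assoc] at hm
  exact ⟨x, hτ.mem_of_smul_add_mem hx (add_mem hy (hτ.le (h hs))) ha hm, rfl⟩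

/-- Take the points of `τ` that map into `ρ`; they include `σ`, which maps to zero. -/
lemma exists_of_isFaceOf_map_mkQ {ρ : PointedCone ℝ (E ⧸ coneSpan σ)} (h : σ ≤ τ)
    (hρ : ρ.IsFaceOf (τ.map (coneSpan σ).mkQ)) :
    ∃ τ' : PointedCone ℝ E, τ'.IsFaceOf τ ∧ σ ≤ τ' ∧ ρ = τ'.map (coneSpan σ).mkQ := by
  refine ⟨ρ.comap (coneSpan σ).mkQ ⊓ τ, ⟨inf_le_right, ?_⟩, le_inf (fun s hs => ?_) h, ?_⟩
  · intro x y a hx hy ha hxy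
    refine ⟨hρ.mem_of_smul_add_mem (x := (coneSpan σ).mkQ x) (y := (coneSpan σ).mkQ y)
      ⟨x, hx, rfl⟩ ⟨y, hy, rfl⟩ ha hxy.1, hx⟩
  · have : (coneSpan σ).mkQ s = 0 := (Submodule.Quotient.mk_eq_zero _).2 (mem_coneSpan hs)
    rw [PointedCone.mem_comap, this]
    exact zero_mem ρ
  · refine le_antisymm (fun q hq => ?_) ?_
    · obtain ⟨t, ht, rfl⟩ := hρ.le hq
      exact ⟨t, ⟨hq, ht⟩, rfl⟩
    · rintro _ ⟨t, ht, rfl⟩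
      exact ht.1

lemma IsRationalCone.map_mkQ (hτ : IsRationalCone L τ) (hσ : σ.IsFaceOf τ) :
    IsRationalCone (L.map (coneSpan σ).mkQ.toAddMonoidHom) (τ.map (coneSpan σ).mkQ) := by
  constructor
  · obtain ⟨s, hs, hsL, rfl⟩ := hτ.generated
    refine ⟨(coneSpan σ).mkQ '' s, hs.image _, ?_, Submodule.map_span _ _⟩
    rintro _ ⟨x, hx, rfl⟩
    exact ⟨x, hsL hx, rfl⟩
  · intro q hq hq'
    obtain ⟨v, rfl⟩ := (coneSpan σ).mkQ_surjective q
    rw [← map_neg, mkQ_mem_map_iff hσ.le] at hq'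
    rw [mkQ_mem_map_iff hσ.le] at hq
    obtain ⟨s, hs, hv⟩ := hq
    obtain ⟨s', hs', hv'⟩ := hq'
    have := hσ.mem_of_add_mem_left hv hv' (by
      rw [add_add_add_comm, add_neg_cancel, zero_add]; exact add_mem hs hs')
    have := sub_mem (mem_coneSpan this) (mem_coneSpan hs)
    rw [add_sub_cancel_right] at this
    exact (Submodule.Quotient.mk_eq_zero _).2 this

lemma coneDim_map_mkQ [FiniteDimensional ℝ E] (h : σ ≤ τ) :
    coneDim (τ.map (coneSpan σ).mkQ) + coneDim σ = coneDim τ := by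
  have hW : coneSpan σ ≤ coneSpan τ := Submodule.span_mono h
  have h1 : coneSpan (τ.map (coneSpan σ).mkQ) =
      LinearMap.range ((coneSpan σ).mkQ.domRestrict (coneSpan τ)) := by
    rw [LinearMap.range_domRestrict, coneSpan.eq_1 τ, Submodule.map_span]
    rfl
  have h2 := LinearMap.finrank_range_add_finrank_ker ((coneSpan σ).mkQ.domRestrict (coneSpan τ))
  have h3 : LinearMap.ker ((coneSpan σ).mkQ.domRestrict (coneSpan τ)) =
      (coneSpan σ).comap (coneSpan τ).subtype := by
    rw [LinearMap.ker_domRestrict, Submodule.ker_mkQ]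
  rw [h3, (Submodule.comapSubtypeEquivOfLe hW).finrank_eq, ← h1] at h2
  exact h2

end StarCones

namespace WeightedFan

/-! ### Star fans -/

section Star

variable {E : Type*} [AddCommGroup E] [Module ℝ E] {L : AddSubgroup E} {S : WeightedFan L}
  {σ τ τ' : PointedCone ℝ E} {x v : E}

/-- A point `t` of `τ` becomes a point of `τ'` after adding some `s` in `σ`. The sum lies in the
common face, so `t` does too. -/
lemma IsFan.map_mkQ_injective (hS : S.IsFan) (hτ : τ ∈ S.cones) (hτ' : τ' ∈ S.cones)
    (h : σ ≤ τ) (h' : σ ≤ τ') (heq : τ.map (coneSpan σ).mkQ = τ'.map (coneSpan σ).mkQ) :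
    τ = τ' := by
  have key : ∀ {τ τ' : PointedCone ℝ E}, τ ∈ S.cones → τ' ∈ S.cones → σ ≤ τ → σ ≤ τ' →
      τ.map (coneSpan σ).mkQ = τ'.map (coneSpan σ).mkQ → τ ≤ τ' := by
    intro τ τ' hτ hτ' h h' heq t ht
    obtain ⟨s, hs, hm⟩ := (mkQ_mem_map_iff h').1 (by rw [← heq]; exact ⟨t, ht, rfl⟩)
    exact ((hS.inter_face τ hτ τ' hτ').mem_of_add_mem_left ht (h hs)
      ⟨add_mem ht (h hs), hm⟩).2
  exact le_antisymm (key hτ hτ' h h' heq) (key hτ' hτ h' h heq.symm)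

lemma IsFan.star_isFan (hS : S.IsFan) (hσ : σ ∈ S.cones) : (S.star σ).IsFan where
  finite := (hS.finite.image fun τ => τ.map (coneSpan σ).mkQ).subset <| by
    rintro _ ⟨τ, hτ, -, rfl⟩
    exact ⟨τ, hτ, rfl⟩
  nonempty := ⟨_, σ, hσ, le_rfl, rfl⟩
  rational := by
    rintro _ ⟨τ, hτ, h, rfl⟩
    exact (hS.rational τ hτ).map_mkQ (hS.isFaceOf_of_le hσ hτ h)
  face_mem := by
    rintro _ ⟨τ, hτ, h, rfl⟩ ρ hρ
    obtain ⟨τ', hτ', h', rfl⟩ := exists_of_isFaceOf_map_mkQ h hρ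
    exact ⟨τ', hS.face_mem τ hτ τ' hτ', h', rfl⟩
  inter_face := by
    rintro _ ⟨τ, hτ, h, rfl⟩ _ ⟨τ', hτ', h', rfl⟩
    rw [← map_mkQ_inf h h']
    exact isFaceOf_map_mkQ (le_inf h h') (hS.inter_face τ hτ τ' hτ')

lemma star_mem_topCones_iff (hL : IsLattice L) (hpure : S.IsPure) (hσ : σ ∈ S.cones)
    (h : σ ≤ τ) (hτ : τ ∈ S.cones) :
    τ.map (coneSpan σ).mkQ ∈ (S.star σ).topCones ↔ τ ∈ S.topCones := by
  have := hL.finiteDimensional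
  have h1 := coneDim_map_mkQ h
  have h2 := IsFan.coneDim_le hL hpure hσ
  have h3 : (S.star σ).dim = S.dim - coneDim σ := rfl
  constructor
  · rintro ⟨-, h4⟩
    exact ⟨hτ, by omega⟩
  · rintro ⟨-, h4⟩
    exact ⟨⟨τ, hτ, h, rfl⟩, by omega⟩

lemma IsPure.star (hL : IsLattice L) (hpure : S.IsPure) (hσ : σ ∈ S.cones) :
    (S.star σ).IsPure := by
  rintro _ ⟨τ, hτ, h, rfl⟩
  obtain ⟨τ', hτ', hface⟩ := hpure τ hτ
  exact ⟨_, (star_mem_topCones_iff hL hpure hσ (h.trans hface.le) hτ'.1).2 hτ',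
    isFaceOf_map_mkQ h hface⟩

lemma IsFan.star_isReduced (hL : IsLattice L) (hS : S.IsFan) (hpure : S.IsPure)
    (hred : S.IsReduced) (hσ : σ ∈ S.cones) : (S.star σ).IsReduced := by
  intro c hc
  obtain ⟨τ, hτ, h, rfl⟩ := hc.1
  have : {τ' | τ' ∈ S.cones ∧ σ ≤ τ' ∧ τ.map (coneSpan σ).mkQ = τ'.map (coneSpan σ).mkQ} = {τ} :=
    Set.eq_singleton_iff_unique_mem.2 ⟨⟨hτ, h, rfl⟩, fun τ' h' =>
      (hS.map_mkQ_injective hτ h'.1 h h'.2.1 h'.2.2).symm⟩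
  change ∑ᶠ τ' ∈ {τ' | τ' ∈ S.cones ∧ σ ≤ τ' ∧
    τ.map (coneSpan σ).mkQ = τ'.map (coneSpan σ).mkQ}, S.weight τ' = 1
  rw [this, finsum_mem_singleton]
  exact hred τ ((star_mem_topCones_iff hL hpure hσ h hτ).1 hc)

/-- If `v + s` lies in `τ`, then `x + t v = (x - t s) + t (v + s)` does for small `t`, as `x` is
interior to `σ`. Conversely, if `x + t v` lies in `τ`, divide by `t`. -/
lemma IsFan.mkQ_mem_star_support (hL : IsLattice L) (hS : S.IsFan) (hpure : S.IsPure)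
    (hσ : σ ∈ S.cones) (hx : InRelInterior σ x) :
    (coneSpan σ).mkQ v ∈ (S.star σ).support ↔ v ∈ Loc S.support x := by
  constructor
  · rintro ⟨_, ⟨τ, hτ, h, rfl⟩, hv⟩
    obtain ⟨s, hs, hm⟩ := (mkQ_mem_map_iff h).1 hv
    have hs' := (hS.rational σ hσ).ev_mem hL hx (neg_mem (mem_coneSpan hs))
    refine mem_loc.2 ((hs'.and ev_pos).mono fun t ⟨h1, h2⟩ => ⟨τ, hτ, ?_⟩)
    have : x + t • v = x + t • -s + t • (v + s) := by module
    rw [this]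
    exact add_mem (h h1) (τ.smul_mem h2.le hm)
  · intro hv
    obtain ⟨τ, hτ, t, ht, hm⟩ := hS.exists_topCone_of_loc hL hpure hσ hx hv
    refine ⟨_, ⟨τ, hτ.1.1, hτ.2.le, rfl⟩, (mkQ_mem_map_iff hτ.2.le).2 ⟨t⁻¹ • x,
      σ.smul_mem (inv_nonneg.2 ht.le) hx.1, ?_⟩⟩
    have := τ.smul_mem (inv_nonneg.2 ht.le) hm
    rwa [smul_add, smul_smul, inv_mul_cancel₀ ht.ne', one_smul, add_comm] at this

end Star

/-- Star fans of quasilinear fans are quasilinear. -/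
theorem IsQuasilinear.star {E : Type u} [AddCommGroup E] [Module ℝ E] {L : AddSubgroup E}
    {S : WeightedFan L} (h : S.IsQuasilinear) {σ : PointedCone ℝ E} (hσ : σ ∈ S.cones) :
    (S.star σ).IsQuasilinear := by
  have hS := h.isTropical
  have hL := hS.lattice
  have hrat := hS.isFan.rational σ hσ
  have hW := hrat.isRational
  obtain ⟨x, hx⟩ := hrat.exists_relInterior hL
  obtain ⟨Q, hQW, hQ, hQL⟩ := hL.exists_projection hW
  have hmem : ∀ v, (coneSpan σ).mkQ v ∈ (S.star σ).support ↔ v ∈ Loc S.support x := fun v =>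
    hS.isFan.mkQ_mem_star_support hL hS.pure hσ hx
  have hmk : ∀ v, (coneSpan σ).mkQ (v - Q v) = (coneSpan σ).mkQ v := fun v => by
    rw [map_sub, sub_eq_self]
    exact (Submodule.Quotient.mk_eq_zero _).2 (hQW v)
  have hQQ : ∀ v, Q (v - Q v) = 0 := fun v => by rw [map_sub, hQ _ (hQW v), sub_self]
  -- The kernel of `P` is the span of `σ`, under which the local cone is invariant. The slice fixed
  -- by `P` is a model of the star fan in `E`.
  let P : E →ₗ[ℝ] E := LinearMap.id - Q
  have hloc := (QLs.loc_and_hl ⟨S, h, rfl⟩ x ⟨σ, hσ, hx.1⟩).1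
  have hP : ∀ v, P (P v) = P v := fun v => by
    change v - Q v - Q (v - Q v) = v - Q v
    rw [hQQ, sub_zero]
  have hPL : ∀ v ∈ L, P v ∈ L := fun v hv => L.sub_mem hv (hQL v hv)
  have hinv : ∀ v, v ∈ Loc S.support x ↔ P v ∈ Loc S.support x := fun v => by
    rw [← hmem, ← hmem, ← hmk]
    rfl
  have hker : LinearMap.ker P = coneSpan σ := by
    ext v
    rw [LinearMap.mem_ker]
    change v - Q v = 0 ↔ _
    rw [sub_eq_zero]
    exact ⟨fun h => by rw [h]; exact hQW v, fun h => (hQ v h).symm⟩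
  have hiso : SetIso (L.map (coneSpan σ).mkQ.toAddMonoidHom) (S.star σ).support L
      {v | v ∈ Loc S.support x ∧ P v = v} (quotientSection Q hQ)
      (coneSpan σ).mkQ := by
    refine ⟨?_, fun v hv => ⟨v, hv, rfl⟩, fun q hq => ?_, fun v hv => (hmem v).2 hv.1,
      fun q _ => ?_, fun v hv => hv.2⟩
    · rintro _ ⟨v, hv, rfl⟩
      exact L.sub_mem hv (hQL v hv)
    · obtain ⟨v, rfl⟩ := (coneSpan σ).mkQ_surjective q
      rw [quotientSection_mkQ]
      exact ⟨(hmem _).1 (by rwa [hmk]), hP v⟩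
    · obtain ⟨v, rfl⟩ := (coneSpan σ).mkQ_surjective q
      rw [quotientSection_mkQ, hmk]
  have hL' := hL.map_mkQ hW
  have hX := QLs.of_setIso hL' (hloc.slice hP hPL hinv) hiso
  have hfan := hS.isFan.star_isFan hσ
  have hpure := IsPure.star hL hS.pure hσ
  have hred := hS.isFan.star_isReduced hL hS.pure h.isReduced hσ
  refine hX.isQuasilinear (hfan.isTropical hL' hpure hred ?_) hred
  have := (TropSet.slice hL hP hPL hinv hloc.nonempty ((hS.tropSet h.isReduced).loc x)).2
  rw [hker] at this
  exact hiso.symm.tropSet hL hL' this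

end WeightedFan

end Trop

namespace Trop

/-! ### Products of cones -/

section ProductCones

variable {E E' : Type*} [AddCommGroup E] [Module ℝ E] [AddCommGroup E'] [Module ℝ E']
  {L : AddSubgroup E} {L' : AddSubgroup E'} {σ τ : PointedCone ℝ E} {σ' τ' : PointedCone ℝ E'}

lemma IsFaceOf_prod (h : τ.IsFaceOf σ) (h' : τ'.IsFaceOf σ') :
    PointedCone.IsFaceOf (Submodule.prod τ τ') (Submodule.prod σ σ') :=
  ⟨Submodule.prod_mono h.le h'.le, fun hx hy ha hxy =>
    ⟨h.mem_of_smul_add_mem hx.1 hy.1 ha hxy.1, h'.mem_of_smul_add_mem hx.2 hy.2 ha hxy.2⟩⟩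

/-- A point `(x, y)` of a face is the sum of `(x, 0)` and `(0, y)`, which both lie in the product
cone and hence in the face. -/
lemma exists_of_isFaceOf_prod {F : PointedCone ℝ (E × E')}
    (hF : F.IsFaceOf (Submodule.prod σ σ')) :
    ∃ (τ : PointedCone ℝ E) (τ' : PointedCone ℝ E'), τ.IsFaceOf σ ∧ τ'.IsFaceOf σ' ∧ F = Submodule.prod τ τ' := by
  refine ⟨F.comap (LinearMap.inl ℝ E E'), F.comap (LinearMap.inr ℝ E E'),
    ⟨fun x hx => (hF.le hx).1, @fun x y a hx hy ha hxy => ?_⟩,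
    ⟨fun x hx => (hF.le hx).2, @fun x y a hx hy ha hxy => ?_⟩, ?_⟩
  · refine hF.mem_of_smul_add_mem (x := (x, 0)) (y := (y, 0)) ⟨hx, zero_mem _⟩ ⟨hy, zero_mem _⟩ ha ?_
    simpa using hxy
  · refine hF.mem_of_smul_add_mem (x := (0, x)) (y := (0, y)) ⟨zero_mem _, hx⟩ ⟨zero_mem _, hy⟩ ha ?_
    simpa using hxy
  · ext ⟨x, y⟩
    have hsplit : ((x, y) : E × E') = (x, 0) + (0, y) := by simp
    constructor
    · intro h
      obtain ⟨h1, h2⟩ := hF.le h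
      rw [hsplit] at h
      have h3 : (x, (0 : E')) ∈ Submodule.prod σ σ' := ⟨h1, zero_mem _⟩
      have h4 : ((0 : E), y) ∈ Submodule.prod σ σ' := ⟨zero_mem _, h2⟩
      exact ⟨hF.mem_of_add_mem_left h3 h4 h, hF.mem_of_add_mem_right h3 h4 h⟩
    · rintro ⟨h1, h2⟩
      rw [hsplit]
      exact add_mem h1 h2

lemma prod_hull (s : Set E) (s' : Set E') :
    Submodule.prod (PointedCone.hull ℝ s) (PointedCone.hull ℝ s') =
      PointedCone.hull ℝ (LinearMap.inl ℝ E E' '' s ∪ LinearMap.inr ℝ E E' '' s') := by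
  rw [PointedCone.hull, PointedCone.hull, PointedCone.hull, Submodule.span_union]
  refine le_antisymm ?_ (sup_le (Submodule.span_le.2 ?_) (Submodule.span_le.2 ?_))
  · rintro ⟨x, y⟩ ⟨hx, hy⟩
    have h1 : LinearMap.inl ℝ E E' x ∈ PointedCone.map (LinearMap.inl ℝ E E') (.hull ℝ s) :=
      ⟨x, hx, rfl⟩
    have h2 : LinearMap.inr ℝ E E' y ∈ PointedCone.map (LinearMap.inr ℝ E E') (.hull ℝ s') :=
      ⟨y, hy, rfl⟩
    rw [PointedCone.map, PointedCone.hull, Submodule.map_span] at h1 h2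
    exact Submodule.mem_sup.2 ⟨_, h1, _, h2, by simp⟩
  · rintro _ ⟨x, hx, rfl⟩
    exact ⟨Submodule.subset_span hx, zero_mem _⟩
  · rintro _ ⟨x, hx, rfl⟩
    exact ⟨zero_mem _, Submodule.subset_span hx⟩

lemma IsRationalCone.prod (hσ : IsRationalCone L σ) (hσ' : IsRationalCone L' σ') :
    IsRationalCone (L.prod L') (Submodule.prod σ σ') := by
  constructor
  · obtain ⟨s, hs, hsL, rfl⟩ := hσ.generated
    obtain ⟨s', hs', hsL', rfl⟩ := hσ'.generated
    refine ⟨_, (hs.image _).union (hs'.image _), ?_, prod_hull s s'⟩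
    rintro _ (⟨x, hx, rfl⟩ | ⟨x, hx, rfl⟩)
    exacts [⟨hsL hx, zero_mem _⟩, ⟨zero_mem _, hsL' hx⟩]
  · exact fun p hp hp' => Prod.ext (hσ.salient _ hp.1 hp'.1) (hσ'.salient _ hp.2 hp'.2)

lemma coneDim_prod [FiniteDimensional ℝ E] [FiniteDimensional ℝ E'] :
    coneDim (Submodule.prod σ σ' : PointedCone ℝ (E × E')) = coneDim σ + coneDim σ' := by
  have : coneSpan (Submodule.prod σ σ' : PointedCone ℝ (E × E')) =
      (coneSpan σ).prod (coneSpan σ') := by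
    refine le_antisymm (Submodule.span_le.2 fun p hp => ⟨mem_coneSpan hp.1, mem_coneSpan hp.2⟩) ?_
    rw [coneSpan, coneSpan, ← LinearMap.span_inl_union_inr]
    refine Submodule.span_mono ?_
    rintro _ (⟨x, hx, rfl⟩ | ⟨x, hx, rfl⟩)
    exacts [⟨hx, zero_mem _⟩, ⟨zero_mem _, hx⟩]
  rw [coneDim, this, finrank_submodule_prod]
  rfl

end ProductCones

namespace WeightedFan

/-! ### Products of fans and stable invariance -/

section Products

variable {E E' : Type*} [AddCommGroup E] [Module ℝ E] [AddCommGroup E'] [Module ℝ E']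
  {L : AddSubgroup E} {L' : AddSubgroup E'} {S : WeightedFan L} {D : WeightedFan L'}

lemma prod_support : (S.prod D).support = S.support ×ˢ D.support := by
  ext p
  constructor
  · rintro ⟨_, ⟨σ, hσ, σ', hσ', rfl⟩, hp⟩
    exact ⟨⟨σ, hσ, hp.1⟩, σ', hσ', hp.2⟩
  · rintro ⟨⟨σ, hσ, h⟩, σ', hσ', h'⟩
    exact ⟨_, ⟨σ, hσ, σ', hσ', rfl⟩, h, h'⟩

lemma IsFan.prod (hS : S.IsFan) (hD : D.IsFan) : (S.prod D).IsFan where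
  finite := (Set.Finite.image2 (fun σ σ' => Submodule.prod σ σ') hS.finite hD.finite).subset <| by
    rintro _ ⟨σ, hσ, σ', hσ', rfl⟩
    exact ⟨σ, hσ, σ', hσ', rfl⟩
  nonempty := by
    obtain ⟨σ, hσ⟩ := hS.nonempty
    obtain ⟨σ', hσ'⟩ := hD.nonempty
    exact ⟨_, σ, hσ, σ', hσ', rfl⟩
  rational := by
    rintro _ ⟨σ, hσ, σ', hσ', rfl⟩
    exact (hS.rational σ hσ).prod (hD.rational σ' hσ')
  face_mem := by
    rintro _ ⟨σ, hσ, σ', hσ', rfl⟩ F hF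
    obtain ⟨τ, τ', hτ, hτ', rfl⟩ := exists_of_isFaceOf_prod hF
    exact ⟨τ, hS.face_mem σ hσ τ hτ, τ', hD.face_mem σ' hσ' τ' hτ', rfl⟩
  inter_face := by
    rintro _ ⟨σ, hσ, σ', hσ', rfl⟩ _ ⟨τ, hτ, τ', hτ', rfl⟩
    rw [Submodule.prod_inf_prod]
    exact IsFaceOf_prod (hS.inter_face σ hσ τ hτ) (hD.inter_face σ' hσ' τ' hτ')

lemma prod_mem_topCones (hL : IsLattice L) (hL' : IsLattice L') {σ : PointedCone ℝ E}
    {σ' : PointedCone ℝ E'} (hσ : σ ∈ S.topCones) (hσ' : σ' ∈ D.topCones) :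
    Submodule.prod σ σ' ∈ (S.prod D).topCones := by
  have := hL.finiteDimensional
  have := hL'.finiteDimensional
  exact ⟨⟨σ, hσ.1, σ', hσ'.1, rfl⟩, by rw [coneDim_prod, hσ.2, hσ'.2]; rfl⟩

lemma prod_weight (σ : PointedCone ℝ E) (σ' : PointedCone ℝ E') :
    (S.prod D).weight (Submodule.prod σ σ') = S.weight σ * D.weight σ' := by
  have h1 : PointedCone.map (LinearMap.fst ℝ E E') (Submodule.prod σ σ') = σ :=
    Submodule.prod_map_fst σ σ'
  have h2 : PointedCone.map (LinearMap.snd ℝ E E') (Submodule.prod σ σ') = σ' :=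
    Submodule.prod_map_snd σ σ'
  change S.weight _ * D.weight _ = _
  rw [h1, h2]

lemma IsPure.prod (hL : IsLattice L) (hL' : IsLattice L') (hS : S.IsPure) (hD : D.IsPure) :
    (S.prod D).IsPure := by
  rintro _ ⟨σ, hσ, σ', hσ', rfl⟩
  obtain ⟨τ, hτ, h⟩ := hS σ hσ
  obtain ⟨τ', hτ', h'⟩ := hD σ' hσ'
  exact ⟨_, prod_mem_topCones hL hL' hτ hτ', IsFaceOf_prod h h'⟩

lemma prod_isReduced (hL : IsLattice L) (hL' : IsLattice L') (hS : S.IsPure) (hD : D.IsPure)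
    (hSr : S.IsReduced) (hDr : D.IsReduced) : (S.prod D).IsReduced := by
  have := hL.finiteDimensional
  have := hL'.finiteDimensional
  rintro _ ⟨⟨σ, hσ, σ', hσ', rfl⟩, hd⟩
  rw [coneDim_prod] at hd
  have h1 := IsFan.coneDim_le hL hS hσ
  have h2 := IsFan.coneDim_le hL' hD hσ'
  have h3 : (S.prod D).dim = S.dim + D.dim := rfl
  rw [prod_weight, hSr σ ⟨hσ, by omega⟩, hDr σ' ⟨hσ', by omega⟩, one_mul]

lemma IsTropical.exists_topCone (hS : S.IsTropical) : ∃ σ, σ ∈ S.topCones := by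
  obtain ⟨σ, hσ⟩ := hS.isFan.nonempty
  obtain ⟨σ', hσ', -⟩ := hS.pure σ hσ
  exact ⟨σ', hσ'⟩

lemma isReduced_of_prod (hL : IsLattice L) (hD : D.IsTropical) (hDr : D.IsReduced)
    (h : (S.prod D).IsReduced) : S.IsReduced := by
  intro σ hσ
  obtain ⟨σ', hσ'⟩ := hD.exists_topCone
  have := h _ (prod_mem_topCones hL hD.lattice hσ hσ')
  rwa [prod_weight, hDr σ' hσ', mul_one] at this

lemma IsTropical.prod (hS : S.IsTropical) (hSr : S.IsReduced) (hD : D.IsTropical)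
    (hDr : D.IsReduced) (hDc : D.IsComplete) : (S.prod D).IsTropical := by
  have hL := hS.lattice
  have hL' := hD.lattice
  have := hL.finiteDimensional
  have := hL'.finiteDimensional
  refine (hS.isFan.prod hD.isFan).isTropical (hL.prod hL') (IsPure.prod hL hL' hS.pure hD.pure)
    (prod_isReduced hL hL' hS.pure hD.pure hSr hDr) ?_
  have h1 := hD.tropSet hDr
  rw [hDc] at h1
  have h2 : D.dim = Module.finrank ℝ E' :=
    h1.dim_eq hL' ⟨_, tropA_univ L'⟩ Set.univ_nonempty
  rw [prod_support, hDc]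
  change TropSet _ (S.dim + D.dim) _
  rw [h2]
  exact (hS.tropSet hSr).prod_univ L'

end Products

/-- Products of quasilinear fans with complete fans are quasilinear. -/
theorem IsQuasilinear.prod {E E' : Type u} [AddCommGroup E] [Module ℝ E] [AddCommGroup E']
    [Module ℝ E'] {L : AddSubgroup E} {L' : AddSubgroup E'} {S : WeightedFan L}
    {D : WeightedFan L'} (hS : S.IsQuasilinear) (hD : D.IsTropical) (hDr : D.IsReduced)
    (hDc : D.IsComplete) : (S.prod D).IsQuasilinear := by
  have h := QLs.prod_univ ⟨S, hS, rfl⟩ hD.lattice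
  rw [← hDc, ← prod_support] at h
  exact h.isQuasilinear (hS.isTropical.prod hS.isReduced hD hDr hDc)
    (prod_isReduced hS.isTropical.lattice hD.lattice hS.isTropical.pure hD.pure hS.isReduced hDr)

/-- A fan is quasilinear if its product with a complete fan is. -/
theorem IsQuasilinear.of_prod {E E' : Type u} [AddCommGroup E] [Module ℝ E] [AddCommGroup E']
    [Module ℝ E'] {L : AddSubgroup E} {L' : AddSubgroup E'} {S : WeightedFan L}
    {D : WeightedFan L'} (hS : S.IsTropical) (hD : D.IsTropical) (hDr : D.IsReduced)
    (hDc : D.IsComplete) (h : (S.prod D).IsQuasilinear) : S.IsQuasilinear := by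
  have hX : QLs (L.prod L') (S.support ×ˢ (Set.univ : Set E')) :=
    ⟨_, h, by rw [prod_support, hDc]⟩
  -- Slice by the projection that kills the second factor; the slice is a copy of the support of
  -- `S`.
  have hslice := hX.slice (P := LinearMap.inl ℝ E E' ∘ₗ LinearMap.fst ℝ E E') (fun _ => rfl)
    (fun x hx => ⟨hx.1, zero_mem _⟩) fun x => ⟨fun h => ⟨h.1, trivial⟩, fun h => ⟨h.1, trivial⟩⟩
  refine QLs.isQuasilinear (hslice.of_setIso hS.lattice (f := LinearMap.inl ℝ E E')
    (g := LinearMap.fst ℝ E E') ⟨fun x hx => ⟨hx, zero_mem _⟩, fun y hy => hy.1,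
      fun x hx => ⟨⟨hx, trivial⟩, rfl⟩, fun y hy => hy.1.1, fun _ _ => rfl, fun y hy => hy.2⟩) hS
    (isReduced_of_prod hS.lattice hD hDr h.isReduced)

end WeightedFan

end Trop

/-! ### Modifications of quasilinear fans, and the main theorem -/

namespace Trop

namespace WeightedFan

variable {E : Type u} [AddCommGroup E] [Module ℝ E] {L : AddSubgroup E} {S : WeightedFan L}
  {φ : E → ℝ}

/-- Modifications of quasilinear fans along quasilinear divisors are quasilinear. -/
theorem IsQuasilinear.modification_of_divisor (h : S.IsQuasilinear) (hφ : S.IsPiecewiseLinear φ)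
    (hdiv : (S.divisor φ).IsQuasilinear) : (S.modification φ).IsQuasilinear := by
  have hS := h.isTropical
  have hred := h.isReduced
  have hL := hS.lattice
  have hD := hdiv.isTropical
  have hDred := hdiv.isReduced
  obtain ⟨A, B, hA, hAS, hPL⟩ := hS.exists_plw hφ
  have hX := hS.tropA hred hA hAS
  have hDA := hD.tropA hDred hA (hAS.divisor hS.isFan)
  have hDX : (S.divisor φ).support ⊆ S.support := hS.isFan.divisor_support_subset
  have hd : (S.divisor φ).dim + 1 = S.dim := by
    obtain ⟨_, τ, hτ, -, -⟩ := hD.isFan.nonempty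
    have : (S.divisor φ).dim = S.dim - 1 := rfl
    have := hτ.2
    omega
  have hM : TropSet _ _ _ := ⟨_, hPL.tropA_modSet hL hX hDA hDX (fun _ => hd)
    fun x hx => hS.balanced_modification hred hφ hDred hA hAS hx⟩
  have hq := QLs.modSet ⟨S, h, rfl⟩ ⟨_, hdiv, rfl⟩ hX hDA hDX hd hPL hM
  rw [← hS.isFan.modification_support hφ] at hq
  exact hq.isQuasilinear (hS.isFan.modification_isTropical hL hS.pure hred hφ hDred hM)
    (hS.isFan.modification_isReduced hL hred hφ hDred)

/-- Modifications of quasilinear fans along trivial divisors are quasilinear. -/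
theorem IsQuasilinear.modification_of_trivial (h : S.IsQuasilinear) (hφ : S.IsPiecewiseLinear φ)
    (hdiv : S.IsTrivialDivisor φ) : (S.modification φ).IsQuasilinear := by
  have hS := h.isTropical
  have hred := h.isReduced
  have hL := hS.lattice
  have hempty : ∀ ρ, ρ ∉ (S.divisor φ).cones := fun ρ ⟨τ, hτ, hord, _⟩ => hord (hdiv τ hτ)
  have hsupp : (S.divisor φ).support = ∅ :=
    Set.eq_empty_of_forall_notMem fun x ⟨ρ, hρ, _⟩ => hempty ρ hρ
  have hDred : (S.divisor φ).IsReduced := fun ρ hρ => (hempty ρ hρ.1).elim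
  obtain ⟨A, B, hA, hAS, hPL⟩ := hS.exists_plw hφ
  have hX := hS.tropA hred hA hAS
  have hM : TropSet (L.prod (AddSubgroup.zmultiples (1 : ℝ))) S.dim
      (modSet S.support φ (S.divisor φ).support) :=
    ⟨_, hPL.tropA_modSet hL hX (d' := 0) (by rw [hsupp]; exact tropA_empty hA 0)
      (by rw [hsupp]; exact Set.empty_subset _)
      (fun hne => by rw [hsupp] at hne; exact (Set.not_nonempty_empty hne).elim)
      fun x hx => hS.balanced_modification hred hφ hDred hA hAS hx⟩
  have hQ : QLs L S.support := ⟨S, h, rfl⟩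
  have hq : QLs (L.prod (AddSubgroup.zmultiples (1 : ℝ))) (S.modification φ).support := by
    rw [hS.isFan.modification_support hφ, hsupp]
    rw [hsupp] at hM
    -- With trivial divisor the modification is just the graph of `φ`, which is balanced; so `φ` is
    -- linear and the graph is isomorphic to the support of `S`.
    obtain ⟨ℓ, hℓ, H⟩ := hQ.hl _ A B φ hA ⟨A, hX⟩ hPL hM
    exact hQ.of_setIso (hL.prod isLattice_int) (setIso_graph hℓ H)
  exact hq.isQuasilinear (hS.isFan.modification_isTropical hL hS.pure hred hφ hDred hM)
    (hS.isFan.modification_isReduced hL hred hφ hDred)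

theorem quasilinearity_intrinsicToSupport : quasilinearity.{u}.IntrinsicToSupport :=
  fun _ _ _ _ _ _ hS hS' h =>
    ⟨fun hq => .of_support_eq hS' (h.isReduced hq.isReduced) hq h.support_eq.symm,
      fun hq => .of_support_eq hS (h.symm.isReduced hq.isReduced) hq h.support_eq⟩

end WeightedFan

end Trop

theorem mainTheorem6 :
    (∀ (E : Type u) [AddCommGroup E] [Module ℝ E] (L : AddSubgroup E) (S : Trop.WeightedFan L),
      S.IsQuasilinear → ∀ σ ∈ S.cones, (S.star σ).IsQuasilinear) ∧
    Trop.quasilinearity.{u}.IntrinsicToSupport ∧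
    Trop.quasilinearity.{u}.IsLocal ∧
    Trop.quasilinearity.{u}.StablyInvariant ∧
    Trop.quasilinearity.{u}.PreservedByModifications := by
  refine ⟨fun _ _ _ _ _ h _ hσ => h.star hσ, Trop.WeightedFan.quasilinearity_intrinsicToSupport,
    fun _ _ _ _ _ _ h _ hσ => Trop.WeightedFan.IsQuasilinear.star h hσ,
    ⟨Trop.WeightedFan.quasilinearity_intrinsicToSupport, ?_⟩, ?_⟩
  · intro _ _ _ _ _ _ _ _ S D hS hD hDc hDr _
    exact ⟨fun h => Trop.WeightedFan.IsQuasilinear.prod h hD hDr hDc,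
      fun h => Trop.WeightedFan.IsQuasilinear.of_prod hS hD hDr hDc h⟩
  · intro _ _ _ _ _ _ _ h hφ hdiv
    exact hdiv.elim (fun hd => Trop.WeightedFan.IsQuasilinear.modification_of_trivial h hφ hd)
      fun hd => Trop.WeightedFan.IsQuasilinear.modification_of_divisor h hφ hd
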